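/- Call a polygon $P$ in the Euclidean plane a \emph{reptile} if, for some integer $k\ge 2$, it can be decomposed into $k$ nonoverlapping, pairwise congruent polygons each of which is similar to $P$ (reflected copies are allowed). Let $Q$ be a cyclic quadrilateral with vertices $A,B,C,D$ (in this cyclic order) such that $\overline{CD}=\overline{DA}$ and the angles of $Q$ at $B$ and at $D$ are right angles. If $Q$ is not a square, then $Q$ is not a reptile. -/

import Mathlib

open scoped EuclideanGeometry

/-- The Euclidean plane. -/
abbrev Plane : Type := EuclideanSpace ℝ (Fin 2)

/-- Two figures are congruent if an isometry of the plane (possibly orientation reversing)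
carries one onto the other. -/
def CongruentFigures (S T : Set Plane) : Prop :=
  ∃ f : Plane ≃ᵢ Plane, f '' S = T

/-- Two figures are similar if a similarity of the plane (possibly orientation reversing)
carries one onto the other. -/
def SimilarFigures (S T : Set Plane) : Prop :=
  ∃ f : Plane ≃ᵈ Plane, f '' S = T

/-- `P` is a `k`-reptile: it can be decomposed into `k` nonoverlapping and pairwise congruent
figures that are similar to `P`. -/
def IsKReptile (k : ℕ) (P : Set Plane) : Prop :=
  ∃ T : Fin k → Set Plane,
    (⋃ i, T i) = P ∧
    (∀ i j, i ≠ j → Disjoint (interior (T i)) (interior (T j))) ∧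
    (∀ i j, CongruentFigures (T i) (T j)) ∧
    ∀ i, SimilarFigures P (T i)

/-- `P` is a reptile: it is a `k`-reptile for some `k ≥ 2`. -/
def IsReptile (P : Set Plane) : Prop :=
  ∃ k : ℕ, 2 ≤ k ∧ IsKReptile k P

/-- `A B C D` are, in this cyclic order, the vertices of a cyclic quadrilateral: they are four
distinct points on a circle, and the segments `AC` and `BD` are its (crossing) diagonals. -/
structure IsCyclicQuadrilateral (A B C D : Plane) : Prop where
  injective : Function.Injective ![A, B, C, D]
  cospherical : EuclideanGeometry.Cospherical ({A, B, C, D} : Set Plane)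
  diagonals_cross : (openSegment ℝ A C ∩ openSegment ℝ B D).Nonempty

/-- The closed region bounded by the quadrilateral with vertices `A B C D`. (It is only used for
cyclic quadrilaterals, and these are convex.) -/
def quadRegion (A B C D : Plane) : Set Plane :=
  convexHull ℝ {A, B, C, D}

/-- The quadrilateral `A B C D` is a square: its sides are equal and its angles are right. -/
structure IsSquareQuadrilateral (A B C D : Plane) : Prop where
  sides_BC : dist B C = dist A B
  sides_CD : dist C D = dist A B
  sides_DA : dist D A = dist A B
  angle_A : ∠ D A B = Real.pi / 2
  angle_B : ∠ A B C = Real.pi / 2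
  angle_C : ∠ B C D = Real.pi / 2
  angle_D : ∠ C D A = Real.pi / 2

/-! Scale the pieces so that CD = DA = 1, AB = p, BC = q, with p² + q² = 2 and, by symmetry, q < p.
The angles are right at B and D, α at A and 180° − α at C, where cos α = (p − q)/2; since p < √2,
45° < α < 90°. Hence on one side of a vertex inside a straight line of the dissection the angles are
90° + 90° or α + (180° − α), unless α = 60°, that is, p = 1 + q.

Case p ≠ 1 + q. The supplementary rule (`F.rs`) makes the dissection rigid. Four tiles around a
common vertex D form a square of side p + q, with their vertices B at its corners. In a right angle
of the skeleton the tile on the floor cannot have its vertex D in the corner (`corner_not_DA`,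
`corner_not_DC`). So it has B there, and either the square is completed or one of a few breaks
occurs (`corner_BA`, `corner_BC`). Breaks are excluded by listing the edges along a segment of
length p that ends at an orthogonal ray (`F.not_CD`, `F.CB_special`); only p = 7/5, q = 1/5 needs
extra care. Therefore the side DA of the large quadrilateral carries a row of squares starting at D
(`IsBig.rows`), and the end of this row shows that the tile in the corner A is not homothetic to the
whole (`IsBig.not_homothetic`). That tile has its acute angle at A (`IsBig.corner_A`), so it is a
reflected copy. Dissecting every piece again in the same way gives a dissection whose corner tile is
reflected twice, hence homothetic to the whole: a contradiction (`Rep.false_of_ne`).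

Case p = 1 + q. Here p and q are (√3 ± 1)/2. With k pieces the large side L satisfies L² = k, and L
and Lq are sums of sides 1, p, q of tiles, the second sum not consisting of q alone. Comparing
coefficients of 1 and √3 is contradictory (`IsBig.not_sixty`).

Areas serve only to show that all pieces have the same ratio r with k r² = 1 (`exists_rep`). A tile
is recorded by one of its directed edges, a `Flag`; arguments about angles at a vertex become sign
conditions on short rays. -/

namespace Reptile

/-! ### The tile and its directed edges in coordinates -/

open Filter Topology

/-- Side lengths of the quadrilateral, normalised so that the two equal sides have length `1`:
`AB = p`, `BC = q`, `CD = DA = 1`. -/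
structure Par (p q : ℝ) : Prop where
  hq : 0 < q
  hpq : q < p
  h2 : p ^ 2 + q ^ 2 = 2

namespace Par
variable {p q : ℝ}
lemma p_gt (h : Par p q) : 1 < p := by nlinarith [h.hq, h.hpq, h.h2]
lemma q_lt (h : Par p q) : q < 1 := by nlinarith [h.hq, h.hpq, h.h2]
lemma pp (h : Par p q) : 0 < p := by linarith [h.p_gt]
lemma p_lt (h : Par p q) : p < 3 / 2 := by nlinarith [h.hq, h.hpq, h.h2]
lemma m_pos (h : Par p q) : 0 < p - q := by linarith [h.hpq]
lemma s_lt (h : Par p q) : p + q < 2 := by nlinarith [h.hq, h.hpq, h.h2]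
lemma pq_pos (h : Par p q) : 0 < p * q := mul_pos h.pp h.hq
lemma s_gt (h : Par p q) : 1 < p + q := by linarith [h.p_gt, h.hq]
lemma s_gt' (h : Par p q) : 7 / 5 < p + q := by nlinarith [h.hq, h.hpq, h.h2, h.pq_pos, h.s_gt]
end Par

/-- The angles of the quadrilateral: acute at `A`, right at `B` and `D`, obtuse at `C`. -/
inductive Ang | acute | right | obtuse

/-- Cosine of the exterior angle. -/
noncomputable def Ang.tc (p q : ℝ) : Ang → ℝ
  | acute => -(p - q) / 2
  | right => 0
  | obtuse => (p - q) / 2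

/-- Sine of the exterior angle. -/
noncomputable def Ang.ts (p q : ℝ) : Ang → ℝ
  | acute => (p + q) / 2
  | right => 1
  | obtuse => (p + q) / 2

def Ang.supp : Ang → Ang
  | acute => obtuse
  | right => right
  | obtuse => acute

/-- Types of directed edges having the tile on their left. The types `DA`, `AB`, `BC`, `CD` belong
to positively oriented tiles, the other four to negatively oriented ones. -/
inductive Ty | DA | AB | BC | CD | AD | DC | CB | BA

namespace Ty
def len (p q : ℝ) : Ty → ℝ
  | DA => 1 | AB => p | BC => q | CD => 1
  | AD => 1 | DC => 1 | CB => q | BA => p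

def nx : Ty → Ty
  | DA => AB | AB => BC | BC => CD | CD => DA
  | AD => DC | DC => CB | CB => BA | BA => AD

/-- Angle at the end point. -/
def ea : Ty → Ang
  | DA => .acute | AB => .right | BC => .obtuse | CD => .right
  | AD => .right | DC => .obtuse | CB => .right | BA => .acute

/-- Angle at the starting point. -/
def sa : Ty → Ang
  | DA => .right | AB => .acute | BC => .right | CD => .obtuse
  | AD => .acute | DC => .right | CB => .obtuse | BA => .right

def bar : Ty → Ty
  | DA => AD | AB => BA | BC => CB | CD => DC
  | AD => DA | DC => CD | CB => BC | BA => AB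

lemma sa_nx (τ : Ty) : (nx τ).sa = τ.ea := by cases τ <;> rfl
lemma bar_bar (τ : Ty) : τ.bar.bar = τ := by cases τ <;> rfl
lemma nx_bar_nx (τ : Ty) : (nx τ).bar.nx = τ.bar := by cases τ <;> rfl
lemma len_bar (p q : ℝ) (τ : Ty) : τ.bar.len p q = τ.len p q := by cases τ <;> rfl
lemma sa_bar (τ : Ty) : τ.bar.sa = τ.ea := by cases τ <;> rfl
lemma ea_bar (τ : Ty) : τ.bar.ea = τ.sa := by cases τ <;> rfl
end Ty

lemma Ang.ts_pos {p q : ℝ} (h : Par p q) (a : Ang) : 0 < a.ts p q := by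
  cases a <;> simp only [Ang.ts] <;> linarith [h.hq, h.hpq]

lemma Ang.tc_ts {p q : ℝ} (h : Par p q) (a : Ang) : a.tc p q ^ 2 + a.ts p q ^ 2 = 1 := by
  have := h.h2
  cases a <;> simp only [Ang.ts, Ang.tc] <;> linarith

lemma Ty.len_pos {p q : ℝ} (h : Par p q) (τ : Ty) : 0 < τ.len p q := by
  cases τ <;> simp only [Ty.len] <;> linarith [h.hq, h.hpq]

/-- A directed edge of a tile: its type, starting point and direction. -/
@[ext] structure Flag where
  τ : Ty
  x : ℝ
  y : ℝ
  e : ℝ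
  f : ℝ

namespace Flag
variable {p q : ℝ}

/-- The next edge of the same tile. -/
noncomputable def st (p q : ℝ) (g : Flag) : Flag :=
  ⟨g.τ.nx, g.x + g.τ.len p q * g.e, g.y + g.τ.len p q * g.f,
    g.e * g.τ.ea.tc p q - g.f * g.τ.ea.ts p q, g.e * g.τ.ea.ts p q + g.f * g.τ.ea.tc p q⟩

/-- Signed distance to the line of the edge. -/
def hh (g : Flag) (X Y : ℝ) : ℝ := (Y - g.y) * g.e - (X - g.x) * g.f

/-- The exterior angles add up to a full turn, and the side vectors add up to zero because p² + q² =
2. -/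
lemma st4 (h : Par p q) (g : Flag) : st p q (st p q (st p q (st p q g))) = g := by
  obtain ⟨τ, x, y, e, f⟩ := g
  have h2 := h.h2
  cases τ <;> simp only [st, Ty.nx, Ty.len, Ty.ea, Ang.tc, Ang.ts] <;>
    simp only [Flag.mk.injEq, true_and] <;> refine ⟨?_, ?_, ?_, ?_⟩ <;> grind

def poly (p q : ℝ) (g : Flag) (X Y : ℝ) : Prop :=
  0 ≤ g.hh X Y ∧ 0 ≤ (st p q g).hh X Y ∧ 0 ≤ (st p q (st p q g)).hh X Y ∧
    0 ≤ (st p q (st p q (st p q g))).hh X Y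

def opoly (p q : ℝ) (g : Flag) (X Y : ℝ) : Prop :=
  0 < g.hh X Y ∧ 0 < (st p q g).hh X Y ∧ 0 < (st p q (st p q g)).hh X Y ∧
    0 < (st p q (st p q (st p q g))).hh X Y

lemma poly_st (h : Par p q) (g : Flag) (X Y : ℝ) : poly p q (st p q g) X Y ↔ poly p q g X Y := by
  simp only [poly, st4 h]; tauto

lemma opoly_st (h : Par p q) (g : Flag) (X Y : ℝ) :
    opoly p q (st p q g) X Y ↔ opoly p q g X Y := by
  simp only [opoly, st4 h]; tauto

lemma opoly.poly {g : Flag} {X Y : ℝ} (h : opoly p q g X Y) : poly p q g X Y :=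
  ⟨h.1.le, h.2.1.le, h.2.2.1.le, h.2.2.2.le⟩

def unit (g : Flag) : Prop := g.e ^ 2 + g.f ^ 2 = 1

lemma unit_st (h : Par p q) {g : Flag} (hg : g.unit) : (st p q g).unit := by
  have := Ang.tc_ts h g.τ.ea
  simp only [unit, st] at *
  grind

lemma hh_self (g : Flag) (t r u v : ℝ) :
    g.hh (g.x + t * g.e + r * u) (g.y + t * g.f + r * v) = r * (g.e * v - g.f * u) := by
  simp only [hh]; ring

lemma hh_next {g : Flag} (hg : g.unit) (t r u v : ℝ) :
    (st p q g).hh (g.x + t * g.e + r * u) (g.y + t * g.f + r * v) =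
      (g.τ.len p q - t) * g.τ.ea.ts p q + r * ((st p q g).e * v - (st p q g).f * u) := by
  simp only [hh, st, unit] at *
  grind

lemma hh_prev {g : Flag} (hg : g.unit) (t r u v : ℝ) :
    g.hh ((st p q g).x + t * (st p q g).e + r * u) ((st p q g).y + t * (st p q g).f + r * v) =
      t * g.τ.ea.ts p q + r * (g.e * v - g.f * u) := by
  simp only [hh, st, unit] at *
  grind

/-- The distance to the opposite side is affine along an edge, so the two end points suffice. There
it is a side length times the sine of an angle. -/
lemma hh_opp_pos (h : Par p q) {g : Flag} (hg : g.unit) {t : ℝ} (h0 : 0 ≤ t)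
    (h1 : t ≤ g.τ.len p q) :
    0 < (st p q (st p q g)).hh (g.x + t * g.e) (g.y + t * g.f) := by
  have e1 := hh_next (p := p) (q := q) (unit_st h hg) 0 0 0 0
  have e2 := hh_prev (p := p) (q := q) (unit_st h (unit_st h hg))
    ((st p q (st p q (st p q g))).τ.len p q) 0 0 0
  have e3 : (st p q (st p q (st p q (st p q g)))) = g := st4 h g
  have l1 := mul_pos (Ty.len_pos h (st p q g).τ) (Ang.ts_pos h (st p q g).τ.ea)
  have l2 := mul_pos (Ty.len_pos h (st p q (st p q (st p q g))).τ)
    (Ang.ts_pos h (st p q (st p q g)).τ.ea)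
  have l := Ty.len_pos h g.τ
  generalize st p q (st p q g) = k at *
  have x3 : (st p q k).x + (st p q k).τ.len p q * (st p q k).e = g.x := by rw [← e3]; rfl
  have y3 : (st p q k).y + (st p q k).τ.len p q * (st p q k).f = g.y := by rw [← e3]; rfl
  rw [x3, y3] at e2
  simp only [mul_zero, add_zero, zero_mul, sub_zero] at e1 e2
  rw [← e1] at l1
  rw [← e2] at l2
  have : g.τ.len p q * k.hh (g.x + t * g.e) (g.y + t * g.f) =
      (g.τ.len p q - t) * k.hh g.x g.y + t * k.hh (st p q g).x (st p q g).y := by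
    simp only [hh, st]; ring
  have : 0 < g.τ.len p q * k.hh (g.x + t * g.e) (g.y + t * g.f) := by
    rw [this]
    rcases h0.eq_or_lt with rfl | h0
    · simp; positivity
    · have := mul_pos h0 l1
      have := mul_nonneg (sub_nonneg.2 h1) l2.le
      linarith
  exact (mul_pos_iff_of_pos_left l).1 this

lemma edge_poly (h : Par p q) {g : Flag} (hg : g.unit) {t : ℝ} (h0 : 0 ≤ t)
    (h1 : t ≤ g.τ.len p q) : poly p q g (g.x + t * g.e) (g.y + t * g.f) := by
  have a1 := hh_self g t 0 0 0
  have a2 := hh_next (p := p) (q := q) hg t 0 0 0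
  have a3 := hh_opp_pos h hg h0 h1
  have a4 := hh_prev (p := p) (q := q) (unit_st h (unit_st h (unit_st h hg))) t 0 0 0
  rw [st4 h] at a4
  simp only [mul_zero, add_zero, zero_mul] at a1 a2 a4
  refine ⟨a1.ge, ?_, a3.le, ?_⟩
  · rw [a2]; exact mul_nonneg (by linarith) (Ang.ts_pos h _).le
  · rw [a4]; exact mul_nonneg h0 (Ang.ts_pos h _).le

lemma hh_ray (g : Flag) (X Y u v r : ℝ) :
    g.hh (X + r * u) (Y + r * v) = g.hh X Y + r * (g.e * v - g.f * u) := by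
  simp only [hh]; ring

end Flag

lemma eventually_affine_pos {A B : ℝ} (h : 0 < A ∨ 0 ≤ A ∧ 0 < B) :
    ∀ᶠ r in 𝓝[>] (0 : ℝ), 0 < A + r * B := by
  rcases h with h | ⟨h, h'⟩
  · have : Tendsto (fun r : ℝ => A + r * B) (𝓝[>] 0) (𝓝 (A + 0 * B)) :=
      (Continuous.tendsto (by fun_prop) _).mono_left nhdsWithin_le_nhds
    exact this.eventually (lt_mem_nhds (by simpa using h))
  · filter_upwards [self_mem_nhdsWithin] with r hr
    have := mul_pos (Set.mem_Ioi.1 hr) h'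
    linarith

namespace Flag
variable {p q : ℝ}

lemma eventually_opoly (h : Par p q) {g : Flag} (hg : g.unit) {t u v : ℝ} (h0 : 0 < t)
    (h1 : t < g.τ.len p q) (hc : 0 < g.e * v - g.f * u) :
    ∀ᶠ r in 𝓝[>] (0 : ℝ), opoly p q g (g.x + t * g.e + r * u) (g.y + t * g.f + r * v) := by
  have a4 := hh_prev (p := p) (q := q) (unit_st h (unit_st h (unit_st h hg))) t
  rw [st4 h] at a4
  have a3 := hh_opp_pos h hg h0.le h1.le
  filter_upwards [eventually_affine_pos (A := 0) (.inr ⟨le_rfl, hc⟩),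
    eventually_affine_pos (.inl (mul_pos (sub_pos.2 h1) (Ang.ts_pos h g.τ.ea))),
    eventually_affine_pos (.inl a3),
    eventually_affine_pos (.inl (mul_pos h0 (Ang.ts_pos h _)))] with r h1 h2 h3 h4
  refine ⟨?_, ?_, ?_, ?_⟩
  · rw [hh_self]; simpa using h1
  · rw [hh_next hg]; exact h2
  · rw [hh_ray]; exact h3
  · rw [a4]; exact h4

lemma eventually_opoly_vertex (h : Par p q) {g : Flag} (hg : g.unit) {u v : ℝ}
    (hc : 0 < (st p q g).e * v - (st p q g).f * u) (hc' : 0 < g.e * v - g.f * u) :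
    ∀ᶠ r in 𝓝[>] (0 : ℝ),
      opoly p q (st p q g) ((st p q g).x + r * u) ((st p q g).y + r * v) := by
  have hu := unit_st h hg
  have a4 := hh_prev (p := p) (q := q) hg 0
  have a2 := hh_next (p := p) (q := q) hu 0
  have a1 := hh_self (st p q g) 0
  have a3 := hh_opp_pos h hu le_rfl (Ty.len_pos h _).le
  simp only [zero_mul, add_zero, sub_zero, zero_add] at a1 a2 a3 a4
  filter_upwards [eventually_affine_pos (A := 0) (.inr ⟨le_rfl, hc⟩),
    eventually_affine_pos (.inl (mul_pos (Ty.len_pos h _) (Ang.ts_pos h (st p q g).τ.ea))),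
    eventually_affine_pos (.inl a3),
    eventually_affine_pos (A := 0) (.inr ⟨le_rfl, hc'⟩)] with r h1 h2 h3 h4
  refine ⟨?_, ?_, ?_, ?_⟩
  · rw [a1]; simpa using h1
  · rw [a2]; exact h2
  · rw [hh_ray]; exact h3
  · rw [st4 h, a4]; simpa using h4

lemma exists_opoly (h : Par p q) {g : Flag} (hg : g.unit) : ∃ X Y, opoly p q g X Y := by
  have l := Ty.len_pos h g.τ
  obtain ⟨r, hr⟩ := (eventually_opoly h hg (t := g.τ.len p q / 2) (u := -g.f) (v := g.e)
    (by linarith) (by linarith) (by rw [unit] at hg; linarith)).exists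
  exact ⟨_, _, hr⟩

lemma opoly_toward {g : Flag} {X Y X' Y' r : ℝ} (h : poly p q g X Y)
    (h' : opoly p q g X' Y') (h0 : 0 < r) (h1 : r < 1) :
    opoly p q g (X + r * (X' - X)) (Y + r * (Y' - Y)) := by
  have key : ∀ k : Flag, 0 ≤ k.hh X Y → 0 < k.hh X' Y' →
      0 < k.hh (X + r * (X' - X)) (Y + r * (Y' - Y)) := by
    intro k hk hk'
    have : k.hh (X + r * (X' - X)) (Y + r * (Y' - Y)) = (1 - r) * k.hh X Y + r * k.hh X' Y' := by
      simp only [hh]; ring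
    rw [this]
    have := mul_pos h0 hk'
    have := mul_nonneg (sub_pos.2 h1).le hk
    linarith
  exact ⟨key _ h.1 h'.1, key _ h.2.1 h'.2.1, key _ h.2.2.1 h'.2.2.1, key _ h.2.2.2 h'.2.2.2⟩

lemma opoly.eventually {g : Flag} {X Y : ℝ} (h : opoly p q g X Y) (u v : ℝ) :
    ∀ᶠ r in 𝓝[>] (0 : ℝ), opoly p q g (X + r * u) (Y + r * v) := by
  filter_upwards [eventually_affine_pos (.inl h.1), eventually_affine_pos (.inl h.2.1),
    eventually_affine_pos (.inl h.2.2.1), eventually_affine_pos (.inl h.2.2.2)] with r h1 h2 h3 h4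
  refine ⟨?_, ?_, ?_, ?_⟩ <;> rw [hh_ray] <;> assumption

end Flag
end Reptile
-- Tilings, their skeleton, and tiles along a skeleton ray
namespace Reptile

open Filter Topology

/-- A tiling of a convex region by finitely many unit copies of the quadrilateral. -/
structure Tiling (p q : ℝ) where
  par : Par p q
  Q : ℝ → ℝ → Prop
  conv : ∀ x y x' y' t, Q x y → Q x' y' → 0 ≤ t → t ≤ 1 → Q (x + t * (x' - x)) (y + t * (y' - y))
  ι : Type
  fin : Finite ι
  tile : ι → Flag
  unit : ∀ i, (tile i).unit
  disj : ∀ i j, i ≠ j → ∀ x y, (tile i).opoly p q x y → ¬ (tile j).opoly p q x y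
  cover : ∀ x y, Q x y ↔ ∃ i, (tile i).poly p q x y

namespace Tiling
variable {p q : ℝ}

/-- `g` is an edge of a tile of the tiling. -/
def HasFlag (T : Tiling p q) (g : Flag) : Prop := ∃ i k, (Flag.st p q)^[k] (T.tile i) = g

/-- Some tile has an edge of type `τ` starting at `(x, y)` in direction `(e, f)`. -/
def F (T : Tiling p q) (τ : Ty) (x y e f : ℝ) : Prop := T.HasFlag ⟨τ, x, y, e, f⟩

/-- `(x, y)` is not in the interior of a tile. -/
def Sk (T : Tiling p q) (x y : ℝ) : Prop := ∀ i, ¬ (T.tile i).opoly p q x y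

/-- The skeleton of the tiling. -/
def S (T : Tiling p q) (x y : ℝ) : Prop := T.Sk x y ∧ T.Q x y

/-- A short ray from `(x, y)` in direction `(e, f)` avoids the interiors of the tiles. -/
def Fr (T : Tiling p q) (x y e f : ℝ) : Prop := ∀ᶠ r in 𝓝[>] (0 : ℝ), T.Sk (x + r * e) (y + r * f)

/-- A short ray from `(x, y)` in direction `(e, f)` lies in the skeleton. -/
def SR (T : Tiling p q) (x y e f : ℝ) : Prop := ∀ᶠ r in 𝓝[>] (0 : ℝ), T.S (x + r * e) (y + r * f)

lemma SR.Fr {T : Tiling p q} {x y e f : ℝ} (h : T.SR x y e f) : T.Fr x y e f :=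
  h.mono fun _ h => h.1

lemma HasFlag.st {T : Tiling p q} {g : Flag} (h : T.HasFlag g) : T.HasFlag (g.st p q) := by
  obtain ⟨i, k, rfl⟩ := h
  exact ⟨i, k + 1, by rw [Function.iterate_succ_apply']⟩

lemma HasFlag.prev {T : Tiling p q} {g : Flag} (h : T.HasFlag g) :
    ∃ g', T.HasFlag g' ∧ g'.st p q = g := ⟨_, h.st.st.st, Flag.st4 T.par g⟩

lemma HasFlag.spec {T : Tiling p q} {g : Flag} (h : T.HasFlag g) :
    g.unit ∧ ∃ i, ∀ x y, (g.poly p q x y ↔ (T.tile i).poly p q x y) ∧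
      (g.opoly p q x y ↔ (T.tile i).opoly p q x y) := by
  obtain ⟨i, k, rfl⟩ := h
  induction k with
  | zero => exact ⟨T.unit i, i, fun _ _ => ⟨Iff.rfl, Iff.rfl⟩⟩
  | succ k ih =>
    obtain ⟨hu, j, hj⟩ := ih
    rw [Function.iterate_succ_apply']
    refine ⟨Flag.unit_st T.par hu, j, fun x y => ?_⟩
    rw [Flag.poly_st T.par, Flag.opoly_st T.par]
    exact hj x y

lemma HasFlag.not_sk {T : Tiling p q} {g : Flag} (h : T.HasFlag g) {x y : ℝ}
    (ho : g.opoly p q x y) : ¬ T.Sk x y := by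
  obtain ⟨_, i, hi⟩ := h.spec
  exact fun hs => hs i ((hi x y).2.1 ho)

/-- If a point of the edge were interior to another tile, a small move towards an interior point of
the own tile would reach a common interior point of both. -/
lemma HasFlag.edge {T : Tiling p q} {g : Flag} (h : T.HasFlag g) {t : ℝ} (h0 : 0 ≤ t)
    (h1 : t ≤ g.τ.len p q) : T.S (g.x + t * g.e) (g.y + t * g.f) := by
  obtain ⟨hu, i, hi⟩ := h.spec
  have hp := Flag.edge_poly T.par hu h0 h1
  refine ⟨fun j hj => ?_, (T.cover _ _).2 ⟨i, (hi _ _).1.1 hp⟩⟩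
  by_cases hij : i = j
  · subst hij
    have := ((hi _ _).2.2 hj).1
    have e := Flag.hh_self g t 0 0 0
    simp only [zero_mul, add_zero] at e
    linarith
  · obtain ⟨X, Y, hX⟩ := Flag.exists_opoly T.par hu
    have e1 := Flag.opoly.eventually hj (X - (g.x + t * g.e)) (Y - (g.y + t * g.f))
    have e2 : ∀ᶠ r in 𝓝[>] (0 : ℝ), r < 1 := nhdsWithin_le_nhds (gt_mem_nhds one_pos)
    obtain ⟨r, ⟨hr, hr1⟩, hr0⟩ := ((e1.and e2).and self_mem_nhdsWithin).exists
    exact T.disj i j hij _ _ ((hi _ _).2.1 (Flag.opoly_toward hp hX hr0 hr1)) hr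

lemma F.unit {T : Tiling p q} {τ x y e f} (h : T.F τ x y e f) : e ^ 2 + f ^ 2 = 1 := h.spec.1

lemma F.congr {T : Tiling p q} {τ x y e f x' y' e' f'} (h : T.F τ x y e f) (hx : x' = x)
    (hy : y' = y) (he : e' = e) (hf : f' = f) : T.F τ x' y' e' f' := by
  subst hx hy he hf; exact h

lemma F.nx {T : Tiling p q} {τ x y e f} (h : T.F τ x y e f) :
    T.F τ.nx (x + τ.len p q * e) (y + τ.len p q * f)
      (e * τ.ea.tc p q - f * τ.ea.ts p q) (e * τ.ea.ts p q + f * τ.ea.tc p q) := HasFlag.st h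

lemma F.edge {T : Tiling p q} {τ x y e f} (h : T.F τ x y e f) {t : ℝ} (h0 : 0 ≤ t)
    (h1 : t ≤ τ.len p q) : T.S (x + t * e) (y + t * f) := HasFlag.edge h h0 h1

lemma SR.of_seg {T : Tiling p q} {x y e f X : ℝ} (hX : 0 < X)
    (h : ∀ t, 0 < t → t < X → T.S (x + t * e) (y + t * f)) : T.SR x y e f := by
  filter_upwards [self_mem_nhdsWithin, nhdsWithin_le_nhds (gt_mem_nhds hX)] with r h0 h1
  exact h r h0 h1

lemma F.sr {T : Tiling p q} {τ x y e f} (h : T.F τ x y e f) {t X Y : ℝ} (h0 : 0 ≤ t)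
    (h1 : t < τ.len p q) (hX : X = x + t * e) (hY : Y = y + t * f) : T.SR X Y e f := by
  subst hX hY
  refine SR.of_seg (sub_pos.2 h1) fun r hr hr' => ?_
  have := h.edge (t := t + r) (by linarith) (by linarith)
  convert this using 1 <;> ring

lemma F.sr_neg {T : Tiling p q} {τ x y e f} (h : T.F τ x y e f) {t X Y : ℝ} (h0 : 0 < t)
    (h1 : t ≤ τ.len p q) (hX : X = x + t * e) (hY : Y = y + t * f) : T.SR X Y (-e) (-f) := by
  subst hX hY
  refine SR.of_seg h0 fun r hr hr' => ?_
  have := h.edge (t := t - r) (by linarith) (by linarith)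
  convert this using 1 <;> ring

/-- No free ray leaves an interior point of an edge into the tile. -/
lemma F.nc {T : Tiling p q} {τ x y e f} (h : T.F τ x y e f) {t X Y u v : ℝ} (h0 : 0 < t)
    (h1 : t < τ.len p q) (hX : X = x + t * e) (hY : Y = y + t * f) (hr : T.Fr X Y u v)
    (hc : 0 < e * v - f * u) : False := by
  subst hX hY
  obtain ⟨r, hr, hr'⟩ := (hr.and (Flag.eventually_opoly T.par h.spec.1 h0 h1 hc)).exists
  exact HasFlag.not_sk h hr' hr

/-- No free ray leaves a vertex into the sector of a tile. -/
lemma F.nc0 {T : Tiling p q} {τ x y e f} (h : T.F τ x y e f) {u v : ℝ} (hr : T.Fr x y u v)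
    (hc : 0 < e * v - f * u)
    (hc' : 0 < (e * τ.sa.tc p q + f * τ.sa.ts p q) * v -
      (f * τ.sa.tc p q - e * τ.sa.ts p q) * u) : False := by
  obtain ⟨g, hg, hg'⟩ := HasFlag.prev h
  have hts := Ang.tc_ts T.par g.τ.ea
  have e0 : g.τ.nx = τ := congrArg Flag.τ hg'
  have e3 := congrArg Flag.e hg'
  have e4 := congrArg Flag.f hg'
  simp only [Flag.st] at e3 e4
  -- The vector in `hc'` is the direction of the preceding edge, obtained by turning back through
  -- the exterior angle.
  have := Flag.eventually_opoly_vertex T.par hg.spec.1 (u := u) (v := v) (by rw [hg']; exact hc)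
    (by
      rw [← e0, Ty.sa_nx, ← e3, ← e4] at hc'
      have : g.e * v - g.f * u = (g.e * v - g.f * u) * (g.τ.ea.tc p q ^ 2 + g.τ.ea.ts p q ^ 2) := by
        rw [hts, mul_one]
      rw [this]
      refine hc'.trans_eq ?_
      ring)
  rw [hg'] at this
  obtain ⟨r, hr, hr'⟩ := (hr.and this).exists
  exact HasFlag.not_sk h hr' hr

lemma tri (T : Tiling p q) {x y x1 y1 x2 y2 a b : ℝ} (h : T.Q x y) (h1 : T.Q x1 y1)
    (h2 : T.Q x2 y2) (ha : 0 ≤ a) (hb : 0 ≤ b) (hab : a + b ≤ 1) :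
    T.Q (x + a * (x1 - x) + b * (x2 - x)) (y + a * (y1 - y) + b * (y2 - y)) := by
  rcases (add_nonneg ha hb).eq_or_lt with h0 | h0
  · have : a = 0 := by linarith
    have : b = 0 := by linarith
    subst a b; simpa using h
  · have := T.conv _ _ _ _ (b / (a + b)) h1 h2 (by positivity) ((div_le_one h0).2 (by linarith))
    have := T.conv _ _ _ _ (a + b) h this h0.le hab
    convert this using 1 <;> field_simp <;> ring

/-- Near 0 the sign of a quadratic polynomial is that of its first nonvanishing coefficient. -/
lemma frequently_lex {A B C : ℝ} (h : ∃ᶠ r in 𝓝[>] (0 : ℝ), 0 ≤ A + r * (B + r * C)) :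
    0 < A ∨ A = 0 ∧ (0 < B ∨ B = 0 ∧ 0 ≤ C) := by
  by_contra hn
  push Not at hn
  have ht : Tendsto (fun r : ℝ => A + r * (B + r * C)) (𝓝[>] 0) (𝓝 (A + 0 * (B + 0 * C))) :=
    (Continuous.tendsto (by fun_prop) _).mono_left nhdsWithin_le_nhds
  have ht' : Tendsto (fun r : ℝ => B + r * C) (𝓝[>] 0) (𝓝 (B + 0 * C)) :=
    (Continuous.tendsto (by fun_prop) _).mono_left nhdsWithin_le_nhds
  rcases hn.1.lt_or_eq with hA | hA
  · refine h ((ht.eventually_lt_const (u := 0) (by simpa using hA)).mono fun r hr => ?_)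
    exact not_le.2 hr
  · obtain ⟨hB, hC⟩ := hn.2 hA
    subst hA
    rcases hB.lt_or_eq with hB | hB
    · refine h ?_
      filter_upwards [ht'.eventually_lt_const (u := 0) (by simpa using hB),
        self_mem_nhdsWithin] with r hr h0
      have := mul_neg_of_pos_of_neg (Set.mem_Ioi.1 h0) hr
      linarith
    · have hC' := hC hB
      subst hB
      refine h ?_
      filter_upwards [self_mem_nhdsWithin] with r h0
      have := mul_neg_of_pos_of_neg (mul_pos (Set.mem_Ioi.1 h0) h0) hC'
      nlinarith

/-- The curve is tangent to the ray and bends to its left; it runs inside the triangle spanned by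
the origin of the ray, a further point of the ray and the given point on the left. Tangency is what
forces a tile met by the curve arbitrarily late to touch the ray itself. -/
lemma eventually_parabola (T : Tiling p q) {x y e f u v : ℝ} (he : e ^ 2 + f ^ 2 = 1)
    (h0 : T.Q x y) (hr : T.SR x y e f) (hg : T.Q u v) (hl : 0 < e * (v - y) - f * (u - x)) :
    ∀ᶠ r in 𝓝[>] (0 : ℝ), T.Q (x + r * (e + r * -f)) (y + r * (f + r * e)) := by
  obtain ⟨R, hR, hR0⟩ := (hr.and self_mem_nhdsWithin).exists
  have hR0 : 0 < R := hR0
  set g2 := e * (v - y) - f * (u - x) with hg2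
  set g1 := e * (u - x) + f * (v - y) with hg1
  have ev1 : ∀ᶠ r in 𝓝[>] (0 : ℝ), 0 < 1 + r * (-g1 / g2) := eventually_affine_pos (.inl one_pos)
  have ev2 : ∀ᶠ r in 𝓝[>] (0 : ℝ), r ^ 2 / g2 + r * (1 + r * (-g1 / g2)) / R < 1 := by
    have : Tendsto (fun r : ℝ => r ^ 2 / g2 + r * (1 + r * (-g1 / g2)) / R) (𝓝[>] 0)
        (𝓝 (0 ^ 2 / g2 + 0 * (1 + 0 * (-g1 / g2)) / R)) :=
      (Continuous.tendsto (by fun_prop) _).mono_left nhdsWithin_le_nhds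
    exact this.eventually (gt_mem_nhds (by simp))
  filter_upwards [ev1, ev2, self_mem_nhdsWithin] with r h1 h2 h3
  have h3 : 0 < r := h3
  -- The weight of (u, v) is chosen to give normal component r²; the other weight corrects the
  -- tangential component to r.
  have := T.tri h0 hg hR.2 (a := r ^ 2 / g2) (b := r * (1 + r * (-g1 / g2)) / R)
    (by positivity) (by positivity) h2.le
  have hux : u - x = g1 * e - g2 * f := by rw [hg1, hg2]; linear_combination (x - u) * he
  have hvy : v - y = g1 * f + g2 * e := by rw [hg1, hg2]; linear_combination (y - v) * he
  rw [hux, hvy] at this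
  convert this using 1 <;> field_simp <;> ring

/-- Along the left side of a skeleton ray there is a tile with an edge on the ray. -/
lemma lt (T : Tiling p q) {x y e f u v : ℝ} (he : e ^ 2 + f ^ 2 = 1) (h0 : T.Q x y)
    (hr : T.SR x y e f) (hg : T.Q u v) (hl : 0 < e * (v - y) - f * (u - x)) :
    ∃ τ t, 0 ≤ t ∧ t < τ.len p q ∧ T.F τ (x - t * e) (y - t * f) e f := by
  have := T.fin
  have hQ := T.eventually_parabola he h0 hr hg hl
  -- There are finitely many tiles, so one of them contains points of the parabola for arbitrarily
  -- small r.
  obtain ⟨i, hi⟩ : ∃ i, ∃ᶠ r in 𝓝[>] (0 : ℝ),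
      (T.tile i).poly p q (x + r * (e + r * -f)) (y + r * (f + r * e)) := by
    by_contra hn
    simp only [not_exists, not_frequently] at hn
    obtain ⟨r, h1, h2⟩ := (hQ.and (eventually_all.2 hn)).exists
    obtain ⟨i, hi⟩ := (T.cover _ _).1 h1
    exact h2 i hi
  have key : ∀ g : Flag, (∃ᶠ r in 𝓝[>] (0 : ℝ),
      0 ≤ g.hh (x + r * (e + r * -f)) (y + r * (f + r * e))) →
      0 < g.hh x y ∨ g.hh x y = 0 ∧ (0 < g.e * f - g.f * e ∨
        g.e * f - g.f * e = 0 ∧ 0 ≤ g.e * e + g.f * f) := by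
    intro g hg
    refine frequently_lex (hg.mono fun r hr => ?_)
    refine hr.trans_eq ?_
    simp only [Flag.hh]; ring
  have fin : ∀ g : Flag, T.HasFlag g → g.unit → (∃ᶠ r in 𝓝[>] (0 : ℝ),
      0 ≤ (g.st p q).hh (x + r * (e + r * -f)) (y + r * (f + r * e))) → (∃ᶠ r in 𝓝[>] (0 : ℝ),
      0 ≤ (((g.st p q).st p q).st p q).hh (x + r * (e + r * -f)) (y + r * (f + r * e))) →
      g.hh x y = 0 → g.e * f - g.f * e = 0 → 0 ≤ g.e * e + g.f * f →
      ∃ τ t, 0 ≤ t ∧ t < τ.len p q ∧ T.F τ (x - t * e) (y - t * f) e f := by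
    intro g hT hu k1 k3 hz hc hp
    have hu' : g.e ^ 2 + g.f ^ 2 = 1 := hu
    have hone : g.e * e + g.f * f = 1 := by
      have : (g.e * e + g.f * f) ^ 2 = 1 := by
        linear_combination (g.e ^ 2 + g.f ^ 2) * he + hu' - (g.e * f - g.f * e) * hc
      nlinarith
    have ee : g.e = e := by linear_combination g.f * hc + e * hu' - g.e * hone
    have ff : g.f = f := by linear_combination -g.e * hc + f * hu' - g.f * hone
    set t := (x - g.x) * e + (y - g.y) * f with ht
    have hz' : (y - g.y) * e - (x - g.x) * f = 0 := by rw [← hz, Flag.hh, ee, ff]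
    have hx : g.x = x - t * e := by rw [ht]; linear_combination (x - g.x) * he + f * hz'
    have hy : g.y = y - t * f := by rw [ht]; linear_combination (y - g.y) * he - e * hz'
    have ts1 := Ang.ts_pos T.par g.τ.ea
    have ts3 := Ang.ts_pos T.par (((g.st p q).st p q).st p q).τ.ea
    have n1 := Flag.hh_next (p := p) (q := q) hu t 0 0 0
    have n3 := Flag.hh_prev (p := p) (q := q)
      (Flag.unit_st T.par (Flag.unit_st T.par (Flag.unit_st T.par hu))) t 0 0 0
    rw [Flag.st4 T.par] at n3
    have px : g.x + t * g.e + 0 * 0 = x := by rw [hx, ee]; ring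
    have py : g.y + t * g.f + 0 * 0 = y := by rw [hy, ff]; ring
    rw [px, py, zero_mul, add_zero] at n1 n3
    refine ⟨g.τ, t, ?_, ?_, ?_⟩
    · have : 0 ≤ t * (((g.st p q).st p q).st p q).τ.ea.ts p q := by
        rw [← n3]
        rcases key _ k3 with h | h
        · exact h.le
        · exact h.1.ge
      exact nonneg_of_mul_nonneg_left this ts3
    · have : 0 < (g.τ.len p q - t) * g.τ.ea.ts p q := by
        rw [← n1]
        rcases key _ k1 with h | ⟨_, h⟩
        · exact h
        · exfalso
          have : (g.st p q).e * f - (g.st p q).f * e = - g.τ.ea.ts p q := by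
            simp only [Flag.st, ee, ff]
            linear_combination (-g.τ.ea.ts p q) * he
          rw [this] at h
          rcases h with h | h
          · linarith
          · linarith [h.1]
      have := (pos_iff_pos_of_mul_pos this).2 ts1
      linarith
    · have : g = ⟨g.τ, x - t * e, y - t * f, e, f⟩ := by
        ext1 <;> first | rfl | assumption
      rw [F, ← this]; exact hT
  have hT : T.HasFlag (T.tile i) := ⟨i, 0, rfl⟩
  have u0 := T.unit i
  generalize hg : T.tile i = g at *
  have P := T.par
  have u1 := Flag.unit_st P u0
  have u2 := Flag.unit_st P u1
  have u3 := Flag.unit_st P u2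
  have k0 := hi.mono fun r hr => hr.1
  have k1 := hi.mono fun r hr => hr.2.1
  have k2 := hi.mono fun r hr => hr.2.2.1
  have k3 := hi.mono fun r hr => hr.2.2.2
  have s4 := Flag.st4 P g
  -- If all four sides had the ray eventually on their strict inner side, the ray would enter the
  -- open tile. A side for which this fails lies along the ray, by the second-order information in
  -- `key`.
  have good : ∀ k : Flag, (0 < k.hh x y ∨ 0 ≤ k.hh x y ∧ 0 < k.e * f - k.f * e) →
      ∀ᶠ r in 𝓝[>] (0 : ℝ), 0 < k.hh (x + r * e) (y + r * f) := by
    intro k hk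
    simp only [Flag.hh_ray]
    exact eventually_affine_pos hk
  by_cases b0 : 0 < g.hh x y ∨ 0 ≤ g.hh x y ∧ 0 < g.e * f - g.f * e
  · by_cases b1 : 0 < (g.st p q).hh x y ∨
      0 ≤ (g.st p q).hh x y ∧ 0 < (g.st p q).e * f - (g.st p q).f * e
    · by_cases b2 : 0 < ((g.st p q).st p q).hh x y ∨ 0 ≤ ((g.st p q).st p q).hh x y ∧
        0 < ((g.st p q).st p q).e * f - ((g.st p q).st p q).f * e
      · by_cases b3 : 0 < (((g.st p q).st p q).st p q).hh x y ∨
          0 ≤ (((g.st p q).st p q).st p q).hh x y ∧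
            0 < (((g.st p q).st p q).st p q).e * f - (((g.st p q).st p q).st p q).f * e
        · exfalso
          obtain ⟨r, hr, ⟨⟨h0, h1⟩, h2⟩, h3⟩ := (hr.and ((((good _ b0).and (good _ b1)).and
            (good _ b2)).and (good _ b3))).exists
          exact hT.not_sk ⟨h0, h1, h2, h3⟩ hr.1
        · have := key _ k3
          refine fin _ hT.st.st.st u3 (by rwa [s4]) (by rwa [s4]) ?_ ?_ ?_ <;> grind
      · have := key _ k2
        refine fin _ hT.st.st u2 k3 (by rwa [s4]) ?_ ?_ ?_ <;> grind
    · have := key _ k1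
      refine fin _ hT.st u1 k2 (by rwa [s4]) ?_ ?_ ?_ <;> grind
  · have := key _ k0
    refine fin _ hT u0 k1 k3 ?_ ?_ ?_ <;> grind

end Tiling
end Reptile
-- Rigid motions and reflections of tilings
namespace Reptile

open Filter Topology

namespace Flag
variable {p q : ℝ}

/-- Image of an edge under the inverse of the rigid motion `z ↦ c + u z`. -/
def imv (c1 c2 u1 u2 : ℝ) (g : Flag) : Flag :=
  ⟨g.τ, u1 * (g.x - c1) + u2 * (g.y - c2), -u2 * (g.x - c1) + u1 * (g.y - c2),
    u1 * g.e + u2 * g.f, -u2 * g.e + u1 * g.f⟩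

/-- Image of an edge under the reflection exchanging the coordinates. -/
def swap (p q : ℝ) (g : Flag) : Flag :=
  ⟨g.τ.bar, g.y + g.τ.len p q * g.f, g.x + g.τ.len p q * g.e, -g.f, -g.e⟩

lemma imv_st (c1 c2 u1 u2 : ℝ) (g : Flag) :
    imv c1 c2 u1 u2 (st p q g) = st p q (imv c1 c2 u1 u2 g) := by
  ext1 <;> simp only [imv, st] <;> ring

lemma imv_hh {u1 u2 : ℝ} (c1 c2 : ℝ) (hu : u1 ^ 2 + u2 ^ 2 = 1) (g : Flag) (X Y : ℝ) :
    (imv c1 c2 u1 u2 g).hh X Y = g.hh (c1 + u1 * X - u2 * Y) (c2 + u2 * X + u1 * Y) := by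
  simp only [imv, hh]; grind

lemma swap_hh (g : Flag) (X Y : ℝ) : (swap p q g).hh X Y = g.hh Y X := by
  simp only [swap, hh]; ring

lemma swap_swap (g : Flag) : swap p q (swap p q g) = g := by
  ext1 <;> simp only [swap, Ty.bar_bar, Ty.len_bar] <;> ring

/-- A reflection reverses the order of the sides, so `swap` conjugates `st` into its inverse, which
by `st4` is the third iterate. -/
lemma st_swap_st (h : Par p q) (g : Flag) : st p q (swap p q (st p q g)) = swap p q g := by
  have := Ang.tc_ts h g.τ.ea
  ext1 <;> simp only [swap, st, Ty.nx_bar_nx, Ty.ea_bar, Ty.sa_nx, Ty.len_bar] <;> grind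

lemma swap_poly (h : Par p q) (g : Flag) (X Y : ℝ) :
    (swap p q g).poly p q X Y ↔ g.poly p q Y X := by
  have e1 : st p q (swap p q g) = swap p q (st p q (st p q (st p q g))) := by
    rw [← st_swap_st h (st p q (st p q (st p q g))), st4 h]
  have e2 : st p q (st p q (swap p q g)) = swap p q (st p q (st p q g)) := by
    rw [e1, st_swap_st h]
  have e3 : st p q (st p q (st p q (swap p q g))) = swap p q (st p q g) := by
    rw [e2, st_swap_st h]
  rw [poly, poly, e3, e2, e1]; simp only [swap_hh]; tauto

lemma swap_opoly (h : Par p q) (g : Flag) (X Y : ℝ) :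
    (swap p q g).opoly p q X Y ↔ g.opoly p q Y X := by
  have e1 : st p q (swap p q g) = swap p q (st p q (st p q (st p q g))) := by
    rw [← st_swap_st h (st p q (st p q (st p q g))), st4 h]
  have e2 : st p q (st p q (swap p q g)) = swap p q (st p q (st p q g)) := by
    rw [e1, st_swap_st h]
  have e3 : st p q (st p q (st p q (swap p q g))) = swap p q (st p q g) := by
    rw [e2, st_swap_st h]
  rw [opoly, opoly, e3, e2, e1]; simp only [swap_hh]; tauto

lemma swap_iterate (h : Par p q) (g : Flag) (k : ℕ) :
    ∃ k', (st p q)^[k'] (swap p q g) = swap p q ((st p q)^[k] g) := by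
  induction k with
  | zero => exact ⟨0, rfl⟩
  | succ k ih =>
    obtain ⟨k', hk⟩ := ih
    refine ⟨3 + k', ?_⟩
    rw [Function.iterate_add_apply, hk, Function.iterate_succ_apply' _ k]
    generalize (st p q)^[k] g = g
    rw [← st_swap_st h g]
    exact st4 h _

end Flag

namespace Tiling
variable {p q : ℝ}

/-- The tiling in the coordinates `z'` with `z = c + u z'`. -/
def mv (T : Tiling p q) (c1 c2 u1 u2 : ℝ) (hu : u1 ^ 2 + u2 ^ 2 = 1) : Tiling p q where
  par := T.par
  Q x y := T.Q (c1 + u1 * x - u2 * y) (c2 + u2 * x + u1 * y)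
  conv x y x' y' t h h' h0 h1 := by
    have := T.conv _ _ _ _ t h h' h0 h1
    convert this using 1 <;> ring
  ι := T.ι
  fin := T.fin
  tile i := (T.tile i).imv c1 c2 u1 u2
  unit i := by
    have := T.unit i
    simp only [Flag.unit, Flag.imv] at *
    grind
  disj i j hij x y h h' := by
    refine T.disj i j hij (c1 + u1 * x - u2 * y) (c2 + u2 * x + u1 * y) ?_ ?_
    · simpa only [Flag.opoly, ← Flag.imv_st, Flag.imv_hh c1 c2 hu] using h
    · simpa only [Flag.opoly, ← Flag.imv_st, Flag.imv_hh c1 c2 hu] using h'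
  cover x y := by
    rw [T.cover]
    simp only [Flag.poly, ← Flag.imv_st, Flag.imv_hh c1 c2 hu]

/-- The tiling reflected by exchanging the coordinates. -/
noncomputable def sw (T : Tiling p q) : Tiling p q where
  par := T.par
  Q x y := T.Q y x
  conv x y x' y' t h h' h0 h1 := T.conv _ _ _ _ t h h' h0 h1
  ι := T.ι
  fin := T.fin
  tile i := (T.tile i).swap p q
  unit i := by
    have := T.unit i
    simp only [Flag.unit, Flag.swap] at *
    grind
  disj i j hij x y h h' := by
    rw [Flag.swap_opoly T.par] at h h'
    exact T.disj i j hij _ _ h h'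
  cover x y := by
    rw [T.cover]
    simp only [Flag.swap_poly T.par]

section mv
variable (T : Tiling p q) {c1 c2 u1 u2 : ℝ} (hu : u1 ^ 2 + u2 ^ 2 = 1)

lemma mv_F (τ : Ty) (x y e f : ℝ) : (T.mv c1 c2 u1 u2 hu).F τ x y e f ↔
    T.F τ (c1 + u1 * x - u2 * y) (c2 + u2 * x + u1 * y) (u1 * e - u2 * f) (u2 * e + u1 * f) := by
  have it : ∀ (g : Flag) (k : ℕ), (Flag.st p q)^[k] (g.imv c1 c2 u1 u2) =
      ((Flag.st p q)^[k] g).imv c1 c2 u1 u2 := by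
    intro g k
    induction k with
    | zero => rfl
    | succ k ih => rw [Function.iterate_succ_apply', ih, Function.iterate_succ_apply', Flag.imv_st]
  constructor
  · rintro ⟨i, k, h⟩
    refine ⟨i, k, ?_⟩
    have h' : ((Flag.st p q)^[k] (T.tile i)).imv c1 c2 u1 u2 = ⟨τ, x, y, e, f⟩ := by
      rw [← it]; exact h
    generalize (Flag.st p q)^[k] (T.tile i) = g at h'
    obtain ⟨τ', x', y', e', f'⟩ := g
    simp only [Flag.imv, Flag.mk.injEq] at h' ⊢
    obtain ⟨h1, h2, h3, h4, h5⟩ := h'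
    refine ⟨h1, ?_, ?_, ?_, ?_⟩ <;> grind
  · rintro ⟨i, k, h⟩
    refine ⟨i, k, ?_⟩
    have : (Flag.st p q)^[k] ((T.tile i).imv c1 c2 u1 u2) = ⟨τ, x, y, e, f⟩ := by
      rw [it, h]
      simp only [Flag.imv, Flag.mk.injEq, true_and]
      refine ⟨?_, ?_, ?_, ?_⟩ <;> grind
    exact this

lemma mv_Sk (x y : ℝ) : (T.mv c1 c2 u1 u2 hu).Sk x y ↔
    T.Sk (c1 + u1 * x - u2 * y) (c2 + u2 * x + u1 * y) := by
  simp only [Sk, mv, Flag.opoly, ← Flag.imv_st, Flag.imv_hh c1 c2 hu]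

lemma mv_S (x y : ℝ) : (T.mv c1 c2 u1 u2 hu).S x y ↔
    T.S (c1 + u1 * x - u2 * y) (c2 + u2 * x + u1 * y) := by
  rw [S, S, mv_Sk]; rfl

lemma mv_Fr (x y e f : ℝ) : (T.mv c1 c2 u1 u2 hu).Fr x y e f ↔
    T.Fr (c1 + u1 * x - u2 * y) (c2 + u2 * x + u1 * y) (u1 * e - u2 * f) (u2 * e + u1 * f) := by
  simp only [Fr, mv_Sk]
  refine eventually_congr (.of_forall fun r => ?_)
  rw [show c1 + u1 * (x + r * e) - u2 * (y + r * f) =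
    c1 + u1 * x - u2 * y + r * (u1 * e - u2 * f) by ring,
    show c2 + u2 * (x + r * e) + u1 * (y + r * f) =
    c2 + u2 * x + u1 * y + r * (u2 * e + u1 * f) by ring]

lemma mv_SR (x y e f : ℝ) : (T.mv c1 c2 u1 u2 hu).SR x y e f ↔
    T.SR (c1 + u1 * x - u2 * y) (c2 + u2 * x + u1 * y) (u1 * e - u2 * f) (u2 * e + u1 * f) := by
  simp only [SR, mv_S]
  refine eventually_congr (.of_forall fun r => ?_)
  rw [show c1 + u1 * (x + r * e) - u2 * (y + r * f) =
    c1 + u1 * x - u2 * y + r * (u1 * e - u2 * f) by ring,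
    show c2 + u2 * (x + r * e) + u1 * (y + r * f) =
    c2 + u2 * x + u1 * y + r * (u2 * e + u1 * f) by ring]

end mv

lemma F.sw {T : Tiling p q} {τ x y e f} (h : T.F τ x y e f) :
    T.sw.F τ.bar (y + τ.len p q * f) (x + τ.len p q * e) (-f) (-e) := by
  obtain ⟨i, k, h⟩ := h
  obtain ⟨k', h'⟩ := Flag.swap_iterate T.par (T.tile i) k
  exact ⟨i, k', h'.trans (by rw [h]; rfl)⟩

lemma sw_sw (T : Tiling p q) : T.sw.sw = T := by
  obtain ⟨a1, a2, a3, a4, a5, a6, a7, a8, a9⟩ := T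
  simp only [Tiling.sw, Flag.swap_swap]

lemma F.of_sw {T : Tiling p q} {τ x y e f} (h : T.sw.F τ x y e f) :
    T.F τ.bar (y + τ.len p q * f) (x + τ.len p q * e) (-f) (-e) := by
  have := h.sw
  rwa [sw_sw] at this

lemma sw_Sk (T : Tiling p q) (x y : ℝ) : T.sw.Sk x y ↔ T.Sk y x := by
  simp only [Sk, sw, Flag.swap_opoly T.par]

lemma sw_S (T : Tiling p q) (x y : ℝ) : T.sw.S x y ↔ T.S y x := by
  rw [S, S, sw_Sk]; rfl

lemma sw_Fr (T : Tiling p q) (x y e f : ℝ) : T.sw.Fr x y e f ↔ T.Fr y x f e := by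
  simp only [Fr, sw_Sk]

lemma sw_SR (T : Tiling p q) (x y e f : ℝ) : T.sw.SR x y e f ↔ T.SR y x f e := by
  simp only [SR, sw_S]

/-! ### Angles meeting at a point of the skeleton -/

lemma F.prev {T : Tiling p q} {τ x y e f} (h : T.F τ x y e f) : ∃ τ' : Ty, τ'.nx = τ ∧
    T.F τ' (x - τ'.len p q * (e * τ.sa.tc p q + f * τ.sa.ts p q))
      (y - τ'.len p q * (f * τ.sa.tc p q - e * τ.sa.ts p q))
      (e * τ.sa.tc p q + f * τ.sa.ts p q) (f * τ.sa.tc p q - e * τ.sa.ts p q) := by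
  obtain ⟨g, hg, hg'⟩ := HasFlag.prev h
  obtain ⟨τ', x', y', e', f'⟩ := g
  simp only [Flag.st, Flag.mk.injEq] at hg'
  obtain ⟨h1, h2, h3, h4, h5⟩ := hg'
  have hts := Ang.tc_ts T.par τ.sa
  refine ⟨τ', h1, ?_⟩
  have hs : τ'.ea = τ.sa := by rw [← h1, Ty.sa_nx]
  rw [hs] at h4 h5
  have : T.F τ' x' y' e' f' := hg
  have he : e' = e * τ.sa.tc p q + f * τ.sa.ts p q := by grind
  have hf : f' = f * τ.sa.tc p q - e * τ.sa.ts p q := by grind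
  rw [← he, ← hf]
  exact this.congr (by linarith) (by linarith) rfl rfl

lemma F.sr_prev {T : Tiling p q} {τ x y e f} (h : T.F τ x y e f) :
    T.SR x y (-(e * τ.sa.tc p q + f * τ.sa.ts p q)) (-(f * τ.sa.tc p q - e * τ.sa.ts p q)) := by
  obtain ⟨τ', _, h⟩ := h.prev
  exact h.sr_neg (Ty.len_pos T.par _) le_rfl (by ring) (by ring)

lemma F.inQ {T : Tiling p q} {τ x y e f} (h : T.F τ x y e f) : T.Q x y := by
  have := (h.edge le_rfl (Ty.len_pos T.par _).le).2
  simpa using this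

/-- Two skeleton rays from a point do not form an angle smaller than the acute angle. -/
lemma gap (T : Tiling p q) {x y e f u v : ℝ} (he : e ^ 2 + f ^ 2 = 1) (h0 : T.Q x y)
    (h1 : T.SR x y e f) (h2 : T.SR x y u v) (hc : 0 < e * v - f * u)
    (hc' : 0 < (p + q) * (e * u + f * v) - (p - q) * (e * v - f * u)) : False := by
  obtain ⟨R, hR, hR0⟩ := (h2.and self_mem_nhdsWithin).exists
  have P := T.par
  obtain ⟨τ, t, ht0, ht1, hF⟩ := T.lt he h0 h1 hR.2 (by
    have := mul_pos (Set.mem_Ioi.1 hR0) hc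
    linarith)
  -- If the edge starts at the common point, the tile has an angle of at least α there, so the
  -- second ray enters it; otherwise the ray enters through the relative interior of the edge.
  rcases ht0.eq_or_lt with rfl | ht0
  · have hF : T.F τ x y e f := hF.congr (by ring) (by ring) rfl rfl
    have hm := mul_pos P.m_pos hc
    have hre : 0 < e * u + f * v := by
      have : 0 < p + q := by linarith [P.s_gt]
      by_contra hn
      nlinarith
    have hs : 0 < (p + q) * (e * u + f * v) := mul_pos (by linarith [P.s_gt]) hre
    refine hF.nc0 h2.Fr hc ?_
    cases τ.sa <;> simp only [Ang.tc, Ang.ts] <;> linarith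
  · exact hF.nc ht0 ht1 (by ring) (by ring) h2.Fr hc

/-- Along the right side of a skeleton ray there is a tile with an edge on the ray. -/
lemma rt (T : Tiling p q) {x y e f u v : ℝ} (he : e ^ 2 + f ^ 2 = 1) (h0 : T.Q x y)
    (hr : T.SR x y e f) (hg : T.Q u v) (hl : e * (v - y) - f * (u - x) < 0) :
    ∃ τ t, 0 < t ∧ t ≤ τ.len p q ∧ T.F τ (x + t * e) (y + t * f) (-e) (-f) := by
  obtain ⟨τ, t, h1, h2, h3⟩ := T.sw.lt (x := y) (y := x) (e := f) (f := e) (u := v) (v := u)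
    (by linarith) h0 ((T.sw_SR _ _ _ _).2 hr) hg (by linarith)
  refine ⟨τ.bar, τ.len p q - t, by linarith, by rw [Ty.len_bar]; linarith,
    h3.of_sw.congr (by ring) (by ring) rfl rfl⟩

/-- If a skeleton ray prolongs an edge, then the tile on the same side has an edge starting
there. -/
lemma F.follow {T : Tiling p q} {τ x y e f X Y} (h : T.F τ x y e f)
    (hX : X = x + τ.len p q * e) (hY : Y = y + τ.len p q * f) (hr : T.SR X Y e f) :
    ∃ τ' : Ty, T.F τ' X Y e f ∧ (τ.ea = .obtuse → τ'.sa = .acute) := by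
  subst hX hY
  have P := T.par
  have hu := h.unit
  have hts := Ang.ts_pos P τ.ea
  have h1 := h.nx
  have r1 := (h1.sr le_rfl (Ty.len_pos P _) (X := x + τ.len p q * e) (Y := y + τ.len p q * f)
    (by ring) (by ring)).Fr
  obtain ⟨τ', t, ht0, ht1, hF⟩ := T.lt hu h1.inQ hr (h1.edge (Ty.len_pos P _).le le_rfl).2 (by
    have : 0 < τ.nx.len p q * τ.ea.ts p q * (e ^ 2 + f ^ 2) := by
      rw [hu, mul_one]; exact mul_pos (Ty.len_pos P _) hts
    linarith)
  have hc : 0 < e * (e * τ.ea.ts p q + f * τ.ea.tc p q) -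
      f * (e * τ.ea.tc p q - f * τ.ea.ts p q) := by
    have : 0 < τ.ea.ts p q * (e ^ 2 + f ^ 2) := by rw [hu, mul_one]; exact hts
    linarith
  rcases ht0.eq_or_lt with rfl | ht0
  · have hF := hF.congr (x' := x + τ.len p q * e) (y' := y + τ.len p q * f) (e' := e) (f' := f)
      (by ring) (by ring) rfl rfl
    -- After an obtuse angle only α is left; a right or obtuse angle would contain the next side of
    -- the first tile.
    refine ⟨τ', hF, fun ho => ?_⟩
    rw [ho] at hc r1
    by_contra hn
    refine hF.nc0 r1 hc ?_
    have ms := mul_pos P.m_pos (show 0 < p + q by linarith [P.s_gt])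
    have mm := P.m_pos
    rcases hs : τ'.sa
    · exact absurd hs hn
    · simp only [Ang.tc, Ang.ts]
      have : 0 < (p - q) * (e ^ 2 + f ^ 2) := by rw [hu, mul_one]; exact mm
      linarith
    · simp only [Ang.tc, Ang.ts]
      have : 0 < (p - q) * (p + q) * (e ^ 2 + f ^ 2) := by rw [hu, mul_one]; exact ms
      linarith
  · exact (hF.nc ht0 ht1 (by ring) (by ring) r1 hc).elim

/-- The remaining part of the straight angle has to be filled. Since 45° < α < 90°, a wrong choice
of the next angle either overlaps the first tile or leaves a gap smaller than α. The only delicate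
choice is α after α. -/
lemma F.rs {T : Tiling p q} (ne : p ≠ 1 + q) {τ x y e f X Y} (h : T.F τ x y e f)
    (hX : X = x + τ.len p q * e) (hY : Y = y + τ.len p q * f) (hr : T.SR X Y e f) :
    ∃ τ' : Ty, T.F τ' X Y e f ∧ τ'.sa = τ.ea.supp := by
  obtain ⟨τ', hF, ho⟩ := h.follow hX hY hr
  subst hX hY
  have P := T.par
  have hu := h.unit
  have hq := P.hq
  have hp := P.pp
  have h2 := P.h2
  have mm := P.m_pos
  have ms := mul_pos mm (show 0 < p + q by linarith)
  have pq := P.pq_pos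
  refine ⟨τ', hF, ?_⟩
  by_contra hn
  have h1 := h.nx
  have r1 := h1.sr le_rfl (Ty.len_pos P _) (X := x + τ.len p q * e) (Y := y + τ.len p q * f)
    (by ring) (by ring)
  have rp := hF.sr_prev
  have up : (e ^ 2 + f ^ 2) * 1 = 1 := by rw [mul_one, hu]
  rcases hea : τ.ea
  · rw [hea] at r1 hn
    rcases hs : τ'.sa
    · rw [hs] at rp
      simp only [Ang.tc, Ang.ts] at r1 rp
      have u1 : (-(e * (-(p - q) / 2) + f * ((p + q) / 2))) ^ 2 +
        (-(f * (-(p - q) / 2) - e * ((p + q) / 2))) ^ 2 = 1 := by grind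
      -- Two angles α leave 180° − 2α. For α > 60° this is less than α. For α < 60° it is larger
      -- than α but less than 90°, so a third tile would have to use α and leave 180° − 3α, again
      -- positive and less than α.
      rcases lt_or_gt_of_ne (show p - q ≠ 1 by intro h; apply ne; linarith) with hm | hm
      · refine T.gap u1 h1.inQ rp r1 ?_ ?_
        · refine (half_pos ms).trans_eq ?_
          grind
        · have : 0 < (p + q) * (1 - (p - q) ^ 2) := mul_pos (by linarith) (by nlinarith)
          refine this.trans_eq ?_
          grind
      · obtain ⟨τ3, t, ht0, ht1, h3⟩ := T.lt u1 h1.inQ rp (h1.edge (Ty.len_pos P _).le le_rfl).2 (by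
          rw [hea]; simp only [Ang.tc, Ang.ts]
          have := mul_pos (Ty.len_pos P τ.nx) (half_pos ms)
          refine this.trans_eq ?_
          grind)
        rcases ht0.eq_or_lt with rfl | ht0
        · have h3 := h3.congr (x' := x + τ.len p q * e) (y' := y + τ.len p q * f)
            (by ring) (by ring) rfl rfl
          rcases hs3 : τ3.sa
          · have rp3 := h3.sr_prev
            rw [hs3] at rp3
            simp only [Ang.tc, Ang.ts] at rp3
            refine T.gap ?_ h1.inQ rp3 r1 ?_ ?_
            · grind
            · have : 0 < (p + q) * ((p - q) ^ 2 - 1) / 2 :=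
                div_pos (mul_pos (by linarith) (by nlinarith)) two_pos
              refine this.trans_eq ?_
              grind
            · have := mul_pos two_pos (mul_pos pq ms)
              refine this.trans_eq ?_
              grind
          · refine h3.nc0 r1.Fr ?_ ?_
            · refine (half_pos ms).trans_eq ?_
              grind
            · rw [hs3]; simp only [Ang.tc, Ang.ts]
              refine pq.trans_eq ?_
              grind
          · refine h3.nc0 r1.Fr ?_ ?_
            · refine (half_pos ms).trans_eq ?_
              grind
            · rw [hs3]; simp only [Ang.tc, Ang.ts]
              have : 0 < (p + q) / 2 := by linarith
              refine this.trans_eq ?_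
              grind
        · refine h3.nc ht0 ht1 (by ring) (by ring) r1.Fr ?_
          refine (half_pos ms).trans_eq ?_
          grind
    · rw [hs] at rp
      simp only [Ang.tc, Ang.ts] at r1 rp
      refine T.gap ?_ h1.inQ rp r1 ?_ ?_
      · grind
      · have : 0 < (p - q) / 2 := by linarith
        refine this.trans_eq ?_
        grind
      · have : 0 < 2 * (p * q) := by linarith
        refine this.trans_eq ?_
        grind
    · exact hn hs
  · rw [hea] at r1 hn
    rcases hs : τ'.sa
    · rw [hs] at rp
      simp only [Ang.tc, Ang.ts] at r1 rp
      refine T.gap ?_ h1.inQ rp r1 ?_ ?_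
      · grind
      · have : 0 < (p - q) / 2 := by linarith
        refine this.trans_eq ?_
        grind
      · have : 0 < 2 * (p * q) := by linarith
        refine this.trans_eq ?_
        grind
    · exact hn hs
    · refine hF.nc0 r1.Fr ?_ ?_
      · simp only [Ang.tc, Ang.ts]
        refine one_pos.trans_eq ?_
        grind
      · rw [hs]; simp only [Ang.tc, Ang.ts]
        have : 0 < (p - q) / 2 := by linarith
        refine this.trans_eq ?_
        grind
  · exact hn (by rw [ho hea, hea]; rfl)

lemma F.rs_neg {T : Tiling p q} (ne : p ≠ 1 + q) {τ x y e f} (h : T.F τ x y e f)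
    (hr : T.SR x y (-e) (-f)) :
    ∃ τ' : Ty, T.F τ' (x - τ'.len p q * e) (y - τ'.len p q * f) e f ∧ τ'.ea = τ.sa.supp := by
  obtain ⟨τ', h1, h2⟩ := h.sw.rs ne (X := y) (Y := x) (by rw [Ty.len_bar]; ring)
    (by rw [Ty.len_bar]; ring) ((T.sw_SR _ _ _ _).2 hr)
  refine ⟨τ'.bar, h1.of_sw.congr ?_ ?_ ?_ ?_, ?_⟩
  · rw [Ty.len_bar]; ring
  · rw [Ty.len_bar]; ring
  · ring
  · ring
  · rw [Ty.ea_bar, h2, Ty.ea_bar]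

end Tiling
end Reptile
-- Edges along a segment of length p ending at an orthogonal ray
namespace Reptile

open Filter Topology

namespace Ty
lemma of_sa_acute {τ : Ty} (h : τ.sa = .acute) : τ = AB ∨ τ = AD := by
  cases τ <;> simp_all [sa]
lemma of_sa_right {τ : Ty} (h : τ.sa = .right) : τ = DA ∨ τ = BC ∨ τ = DC ∨ τ = BA := by
  cases τ <;> simp_all [sa]
lemma of_sa_obtuse {τ : Ty} (h : τ.sa = .obtuse) : τ = CD ∨ τ = CB := by
  cases τ <;> simp_all [sa]
lemma of_ea_acute {τ : Ty} (h : τ.ea = .acute) : τ = DA ∨ τ = BA := by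
  cases τ <;> simp_all [ea]
lemma of_ea_right {τ : Ty} (h : τ.ea = .right) : τ = AB ∨ τ = CD ∨ τ = AD ∨ τ = CB := by
  cases τ <;> simp_all [ea]
lemma of_ea_obtuse {τ : Ty} (h : τ.ea = .obtuse) : τ = BC ∨ τ = DC := by
  cases τ <;> simp_all [ea]
end Ty

namespace Tiling
variable {p q : ℝ}

lemma F.to {T : Tiling p q} {τ x y e f x' y' e' f'} (h : T.F τ x y e f)
    (H : x' = x ∧ y' = y ∧ e' = e ∧ f' = f) : T.F τ x' y' e' f' :=
  h.congr H.1 H.2.1 H.2.2.1 H.2.2.2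

lemma SR.to {T : Tiling p q} {x y e f x' y' e' f'} (h : T.SR x y e f)
    (H : x' = x ∧ y' = y ∧ e' = e ∧ f' = f) : T.SR x' y' e' f' := by
  obtain ⟨rfl, rfl, rfl, rfl⟩ := H; exact h

lemma Fr.to {T : Tiling p q} {x y e f x' y' e' f'} (h : T.Fr x y e f)
    (H : x' = x ∧ y' = y ∧ e' = e ∧ f' = f) : T.Fr x' y' e' f' := by
  obtain ⟨rfl, rfl, rfl, rfl⟩ := H; exact h

/-- Edges on a segment of length `p` of the skeleton can be continued up to a skeleton ray
orthogonal to the segment at its end. -/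
lemma F.climb {T : Tiling p q} (ne : p ≠ 1 + q) (hseg : ∀ t, 0 < t → t < p → T.S t 0)
    (hK : T.SR p 0 0 1) {τ : Ty} {x x' : ℝ} (h : T.F τ x' 0 1 0) (hx' : x = x' + τ.len p q)
    (h0 : 0 < x) (h1 : x < p) :
    ∃ τ' : Ty, T.F τ' x 0 1 0 ∧ τ'.sa = τ.ea.supp ∧
      (x + τ'.len p q < p ∨ (x + τ'.len p q = p ∧ τ'.ea = .right)) := by
  have P := T.par
  obtain ⟨τ', hF, hs⟩ := h.rs ne (X := x) (Y := 0) (by linarith) (by ring)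
    (SR.of_seg (sub_pos.2 h1) fun t ht ht' => by
      have := hseg (x + t) (by linarith) (by linarith)
      simpa using this)
  refine ⟨τ', hF, hs, ?_⟩
  rcases lt_trichotomy (x + τ'.len p q) p with hl | hl | hl
  · exact .inl hl
  · refine .inr ⟨hl, ?_⟩
    have hn := hF.nx
    have hmm := P.m_pos
    have hpq := P.pq_pos
    have h2 := P.h2
    -- An acute angle at the end leaves 90° − α < α next to the orthogonal ray; an obtuse one
    -- contains that ray.
    rcases hea : τ'.ea
    · exfalso
      rw [hea] at hn
      simp only [Ang.tc, Ang.ts] at hn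
      refine T.gap (by norm_num) hn.inQ (hK.to ⟨by linarith, by ring, rfl, rfl⟩)
        (hn.sr le_rfl (Ty.len_pos P _) (by ring) (by ring)) ?_ ?_
      · linarith
      · nlinarith
    · rfl
    · exfalso
      rw [hea] at hn
      simp only [Ang.tc, Ang.ts] at hn
      refine hn.nc0 (hK.Fr.to ⟨by linarith, by ring, rfl, rfl⟩) ?_ ?_
      · linarith
      · rw [Ty.sa_nx, hea]; simp only [Ang.tc, Ang.ts]; nlinarith
  · exact (hF.nc (t := p - x) (by linarith) (by linarith) (by ring) (by ring) hK.Fr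
      (by norm_num)).elim

/-- As p < 3/2, the edge of length 1 can only be followed by `BC`. This ends in an obtuse angle, so
it cannot finish the segment, and the acute angle coming next belongs to an edge of length at least
1, which does not fit. -/
lemma not_CD_base {T : Tiling p q} (ne : p ≠ 1 + q) (hseg : ∀ t, 0 < t → t < p → T.S t 0)
    (hK : T.SR p 0 0 1) (h : T.F .CD 0 0 1 0) : False := by
  have P := T.par
  have := P.p_gt
  have := P.p_lt
  have hq := P.hq
  obtain ⟨τ, h1, s1, l1⟩ := h.climb ne hseg hK (x := 1) (by simp [Ty.len]) one_pos P.p_gt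
  rcases Ty.of_sa_right s1 with rfl | rfl | rfl | rfl <;> simp [Ty.len, Ty.ea] at l1 <;>
    try linarith
  obtain ⟨τ, h2, s2, l2⟩ := h1.climb ne hseg hK (x := 1 + q) (by simp [Ty.len]) (by linarith) l1
  rcases Ty.of_sa_acute s2 with rfl | rfl <;> simp [Ty.len, Ty.ea] at l2
  · rcases l2 with h | h <;> linarith
  · rcases l2 with h | h <;> linarith

/-- Supplementary angles and lengths leave only rows of total length 1 + 2q. Then p = 1 + 2q and p²
+ q² = 2 give (5q − 1)(q + 1) = 0. -/
lemma CB_base_cases {T : Tiling p q} (ne : p ≠ 1 + q) (hseg : ∀ t, 0 < t → t < p → T.S t 0)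
    (hK : T.SR p 0 0 1) (h : T.F .CB 0 0 1 0) : p = 7 / 5 ∧ q = 1 / 5 ∧
      (T.F .DA q 0 1 0 ∧ T.F .CB (1 + q) 0 1 0 ∨ T.F .BC q 0 1 0 ∧ T.F .AD (2 * q) 0 1 0) := by
  have P := T.par
  have := P.p_gt
  have := P.p_lt
  have hq := P.hq
  have fin : 1 + 2 * q = p → p = 7 / 5 ∧ q = 1 / 5 := by
    intro h
    have h2 := P.h2
    rw [← h] at h2
    have : (5 * q - 1) * (q + 1) = 0 := by linarith
    rcases mul_eq_zero.1 this with h | h <;> constructor <;> linarith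
  obtain ⟨τ, h1, s1, l1⟩ := h.climb ne hseg hK (x := q) (by simp [Ty.len]) hq P.hpq
  rcases Ty.of_sa_right s1 with rfl | rfl | rfl | rfl <;> simp [Ty.len, Ty.ea] at l1
  · obtain ⟨τ, h2, s2, l2⟩ := h1.climb ne hseg hK (x := q + 1) (by simp [Ty.len]) (by linarith) l1
    rcases Ty.of_sa_obtuse s2 with rfl | rfl <;> simp [Ty.len, Ty.ea] at l2
    · rcases l2 with h | h <;> linarith
    · rcases l2 with hl | hl
      · exfalso
        obtain ⟨τ, h3, s3, l3⟩ := h2.climb ne hseg hK (x := q + 1 + q) (by simp [Ty.len])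
          (by linarith) hl
        rcases Ty.of_sa_right s3 with rfl | rfl | rfl | rfl <;> simp [Ty.len, Ty.ea] at l3 <;>
          try linarith
        obtain ⟨τ, h4, s4, l4⟩ := h3.climb ne hseg hK (x := q + 1 + q + q) (by simp [Ty.len])
          (by linarith) l3
        rcases Ty.of_sa_acute s4 with rfl | rfl <;> simp [Ty.len, Ty.ea] at l4 <;>
        · rcases l4 with h | h <;> linarith
      · obtain ⟨e1, e2⟩ := fin (by linarith)
        exact ⟨e1, e2, .inl ⟨h1, h2.to ⟨by ring, rfl, rfl, rfl⟩⟩⟩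
  · obtain ⟨τ, h2, s2, l2⟩ := h1.climb ne hseg hK (x := q + q) (by simp [Ty.len]) (by linarith) l1
    rcases Ty.of_sa_acute s2 with rfl | rfl <;> simp [Ty.len, Ty.ea] at l2
    · rcases l2 with h | h <;> linarith
    · rcases l2 with hl | hl
      · exfalso
        obtain ⟨τ, h3, s3, l3⟩ := h2.climb ne hseg hK (x := q + q + 1) (by simp [Ty.len])
          (by linarith) hl
        rcases Ty.of_sa_right s3 with rfl | rfl | rfl | rfl <;> simp [Ty.len, Ty.ea] at l3 <;>
          try linarith
        obtain ⟨τ, h4, s4, l4⟩ := h3.climb ne hseg hK (x := q + q + 1 + q) (by simp [Ty.len])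
          (by linarith) l3
        rcases Ty.of_sa_acute s4 with rfl | rfl <;> simp [Ty.len, Ty.ea] at l4 <;>
        · rcases l4 with h | h <;> linarith
      · obtain ⟨e1, e2⟩ := fin (by linarith)
        exact ⟨e1, e2, .inr ⟨h1, h2.to ⟨by ring, rfl, rfl, rfl⟩⟩⟩
  · exfalso
    obtain ⟨τ, h2, s2, l2⟩ := h1.climb ne hseg hK (x := q + 1) (by simp [Ty.len]) (by linarith) l1
    rcases Ty.of_sa_acute s2 with rfl | rfl <;> simp [Ty.len, Ty.ea] at l2 <;>
    · rcases l2 with h | h <;> linarith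
  · linarith

/-- On the left of a segment of length `p` in the skeleton which ends at an orthogonal skeleton ray
there cannot start an edge `CD`. -/
lemma F.not_CD {T : Tiling p q} (ne : p ≠ 1 + q) {x y e f : ℝ} (h : T.F .CD x y e f)
    (hseg : ∀ t, 0 < t → t < p → T.S (x + t * e) (y + t * f))
    (hK : T.SR (x + p * e) (y + p * f) (-f) e) : False := by
  have hu := h.unit
  refine not_CD_base (T := T.mv x y e f hu) ne (fun t ht ht' => ?_) ?_ ?_
  · rw [mv_S]
    convert hseg t ht ht' using 1 <;> ring
  · rw [mv_SR]
    exact hK.to ⟨by ring, by ring, by ring, by ring⟩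
  · rw [mv_F]
    exact h.to ⟨by ring, by ring, by ring, by ring⟩

/-- The mirror image of `F.not_CD`. -/
lemma F.not_DC {T : Tiling p q} (ne : p ≠ 1 + q) {x y e f X Y : ℝ} (h : T.F .DC X Y (-e) (-f))
    (hX : X = x + e) (hY : Y = y + f)
    (hseg : ∀ t, 0 < t → t < p → T.S (x + t * e) (y + t * f))
    (hK : T.SR (x + p * e) (y + p * f) f (-e)) : False := by
  subst hX hY
  refine F.not_CD (T := T.sw) ne (x := y) (y := x) (e := f) (f := e) ?_ (fun t ht ht' => ?_) ?_
  · exact h.sw.to (by simp [Ty.len])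
  · rw [sw_S]; exact hseg t ht ht'
  · rw [sw_SR]; exact hK

/-- The vertex C of the middle tile lies inside the long side of the first one. The acute angle
supplementary to the obtuse one there prolongs the side CB of the middle tile beyond B. So the side
AB of the middle tile is a segment of length p ending at an orthogonal ray, and the third tile puts
a `DC` on it, against `F.not_DC`. -/
lemma not_row_CB_DA_CB {T : Tiling (7 / 5) (1 / 5)} (h1 : T.F .CB 0 0 1 0)
    (h2 : T.F .DA (1 / 5) 0 1 0) (h3 : T.F .CB (6 / 5) 0 1 0) : False := by
  have k1 : T.F .BA (1 / 5) 0 0 1 := h1.nx.to (by norm_num [Ty.len, Ty.ea, Ang.tc, Ang.ts])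
  have a1 : T.F .AB (6 / 5) 0 (-3 / 5) (4 / 5) :=
    h2.nx.to (by norm_num [Ty.len, Ty.ea, Ang.tc, Ang.ts])
  have a2 : T.F .BC (9 / 25) (28 / 25) (-4 / 5) (-3 / 5) :=
    a1.nx.to (by norm_num [Ty.len, Ty.ea, Ang.tc, Ang.ts])
  have a3 : T.F .CD (1 / 5) 1 0 (-1) := a2.nx.to (by norm_num [Ty.len, Ty.ea, Ang.tc, Ang.ts])
  have b1 : T.F .BA (7 / 5) 0 0 1 := h3.nx.to (by norm_num [Ty.len, Ty.ea, Ang.tc, Ang.ts])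
  have b2 : T.F .AD (7 / 5) (7 / 5) (-4 / 5) (-3 / 5) :=
    b1.nx.to (by norm_num [Ty.len, Ty.ea, Ang.tc, Ang.ts])
  have b3 : T.F .DC (3 / 5) (4 / 5) (-(-3 / 5)) (-(4 / 5)) :=
    b2.nx.to (by norm_num [Ty.len, Ty.ea, Ang.tc, Ang.ts])
  obtain ⟨τ, g1, gs⟩ := a3.rs_neg (by norm_num)
    ((k1.sr (t := 1) (X := 1 / 5) (Y := 1) (by norm_num) (by norm_num [Ty.len]) (by norm_num)
      (by norm_num)).to (by norm_num))
  have g2 : T.SR (9 / 25) (28 / 25) (4 / 5) (3 / 5) := by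
    rcases Ty.of_ea_acute gs with rfl | rfl <;>
    · have : T.F _ (1 / 5) 1 (4 / 5) (3 / 5) :=
        g1.nx.to (by norm_num [Ty.len, Ty.ea, Ang.tc, Ang.ts])
      exact this.sr (t := 1 / 5) (by norm_num) (by norm_num [Ty.len, Ty.nx]) (by norm_num)
        (by norm_num)
  refine b3.not_DC (by norm_num) (x := 6 / 5) (y := 0) (by norm_num) (by norm_num) (fun t h0 h1 => ?_)
    (g2.to (by norm_num))
  exact a1.edge h0.le h1.le

/-- The point (7/5, 1) is the vertex C of the third tile. The tiles on the other side of its side AB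
overrun B, so AB is prolonged there and a second right angle lies opposite to the one at B. The edge
of that neighbour along BC either ends at C with another obtuse angle or passes beyond C; in both
cases it blocks the two directions. -/
lemma not_Fr_of_row_CB_BC_AD {T : Tiling (7 / 5) (1 / 5)} (h2 : T.F .BC (1 / 5) 0 1 0)
    (h3 : T.F .AD (2 / 5) 0 1 0) : ¬ T.Fr (7 / 5) 1 0 1 ∧ ¬ T.Fr (7 / 5) 1 (4 / 5) (3 / 5) := by
  have a1 : T.F .DC (7 / 5) 0 0 1 := h3.nx.to (by norm_num [Ty.len, Ty.ea, Ang.tc, Ang.ts])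
  have a2 : T.F .CB (7 / 5) 1 (-4 / 5) (3 / 5) :=
    a1.nx.to (by norm_num [Ty.len, Ty.ea, Ang.tc, Ang.ts])
  have a3 : T.F .BA (31 / 25) (28 / 25) (-(3 / 5)) (-(4 / 5)) :=
    a2.nx.to (by norm_num [Ty.len, Ty.ea, Ang.tc, Ang.ts])
  have b1 : T.F .CD (2 / 5) 0 (3 / 5) (4 / 5) :=
    h2.nx.to (by norm_num [Ty.len, Ty.ea, Ang.tc, Ang.ts])
  obtain ⟨τ, g1, gs⟩ := b1.rs (by norm_num) (X := 1) (Y := 4 / 5) (by norm_num [Ty.len])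
    (by norm_num [Ty.len]) ((a3.sr_neg (t := 2 / 5) (X := 1) (Y := 4 / 5) (by norm_num)
      (by norm_num [Ty.len]) (by norm_num) (by norm_num)).to (by norm_num))
  have far : T.SR (31 / 25) (28 / 25) (3 / 5) (4 / 5) := by
    rcases Ty.of_sa_right gs with rfl | rfl | rfl | rfl
    · exact g1.sr (t := 2 / 5) (by norm_num) (by norm_num [Ty.len]) (by norm_num) (by norm_num)
    · obtain ⟨τ, k1, ks⟩ := g1.rs (by norm_num) (X := 28 / 25) (Y := 24 / 25)
        (by norm_num [Ty.len]) (by norm_num [Ty.len])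
        ((a3.sr_neg (t := 1 / 5) (X := 28 / 25) (Y := 24 / 25) (by norm_num)
          (by norm_num [Ty.len]) (by norm_num) (by norm_num)).to (by norm_num))
      rcases Ty.of_sa_acute ks with rfl | rfl <;>
        exact k1.sr (t := 1 / 5) (by norm_num) (by norm_num [Ty.len]) (by norm_num) (by norm_num)
    · exact g1.sr (t := 2 / 5) (by norm_num) (by norm_num [Ty.len]) (by norm_num) (by norm_num)
    · exact g1.sr (t := 2 / 5) (by norm_num) (by norm_num [Ty.len]) (by norm_num) (by norm_num)
  obtain ⟨τ, g1, gs⟩ := a3.rs_neg (by norm_num) (far.to (by norm_num))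
  have main : ∀ u v : ℝ, (u = 0 ∧ v = 1) ∨ (u = 4 / 5 ∧ v = 3 / 5) → ¬ T.Fr (7 / 5) 1 u v := by
    intro u v huv hr
    rcases Ty.of_ea_right gs with rfl | rfl | rfl | rfl
    · have c1 : T.F .BC (31 / 25) (28 / 25) (4 / 5) (-3 / 5) :=
        g1.nx.to (by norm_num [Ty.len, Ty.ea, Ang.tc, Ang.ts])
      have c2 : T.F .CD (7 / 5) 1 (24 / 25) (7 / 25) :=
        c1.nx.to (by norm_num [Ty.len, Ty.ea, Ang.tc, Ang.ts])
      refine c2.nc0 hr ?_ ?_ <;> rcases huv with ⟨rfl, rfl⟩ | ⟨rfl, rfl⟩ <;>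
        norm_num [Ty.sa, Ang.tc, Ang.ts]
    all_goals
      have c1 : T.F _ (31 / 25) (28 / 25) (4 / 5) (-3 / 5) :=
        g1.nx.to (by norm_num [Ty.len, Ty.ea, Ang.tc, Ang.ts])
      refine c1.nc (t := 1 / 5) (by norm_num) (by norm_num [Ty.len, Ty.nx]) (by norm_num)
        (by norm_num) hr ?_
      rcases huv with ⟨rfl, rfl⟩ | ⟨rfl, rfl⟩ <;> norm_num
  exact ⟨main 0 1 (.inl ⟨rfl, rfl⟩), main _ _ (.inr ⟨rfl, rfl⟩)⟩

lemma CB_base {T : Tiling p q} (ne : p ≠ 1 + q) (hseg : ∀ t, 0 < t → t < p → T.S t 0)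
    (hK : T.SR p 0 0 1) (h : T.F .CB 0 0 1 0) : p = 7 / 5 ∧ q = 1 / 5 ∧
      T.F .AD (2 / 5) 0 1 0 ∧ ¬ T.Fr (7 / 5) 1 0 1 ∧ ¬ T.Fr (7 / 5) 1 (4 / 5) (3 / 5) := by
  obtain ⟨rfl, rfl, h'⟩ := CB_base_cases ne hseg hK h
  refine ⟨rfl, rfl, ?_⟩
  rcases h' with ⟨h1, h2⟩ | ⟨h1, h2⟩
  · exact (not_row_CB_DA_CB h h1 (h2.to (by norm_num))).elim
  · have h2 := h2.to (x' := 2 / 5) (y' := 0) (e' := 1) (f' := 0) (by norm_num)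
    exact ⟨h2, not_Fr_of_row_CB_BC_AD h1 h2⟩

/-- On the left of a segment of length `p` in the skeleton which ends at an orthogonal skeleton ray
an edge `CB` can start only for one value of the parameters. -/
lemma F.CB_special {T : Tiling p q} (ne : p ≠ 1 + q) {x y e f : ℝ} (h : T.F .CB x y e f)
    (hseg : ∀ t, 0 < t → t < p → T.S (x + t * e) (y + t * f))
    (hK : T.SR (x + p * e) (y + p * f) (-f) e) : p = 7 / 5 ∧ q = 1 / 5 ∧
      T.F .AD (x + 2 / 5 * e) (y + 2 / 5 * f) e f ∧
      ¬ T.Fr (x + 7 / 5 * e - f) (y + 7 / 5 * f + e) (-f) e ∧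
      ¬ T.Fr (x + 7 / 5 * e - f) (y + 7 / 5 * f + e)
        (4 / 5 * e - 3 / 5 * f) (4 / 5 * f + 3 / 5 * e) := by
  have hu := h.unit
  have := CB_base (T := T.mv x y e f hu) ne (fun t ht ht' => ?_) ?_ ?_
  · obtain ⟨h1, h2, h3, h4, h5⟩ := this
    rw [mv_Fr] at h4 h5
    rw [mv_F] at h3
    refine ⟨h1, h2, h3.to ⟨by ring, by ring, by ring, by ring⟩, fun h => h4 (h.to ?_),
      fun h => h5 (h.to ?_)⟩ <;> refine ⟨by ring, by ring, by ring, by ring⟩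
  · rw [mv_S]
    convert hseg t ht ht' using 1 <;> ring
  · rw [mv_SR]
    exact hK.to ⟨by ring, by ring, by ring, by ring⟩
  · rw [mv_F]
    exact h.to ⟨by ring, by ring, by ring, by ring⟩

/-- The mirror image of `F.CB_special`. -/
lemma F.BC_special {T : Tiling p q} (ne : p ≠ 1 + q) {x y e f X Y : ℝ} (h : T.F .BC X Y (-e) (-f))
    (hX : X = x + q * e) (hY : Y = y + q * f)
    (hseg : ∀ t, 0 < t → t < p → T.S (x + t * e) (y + t * f))
    (hK : T.SR (x + p * e) (y + p * f) f (-e)) : p = 7 / 5 ∧ q = 1 / 5 ∧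
      T.F .DA (x + 7 / 5 * e) (y + 7 / 5 * f) (-e) (-f) ∧
      ¬ T.Fr (x + 7 / 5 * e + f) (y + 7 / 5 * f - e) f (-e) ∧
      ¬ T.Fr (x + 7 / 5 * e + f) (y + 7 / 5 * f - e)
        (4 / 5 * e + 3 / 5 * f) (4 / 5 * f - 3 / 5 * e) := by
  subst hX hY
  have := F.CB_special (T := T.sw) ne (x := y) (y := x) (e := f) (f := e) ?_ (fun t ht ht' => ?_) ?_
  · obtain ⟨h1, h2, h3, h4, h5⟩ := this
    rw [sw_Fr] at h4 h5
    refine ⟨h1, h2, h3.of_sw.to ?_, h4, h5⟩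
    simp only [Ty.len, and_true]
    constructor <;> ring
  · exact h.sw.to (by simp [Ty.len])
  · rw [sw_S]; exact hseg t ht ht'
  · rw [sw_SR]; exact hK

end Tiling
end Reptile
-- Tiles in a right angle of the skeleton and the square of four tiles
namespace Reptile

open Filter Topology

namespace Tiling
variable {p q : ℝ}

lemma S.sr {T : Tiling p q} {x y e f X : ℝ} (h : ∀ t, 0 < t → t < X → T.S (x + t * e) (y + t * f))
    {t X' Y' : ℝ} (h0 : 0 ≤ t) (h1 : t < X) (hX : X' = x + t * e) (hY : Y' = y + t * f) :
    T.SR X' Y' e f := by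
  subst hX hY
  refine SR.of_seg (sub_pos.2 h1) fun r hr hr' => ?_
  have := h (t + r) (by linarith) (by linarith)
  convert this using 1 <;> ring

lemma floor_sr {T : Tiling p q} {X : ℝ} (h : ∀ t, 0 < t → t < X → T.S t 0) {t : ℝ} (h0 : 0 ≤ t)
    (h1 : t < X) : T.SR t 0 1 0 :=
  S.sr (x := 0) (y := 0) (by simpa using h) h0 h1 (by ring) (by ring)

lemma bar_sr {T : Tiling p q} {X : ℝ} (h : ∀ t, 0 < t → t < X → T.S 0 t) {t : ℝ} (h0 : 0 ≤ t)
    (h1 : t < X) : T.SR 0 t 0 1 :=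
  S.sr (x := 0) (y := 0) (by simpa using h) h0 h1 (by ring) (by ring)

lemma F.prev_CD {T : Tiling p q} {x y e f} (h : T.F .CD x y e f) :
    T.F .BC (x - q * (e * ((p - q) / 2) + f * ((p + q) / 2)))
      (y - q * (f * ((p - q) / 2) - e * ((p + q) / 2)))
      (e * ((p - q) / 2) + f * ((p + q) / 2)) (f * ((p - q) / 2) - e * ((p + q) / 2)) := by
  obtain ⟨τ, h1, h2⟩ := h.prev
  cases τ <;> simp [Ty.nx] at h1
  exact h2

lemma F.prev_CB {T : Tiling p q} {x y e f} (h : T.F .CB x y e f) :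
    T.F .DC (x - 1 * (e * ((p - q) / 2) + f * ((p + q) / 2)))
      (y - 1 * (f * ((p - q) / 2) - e * ((p + q) / 2)))
      (e * ((p - q) / 2) + f * ((p + q) / 2)) (f * ((p - q) / 2) - e * ((p + q) / 2)) := by
  obtain ⟨τ, h1, h2⟩ := h.prev
  cases τ <;> simp [Ty.nx] at h1
  exact h2

/-- Right angled start of the row at a right angle of the skeleton. -/
lemma corner_start {T : Tiling p q} {X Y : ℝ} (hX : 0 < X) (hY : 0 < Y) (h0 : T.Q 0 0)
    (floor : ∀ t, 0 < t → t < X → T.S t 0) (bar : ∀ t, 0 < t → t < Y → T.S 0 t) :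
    ∃ τ : Ty, T.F τ 0 0 1 0 ∧ τ.sa = .right := by
  have P := T.par
  have h2 := P.h2
  have rb := bar_sr bar le_rfl hY
  obtain ⟨τ, t, ht0, ht1, hF⟩ := T.lt (by norm_num) h0 (floor_sr floor le_rfl hX)
    (bar (Y / 2) (by linarith) (by linarith)).2 (by linarith)
  rcases ht0.eq_or_lt with rfl | ht0
  · have hF := hF.congr (x' := 0) (y' := 0) (by ring) (by ring) rfl rfl
    refine ⟨τ, hF, ?_⟩
    have := P.m_pos
    have := P.pq_pos
    rcases hs : τ.sa
    -- An acute angle leaves 90° − α < α.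
    · exfalso
      have rp := hF.sr_prev
      rw [hs] at rp
      simp only [Ang.tc, Ang.ts] at rp
      refine T.gap ?_ h0 rp rb ?_ ?_
      · grind
      · have : 0 < (p + q) / 2 - (p - q) / 2 * 0 := by linarith [P.s_gt]
        linarith
      · nlinarith
    · rfl
    · exfalso
      refine hF.nc0 rb.Fr (by norm_num) ?_
      rw [hs]; simp only [Ang.tc, Ang.ts]
      linarith
  · exact (hF.nc ht0 ht1 (by ring) (by ring) rb.Fr (by norm_num)).elim

/-- Let the tile have D in the corner. The wall continues above its vertex C, so the acute angle
there prolongs CB beyond B: the side AB is a segment of length p ending at an orthogonal ray. The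
obtuse angle following A on the floor puts a `BC` or a `DC` on this segment. The latter is excluded
by `F.not_DC`, the former reduces to p = 7/5, q = 1/5. -/
lemma corner_not_DA {T : Tiling p q} (ne : p ≠ 1 + q) {X Y : ℝ} (hX : 1 < X) (hY : 1 < Y)
    (floor : ∀ t, 0 < t → t < X → T.S t 0) (bar : ∀ t, 0 < t → t < Y → T.S 0 t) :
    ¬ T.F .DA 0 0 1 0 := by
  intro h
  have P := T.par
  have h2 := P.h2
  have hq := P.hq
  have hq1 := P.q_lt
  have hp1 := P.p_gt
  have a1 : T.F .AB 1 0 (-(p - q) / 2) ((p + q) / 2) := h.nx.to (by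
    simp [Ty.len, Ty.ea, Ang.tc, Ang.ts])
  have a2 : T.F .BC (q * (p + q) / 2) (1 + q * (p - q) / 2) (-(p + q) / 2) (-(p - q) / 2) :=
    a1.nx.to (by
      simp only [Ty.len, Ty.ea, Ang.tc, Ang.ts]
      refine ⟨?_, ?_, ?_, ?_⟩ <;> grind)
  have a3 : T.F .CD 0 1 0 (-1) := a2.nx.to (by
      simp only [Ty.len, Ty.ea, Ang.tc, Ang.ts]
      refine ⟨?_, ?_, ?_, ?_⟩ <;> grind)
  obtain ⟨τ, g0, gs⟩ := a3.rs_neg ne ((bar_sr bar zero_le_one hY).to (by norm_num))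
  have g1 : T.F .AB 0 1 ((p + q) / 2) ((p - q) / 2) ∨ T.F .AD 0 1 ((p + q) / 2) ((p - q) / 2) := by
    rcases Ty.of_ea_acute gs with rfl | rfl
    · exact .inl (g0.nx.to (by
        simp only [Ty.len, Ty.ea, Ang.tc, Ang.ts]
        refine ⟨?_, ?_, ?_, ?_⟩ <;> ring))
    · exact .inr (g0.nx.to (by
        simp only [Ty.len, Ty.ea, Ang.tc, Ang.ts]
        refine ⟨?_, ?_, ?_, ?_⟩ <;> ring))
  have g2 : T.SR (q * (p + q) / 2) (1 + q * (p - q) / 2) ((p + q) / 2) ((p - q) / 2) := by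
    rcases g1 with g1 | g1 <;>
    exact g1.sr (t := q) hq.le (by simp only [Ty.len]; linarith) (by ring) (by ring)
  have g3 : T.SR (1 + p * (-(p - q) / 2)) (0 + p * ((p + q) / 2)) ((p + q) / 2)
      (-(-(p - q) / 2)) := g2.to (by refine ⟨?_, ?_, ?_, ?_⟩ <;> grind)
  obtain ⟨τ, k0, ks⟩ := h.rs ne (X := 1) (Y := 0) (by simp [Ty.len]) (by simp)
    (floor_sr floor zero_le_one hX)
  rcases Ty.of_sa_obtuse ks with rfl | rfl
  · have k1 := k0.prev_CD
    obtain ⟨e1, e2, s1, s2, s3⟩ := F.BC_special ne (x := 1) (y := 0) (e := -(p - q) / 2)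
      (f := (p + q) / 2) (X := 1 + q * (-(p - q) / 2)) (Y := 0 + q * ((p + q) / 2))
      (k1.to (by refine ⟨?_, ?_, ?_, ?_⟩ <;> ring)) (by ring) (by ring)
      (fun t h0 h1 => a1.edge h0.le h1.le) g3
    subst e1 e2
    have s2 : ¬ T.Fr (24 / 25) (43 / 25) (4 / 5) (3 / 5) := fun h => s2 (h.to (by norm_num))
    have s3 : ¬ T.Fr (24 / 25) (43 / 25) 0 1 := fun h => s3 (h.to (by norm_num))
    -- For the special parameters the tile with the acute angle at C yields a forbidden ray. An `AB`
    -- passes the critical point; an `AD` is continued by an edge that passes it too, or by a `BC`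
    -- that ends there and is followed by a vertical `CD`.
    rcases g1 with g1 | g1
    · exact s2 (((g1.sr (t := 6 / 5) (by norm_num) (by norm_num [Ty.len]) rfl rfl).Fr).to
        (by norm_num))
    · obtain ⟨τ0, hτ, d0⟩ := s1.prev
      cases τ0 <;> simp [Ty.nx] at hτ
      have d1 : T.F .CD (24 / 25) (43 / 25) (-(4 / 5)) (-(3 / 5)) :=
        d0.to (by norm_num [Ty.len, Ty.sa, Ang.tc, Ang.ts])
      obtain ⟨τ, c1, cs⟩ := g1.rs ne (X := 4 / 5) (Y := 8 / 5) (by norm_num [Ty.len])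
        (by norm_num [Ty.len]) ((d1.sr_neg (t := 1 / 5) (X := 4 / 5) (Y := 8 / 5) (by norm_num)
        (by norm_num [Ty.len]) (by norm_num) (by norm_num)).to (by norm_num))
      rcases Ty.of_sa_right cs with rfl | rfl | rfl | rfl
      · exact s2 (((c1.sr (t := 1 / 5) (by norm_num) (by norm_num [Ty.len]) rfl rfl).Fr).to
          (by norm_num))
      · have c2 : T.F .CD (24 / 25) (43 / 25) 0 1 :=
          c1.nx.to (by norm_num [Ty.len, Ty.ea, Ang.tc, Ang.ts])
        exact s3 ((c2.sr (t := 0) le_rfl (by norm_num [Ty.len]) (by norm_num) (by norm_num)).Fr)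
      · exact s2 (((c1.sr (t := 1 / 5) (by norm_num) (by norm_num [Ty.len]) rfl rfl).Fr).to
          (by norm_num))
      · exact s2 (((c1.sr (t := 1 / 5) (by norm_num) (by norm_num [Ty.len]) rfl rfl).Fr).to
          (by norm_num))
  · have k1 := k0.prev_CB
    exact F.not_DC ne (x := 1) (y := 0) (e := -(p - q) / 2)
      (f := (p + q) / 2) (X := 1 + (-(p - q) / 2)) (Y := 0 + ((p + q) / 2))
      (k1.to (by refine ⟨?_, ?_, ?_, ?_⟩ <;> ring)) (by ring) (by ring)
      (fun t h0 h1 => a1.edge h0.le h1.le) g3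

lemma corner_not_DC {T : Tiling p q} (ne : p ≠ 1 + q) {X Y : ℝ} (hX : 1 < X) (hY : 1 < Y)
    (floor : ∀ t, 0 < t → t < X → T.S t 0) (bar : ∀ t, 0 < t → t < Y → T.S 0 t) :
    ¬ T.F .DC 0 0 1 0 := by
  intro h
  refine corner_not_DA (T := T.sw) ne hY hX (fun t => by rw [sw_S]; exact bar t)
    (fun t => by rw [sw_S]; exact floor t) ?_
  obtain ⟨τ0, hτ, d0⟩ := h.prev
  cases τ0 <;> simp [Ty.nx] at hτ
  exact d0.sw.to (by simp [Ty.len, Ty.sa, Ang.tc, Ang.ts])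

/-- These edges descend along the side AD of the corner tile and must not cross the floor. A `BA` is
too long, and a `BC` is followed by an acute angle on an edge of length at least 1, also too long.
Only an edge of length exactly r = 1 remains. -/
lemma row_down {T : Tiling p q} (ne : p ≠ 1 + q) {X : ℝ} (hX : p < X)
    (floor : ∀ t, 0 < t → t < X → T.S t 0)
    (hA : T.F .AD p 0 (-(p - q) / 2) ((p + q) / 2)) {r : ℝ} {σ : Ty} (hr : q < r) (hr1 : r ≤ 1)
    (h : T.F σ (p - r * ((p - q) / 2)) (r * ((p + q) / 2)) ((p - q) / 2) (-((p + q) / 2)))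
    (hs : σ.sa = .right) : r = 1 ∧ (σ = .DA ∨ σ = .DC) := by
  have P := T.par
  have hq := P.hq
  have hp1 := P.p_gt
  have beyond : ∀ (σ : Ty) (r : ℝ), 0 < r → r < σ.len p q →
      T.F σ (p - r * ((p - q) / 2)) (r * ((p + q) / 2)) ((p - q) / 2) (-((p + q) / 2)) → False := by
    intro σ r h0 h1 h
    refine h.nc (t := r) h0 h1 (X := p) (Y := 0) (by ring) (by ring)
      (floor_sr floor P.pp.le hX).Fr ?_
    linarith
  rcases Ty.of_sa_right hs with rfl | rfl | rfl | rfl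
  · refine ⟨?_, .inl rfl⟩
    by_contra hn
    exact beyond .DA r (by linarith) (lt_of_le_of_ne hr1 hn) h
  · exfalso
    obtain ⟨τ, k, ks⟩ := h.rs ne (X := p - (r - q) * ((p - q) / 2)) (Y := (r - q) * ((p + q) / 2))
      (by simp only [Ty.len]; ring) (by simp only [Ty.len]; ring)
      ((hA.sr_neg (t := r - q) (by linarith) (by simp only [Ty.len]; linarith) rfl rfl).to
        (by refine ⟨?_, ?_, ?_, ?_⟩ <;> ring))
    refine beyond _ _ (by linarith) ?_ k
    rcases Ty.of_sa_acute ks with rfl | rfl <;> simp only [Ty.len] <;> linarith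
  · refine ⟨?_, .inr rfl⟩
    by_contra hn
    exact beyond .DC r (by linarith) (lt_of_le_of_ne hr1 hn) h
  · exfalso
    exact beyond _ r (by linarith) (by simp only [Ty.len]; linarith) h

/-- The tiles around a tile `BA` in a right angle of the skeleton. -/
lemma corner_BA {T : Tiling p q} (ne : p ≠ 1 + q) {X Y gx gy : ℝ} (hX : p < X) (hY : q < Y)
    (floor : ∀ t, 0 < t → t < X → T.S t 0) (bar : ∀ t, 0 < t → t < Y → T.S 0 t)
    (hg : T.Q gx gy) (hgy : p + q < gy) (h : T.F .BA 0 0 1 0) :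
    (T.F .BA (p + q) 0 0 1 ∧ (T.F .CB (p + q) p 0 (-1) ∨ T.F .CD (p + q) p 0 (-1))) ∨
    (∀ t, 0 ≤ t → t ≤ p + q → T.S (p + q) t ∧ T.S t (p + q)) ∨
    (T.F .CB q (p + q) (-1) 0 ∧ ∃ τ : Ty, T.F τ (q - τ.len p q) (p + q) 1 0 ∧
      (τ.ea = .acute ∨ τ.ea = .right)) := by
  have P := T.par
  have h2 := P.h2
  have hq := P.hq
  have hq1 := P.q_lt
  have hp1 := P.p_gt
  have hs2 := P.s_lt
  have mm := P.m_pos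
  have pq := P.pq_pos
  have ms := mul_pos mm (show 0 < p + q by linarith)
  have a1 : T.F .AD p 0 (-(p - q) / 2) ((p + q) / 2) := h.nx.to (by
    simp [Ty.len, Ty.ea, Ang.tc, Ang.ts])
  have a2 : T.F .DC ((p + q) / 2) ((p + q) / 2) (-((p + q) / 2)) (-((p - q) / 2)) :=
    a1.nx.to (by
      simp only [Ty.len, Ty.ea, Ang.tc, Ang.ts]
      refine ⟨?_, ?_, ?_, ?_⟩ <;> ring)
  have a3 : T.F .CB 0 q 0 (-1) := a2.nx.to (by
      simp only [Ty.len, Ty.ea, Ang.tc, Ang.ts]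
      refine ⟨?_, ?_, ?_, ?_⟩ <;> grind)
  obtain ⟨τv, v1, vs⟩ := h.rs ne (X := p) (Y := 0) (by simp [Ty.len]) (by simp)
    (floor_sr floor P.pp.le hX)
  have down : ∀ σ : Ty, T.F σ ((p + q) / 2) ((p + q) / 2) ((p - q) / 2) (-((p + q) / 2)) →
      σ.sa = .right → σ = .DC := by
    intro σ hσ hs
    obtain ⟨-, rfl | rfl⟩ := row_down ne hX floor a1 hq1 le_rfl
      (hσ.to (by refine ⟨?_, ?_, ?_, ?_⟩ <;> ring)) hs
    -- A `DA` would bring a second angle α to the point (p, 0), where the corner tile and the obtuse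
    -- angle on the floor already fill the straight angle.
    · exfalso
      have k : T.F .AB p 0 (p * q) ((p - q) * (p + q) / 2) := hσ.nx.to (by
        simp only [Ty.len, Ty.ea, Ang.tc, Ang.ts]
        refine ⟨?_, ?_, ?_, ?_⟩ <;> ring)
      refine v1.nc0 (k.sr (t := 0) (X := p) (Y := 0) le_rfl (Ty.len_pos P _) (by ring)
        (by ring)).Fr ?_ ?_
      · linarith
      · rw [vs]; simp only [Ty.ea, Ang.supp, Ang.tc, Ang.ts]
        have : 0 < (p + q) / 2 := by linarith
        refine this.trans_eq ?_
        grind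
    · rfl
  have cdown : ∀ σ : Ty, T.F σ ((p + q) / 2) ((p + q) / 2) ((p - q) / 2) (-((p + q) / 2)) →
      σ.sa = .right → T.F .BA (p + q) 0 0 1 := by
    intro σ hσ hs
    obtain rfl := down σ hσ hs
    have k : T.F .CB p 0 1 0 := hσ.nx.to (by
      simp only [Ty.len, Ty.ea, Ang.tc, Ang.ts]
      refine ⟨?_, ?_, ?_, ?_⟩ <;> grind)
    exact k.nx.to (by simp [Ty.len, Ty.ea, Ang.tc, Ang.ts])
  -- Above the obtuse angle at C the wall carries an acute one. If its upper side is an `AB`, it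
  -- overruns the centre D of the prospective square, giving the break to the right; if it is an
  -- `AD`, the second tile of the square is in place.
  obtain ⟨τ, g0, gs⟩ := a3.rs_neg ne ((bar_sr bar hq.le hY).to (by norm_num))
  rcases Ty.of_ea_acute gs with rfl | rfl
  · left
    have b1 : T.F .AB 0 q ((p + q) / 2) ((p - q) / 2) := g0.nx.to (by
        simp only [Ty.len, Ty.ea, Ang.tc, Ang.ts]
        refine ⟨?_, ?_, ?_, ?_⟩ <;> ring)
    obtain ⟨τ, c0, cs⟩ := a2.rs_neg ne ((b1.sr (t := 1) zero_le_one
      (by simp only [Ty.len]; linarith) rfl rfl).to (by refine ⟨?_, ?_, ?_, ?_⟩ <;> ring))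
    have cs : τ.ea = .right := cs
    have c1 : T.F τ.nx ((p + q) / 2) ((p + q) / 2) ((p - q) / 2) (-((p + q) / 2)) := c0.nx.to (by
        simp only [cs, Ang.tc, Ang.ts]
        refine ⟨?_, ?_, ?_, ?_⟩ <;> ring)
    have hBA := cdown _ c1 (by rw [Ty.sa_nx, cs])
    have hDC := down _ c1 (by rw [Ty.sa_nx, cs])
    have : τ = .AD := by cases τ <;> simp_all [Ty.nx]
    subst this
    have c2 : T.F .AD (p + q) p (-((p + q) / 2)) (-((p - q) / 2)) := c0.to (by
        simp only [Ty.len]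
        refine ⟨?_, ?_, ?_, ?_⟩ <;> grind)
    -- The edges above the line through C and D overrun the point (p + q, p), so the angle of the
    -- tile beyond that point is the supplement of α.
    have far : T.SR (p + q) p ((p + q) / 2) ((p - q) / 2) := by
      obtain ⟨τ, d1, ds⟩ := b1.rs ne (X := p * ((p + q) / 2)) (Y := q + p * ((p - q) / 2))
        (by simp [Ty.len]) (by simp [Ty.len])
        ((c2.sr_neg (t := 2 - p) (by linarith) (by simp only [Ty.len]; linarith) rfl rfl).to
          (by refine ⟨?_, ?_, ?_, ?_⟩ <;> ring))
      have done : ∀ τ : Ty, T.F τ (p * ((p + q) / 2)) (q + p * ((p - q) / 2)) ((p + q) / 2)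
          ((p - q) / 2) → 1 ≤ τ.len p q → T.SR (p + q) p ((p + q) / 2) ((p - q) / 2) :=
        fun τ h hl => h.sr (t := 2 - p) (by linarith) (by linarith) (by ring) (by ring)
      rcases Ty.of_sa_right ds with rfl | rfl | rfl | rfl
      · exact done _ d1 (by simp [Ty.len])
      · obtain ⟨τ, e1, es⟩ := d1.rs ne (X := (p + q) * ((p + q) / 2))
          (Y := q + (p + q) * ((p - q) / 2))
          (by simp only [Ty.len]; ring) (by simp only [Ty.len]; ring)
          ((c2.sr_neg (t := 2 - (p + q)) (by linarith) (by simp only [Ty.len]; linarith) rfl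
            rfl).to (by refine ⟨?_, ?_, ?_, ?_⟩ <;> ring))
        refine e1.sr (t := 2 - (p + q)) (by linarith) ?_ (by ring) (by ring)
        rcases Ty.of_sa_acute es with rfl | rfl <;> simp only [Ty.len] <;> linarith
      · exact done _ d1 (by simp [Ty.len])
      · exact done _ d1 (by simp only [Ty.len]; linarith)
    obtain ⟨τ, d1, ds⟩ := c2.rs_neg ne (far.to (by simp))
    refine ⟨hBA, ?_⟩
    rcases Ty.of_ea_obtuse ds with rfl | rfl
    · refine .inr (d1.nx.to (by
        simp only [Ty.ea, Ang.tc, Ang.ts]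
        refine ⟨?_, ?_, ?_, ?_⟩ <;> grind))
    · refine .inl (d1.nx.to (by
        simp only [Ty.ea, Ang.tc, Ang.ts]
        refine ⟨?_, ?_, ?_, ?_⟩ <;> grind))
  · right
    have b1 : T.F .AD 0 q ((p + q) / 2) ((p - q) / 2) := g0.nx.to (by
        simp only [Ty.len, Ty.ea, Ang.tc, Ang.ts]
        refine ⟨?_, ?_, ?_, ?_⟩ <;> ring)
    have b2 : T.F .DC ((p + q) / 2) ((p + q) / 2) (-(p - q) / 2) ((p + q) / 2) := b1.nx.to (by
        simp only [Ty.len, Ty.ea, Ang.tc, Ang.ts]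
        refine ⟨?_, ?_, ?_, ?_⟩ <;> ring)
    have b3 : T.F .CB q (p + q) (-1) 0 := b2.nx.to (by
        simp only [Ty.len, Ty.ea, Ang.tc, Ang.ts]
        refine ⟨?_, ?_, ?_, ?_⟩ <;> grind)
    have rb2 : T.SR q (p + q) ((p - q) / 2) (-((p + q) / 2)) :=
      (b2.sr_neg (t := 1) one_pos le_rfl rfl rfl).to (by refine ⟨?_, ?_, ?_, ?_⟩ <;> ring)
    -- A tile with its acute angle at (q, p + q) either is the third tile of the square, which then
    -- forces the fourth, or has an `AB` along the line, which overruns the centre and contradicts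
    -- `row_down`.
    have full : ∀ σ : Ty, T.F σ q (p + q) ((p - q) / 2) (-((p + q) / 2)) → σ.sa = .acute →
        ∀ t, 0 ≤ t → t ≤ p + q → T.S (p + q) t ∧ T.S t (p + q) := by
      intro σ hσ hs
      rcases Ty.of_sa_acute hs with rfl | rfl
      · exfalso
        obtain ⟨τ, d1, ds⟩ := hσ.rs ne (X := p - (2 - p) * ((p - q) / 2))
          (Y := (2 - p) * ((p + q) / 2))
          (by simp only [Ty.len]; ring) (by simp only [Ty.len]; ring)
          ((a1.sr_neg (t := 2 - p) (by linarith) (by simp only [Ty.len]; linarith) rfl rfl).to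
          (by refine ⟨?_, ?_, ?_, ?_⟩ <;> ring))
        obtain ⟨h, -⟩ := row_down ne hX floor a1 (by linarith) (by linarith) d1 ds
        linarith
      · obtain ⟨τ, d1, ds⟩ := hσ.rs ne (X := (p + q) / 2)
          (Y := (p + q) / 2)
          (by simp only [Ty.len]; ring) (by simp only [Ty.len]; ring)
          ((a1.sr_neg (t := 1) one_pos le_rfl rfl rfl).to
          (by refine ⟨?_, ?_, ?_, ?_⟩ <;> ring))
        have e1 := cdown _ d1 ds
        have e2 : T.F .DC ((p + q) / 2) ((p + q) / 2) ((p + q) / 2) ((p - q) / 2) := hσ.nx.to (by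
          simp only [Ty.len, Ty.ea, Ang.tc, Ang.ts]
          refine ⟨?_, ?_, ?_, ?_⟩ <;> ring)
        have e3 : T.F .CB (p + q) p 0 1 := e2.nx.to (by
          simp only [Ty.len, Ty.ea, Ang.tc, Ang.ts]
          refine ⟨?_, ?_, ?_, ?_⟩ <;> grind)
        have e4 : T.F .BA (p + q) (p + q) (-1) 0 := e3.nx.to (by
          simp [Ty.len, Ty.ea, Ang.tc, Ang.ts])
        intro t ht0 ht1
        constructor
        · rcases le_total t p with htp | htp
          · simpa using e1.edge ht0 htp
          · have := e3.edge (t := t - p) (by linarith) (by simp only [Ty.len]; linarith)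
            simpa using this
        · rcases le_total q t with htp | htp
          · have := e4.edge (t := p + q - t) (by linarith) (by simp only [Ty.len]; linarith)
            convert this using 1 <;> ring
          · have := b3.edge (t := q - t) (by linarith) (by simp only [Ty.len]; linarith)
            convert this using 1 <;> ring
    obtain ⟨τ, t, ht0, ht1, hF⟩ := T.rt (by norm_num) b3.inQ
      (b3.sr (t := 0) (X := q) (Y := p + q) le_rfl hq (by ring) (by ring)) hg (by linarith)
    have hF := hF.congr (x' := q - t) (y' := p + q) (e' := 1) (f' := 0) (by ring) (by ring)
      (by ring) (by ring)
    rcases ht1.eq_or_lt with rfl | ht1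
    · rcases hea : τ.ea
      · exact .inr ⟨b3, τ, hF, .inl hea⟩
      · exact .inr ⟨b3, τ, hF, .inr hea⟩
      -- An obtuse angle above leaves 2α at (q, p + q). A right angle in this gap leaves 2α − 90° <
      -- α. An obtuse angle leaves 3α − 180° < α if α > 60° and overlaps if α < 60°. So the angle is
      -- acute and the square closes.
      · left
        have n1 : T.F τ.nx q (p + q) ((p - q) / 2) ((p + q) / 2) := hF.nx.to (by
          simp only [hea, Ang.tc, Ang.ts]
          refine ⟨?_, ?_, ?_, ?_⟩ <;> ring)
        have rn := n1.sr (t := 0) (X := q) (Y := p + q) le_rfl (Ty.len_pos P _) (by ring) (by ring)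
        obtain ⟨σ, t, ht0, ht1, hσ⟩ := T.lt (by grind) b3.inQ rb2
          (n1.edge (Ty.len_pos P _).le le_rfl).2 (by
            have := mul_pos (Ty.len_pos P τ.nx) (half_pos ms)
            linarith)
        rcases ht0.eq_or_lt with rfl | ht0
        · have hσ := hσ.congr (x' := q) (y' := p + q) (by ring) (by ring) rfl rfl
          rcases hs : σ.sa
          · exact full σ hσ hs
          · exfalso
            have rp := hσ.sr_prev
            rw [hs] at rp
            simp only [Ang.tc, Ang.ts] at rp
            refine T.gap (by grind) b3.inQ rp rn ?_ ?_
            · linarith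
            · refine mm.trans_eq ?_
              grind
          · exfalso
            have rp := hσ.sr_prev
            rw [hs] at rp
            simp only [Ang.tc, Ang.ts] at rp
            rcases lt_or_gt_of_ne (show p - q ≠ 1 by intro h; apply ne; linarith) with hm | hm
            · refine T.gap (by grind) b3.inQ rp rn ?_ ?_
              · have : 0 < (p + q) * (1 - (p - q) ^ 2) / 2 :=
                  div_pos (mul_pos (by linarith) (by nlinarith)) two_pos
                refine this.trans_eq ?_
                grind
              · refine ms.trans_eq ?_
                grind
            · refine hσ.nc0 rn.Fr ?_ ?_
              · linarith
              · rw [hs]; simp only [Ang.tc, Ang.ts]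
                have : 0 < (p + q) * ((p - q) ^ 2 - 1) / 2 :=
                  div_pos (mul_pos (by linarith) (by nlinarith)) two_pos
                refine this.trans_eq ?_
                grind
        · exact (hσ.nc ht0 ht1 (by ring) (by ring) rn.Fr (by linarith)).elim
    · left
      obtain ⟨τ', d1, ds⟩ := b3.rs_neg ne ((hF.sr ht0.le ht1 (X := q) (Y := p + q) (by ring)
        (by ring)).to (by norm_num))
      refine full τ'.nx (d1.nx.to ?_) (by rw [Ty.sa_nx, ds]; rfl)
      have : τ'.ea = .acute := ds
      simp only [this, Ang.tc, Ang.ts]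
      refine ⟨?_, ?_, ?_, ?_⟩ <;> ring

/-- The mirror image of `corner_BA`. -/
lemma corner_BC {T : Tiling p q} (ne : p ≠ 1 + q) {X Y gx gy : ℝ} (hX : q < X) (hY : p < Y)
    (floor : ∀ t, 0 < t → t < X → T.S t 0) (bar : ∀ t, 0 < t → t < Y → T.S 0 t)
    (hg : T.Q gx gy) (hgx : p + q < gx) (h : T.F .BC 0 0 1 0) :
    (T.F .AB p (p + q) (-1) 0 ∧
      (T.F .BC (p - q) (p + q) 1 0 ∨ T.F .DC (p - 1) (p + q) 1 0)) ∨
    (∀ t, 0 ≤ t → t ≤ p + q → T.S (p + q) t ∧ T.S t (p + q)) ∨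
    (∃ τ : Ty, T.F τ (p + q) q 0 (-1) ∧ (τ.sa = .acute ∨ τ.sa = .right)) := by
  obtain ⟨τ0, hτ, d0⟩ := h.prev
  cases τ0 <;> simp [Ty.nx] at hτ
  rcases corner_BA (T := T.sw) ne hY hX (fun t => by rw [sw_S]; exact bar t)
    (fun t => by rw [sw_S]; exact floor t) (gx := gy) (gy := gx) hg hgx
    (d0.sw.to (by simp [Ty.len, Ty.sa, Ang.tc, Ang.ts])) with ⟨h1, h2⟩ | h1 | ⟨-, τ, h1, h2⟩
  · refine .inl ⟨h1.of_sw.to (by simp [Ty.len]), ?_⟩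
    rcases h2 with h2 | h2
    · exact .inl (h2.of_sw.to (by simp [Ty.len]; ring))
    · exact .inr (h2.of_sw.to (by simp [Ty.len]; ring))
  · refine .inr (.inl fun t h h' => ?_)
    have := h1 t h h'
    rw [sw_S, sw_S] at this
    exact this.symm
  · refine .inr (.inr ⟨τ.bar, h1.of_sw.to (by simp), ?_⟩)
    rwa [Ty.sa_bar]

end Tiling
end Reptile
-- Rows of squares along a side of the large quadrilateral
namespace Reptile

open Filter Topology

namespace Tiling
variable {p q : ℝ}

/-- The tiled region looks like the quadrilateral with sides `CD = DA = L`, with `D` at the origin,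
`A` on the first and `C` on the second axis. -/
structure IsBig (T : Tiling p q) (L : ℝ) : Prop where
  one_lt : 1 < L
  left : ∀ x y, T.Q x y → 0 ≤ x
  low : ∀ x y, T.Q x y → 0 ≤ y
  wall : ∀ t, 0 ≤ t → t ≤ L → T.Q 0 t
  base : ∀ t, 0 ≤ t → t ≤ L → T.Q t 0
  side : ∀ x y, T.Q x y → (p + q) * (x - L) + (p - q) * y ≤ 0
  top : ∀ x y, T.Q x y → 0 ≤ (p - q) * x - (p + q) * (y - L)
  vertex : T.Q (L * (q * (p + q) / 2)) (L + L * (q * (p - q) / 2))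

lemma Sk_of_boundary (T : Tiling p q) {x y u v : ℝ} (h : ∀ r, 0 < r → ¬ T.Q (x + r * u) (y + r * v)) :
    T.Sk x y := by
  intro i hi
  obtain ⟨r, hr, hr0⟩ := ((Flag.opoly.eventually hi u v).and self_mem_nhdsWithin).exists
  exact h r hr0 ((T.cover _ _).2 ⟨i, hr.poly⟩)

lemma IsBig.Sk_wall {T : Tiling p q} {L : ℝ} (B : T.IsBig L) (y : ℝ) : T.Sk 0 y :=
  T.Sk_of_boundary (u := -1) (v := 0) fun r hr h => by
    have := B.left _ _ h
    linarith

lemma IsBig.Sk_base {T : Tiling p q} {L : ℝ} (B : T.IsBig L) (x : ℝ) : T.Sk x 0 :=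
  T.Sk_of_boundary (u := 0) (v := -1) fun r hr h => by
    have := B.low _ _ h
    linarith

lemma tr_F (T : Tiling p q) (c d : ℝ) (τ : Ty) (x y e f : ℝ) :
    (T.mv c d 1 0 (by norm_num)).F τ x y e f ↔ T.F τ (c + x) (d + y) e f := by
  rw [mv_F]; simp

lemma tr_S (T : Tiling p q) (c d x y : ℝ) :
    (T.mv c d 1 0 (by norm_num)).S x y ↔ T.S (c + x) (d + y) := by
  rw [mv_S]; simp

lemma tr_Sk (T : Tiling p q) (c d x y : ℝ) :
    (T.mv c d 1 0 (by norm_num)).Sk x y ↔ T.Sk (c + x) (d + y) := by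
  rw [mv_Sk]; simp

lemma tr_Q (T : Tiling p q) (c d x y : ℝ) :
    (T.mv c d 1 0 (by norm_num)).Q x y ↔ T.Q (c + x) (d + y) := by
  simp only [mv]; simp

lemma Fr.of_seg {T : Tiling p q} {x y e f X : ℝ} (hX : 0 < X)
    (h : ∀ t, 0 < t → t < X → T.Sk (x + t * e) (y + t * f)) : T.Fr x y e f := by
  filter_upwards [self_mem_nhdsWithin, nhdsWithin_le_nhds (gt_mem_nhds hX)] with r h0 h1
  exact h r h0 h1

/-- A break of a row to the right of a tile `BA` is impossible. -/
lemma no_break_BA {T : Tiling p q} (ne : p ≠ 1 + q) {ℓ : ℝ} (hℓ : p + q < ℓ)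
    (floor : ∀ t, 0 < t → t < ℓ → T.S t 0) {τe : Ty} (he : T.F τe (ℓ - τe.len p q) 0 1 0)
    (hob : τe.ea = .obtuse → ℓ ≠ p + q + 1) (h1 : T.F .BA (p + q) 0 0 1)
    (h2 : T.F .CB (p + q) p 0 (-1) ∨ T.F .CD (p + q) p 0 (-1)) : False := by
  have P := T.par
  have hq := P.hq
  have hp := P.pp
  have mm := P.m_pos
  have hK : T.SR (p + q + p * 0) (p + p * -1) (-(-1)) 0 :=
    (floor_sr floor (by linarith) hℓ).to (by simp)
  have hseg : ∀ t, 0 < t → t < p → T.S (p + q + t * 0) (p + t * -1) := by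
    intro t h0 h1'
    have := h1.edge (t := p - t) (by linarith) (by simp only [Ty.len]; linarith)
    convert this using 1 <;> ring
  rcases h2 with h2 | h2
  · obtain ⟨rfl, rfl, k1, k2, -⟩ := h2.CB_special ne hseg hK
    have k3 : T.F .DC (8 / 5) 0 1 0 := k1.nx.to (by norm_num [Ty.len, Ty.ea, Ang.tc, Ang.ts])
    have hn : T.F τe.nx ℓ 0 (τe.ea.tc (7 / 5) (1 / 5)) (τe.ea.ts (7 / 5) (1 / 5)) :=
      he.nx.to (by norm_num)
    have rn := (hn.sr (t := 0) (X := ℓ) (Y := 0) le_rfl (Ty.len_pos P _) (by ring) (by ring)).Fr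
    -- The special row leaves a `DC` on the floor from 8/5 to 13/5 = p + q + 1. The end of the floor
    -- would cut it, or meet its obtuse angle in a way excluded by `hob`; if the floor goes on, it
    -- is a ray forbidden at C.
    rcases lt_trichotomy ℓ (13 / 5) with hl | hl | hl
    · refine k3.nc (t := ℓ - 8 / 5) (by linarith) (by simp only [Ty.len]; linarith) (by ring)
        (by ring) rn ?_
      have := Ang.ts_pos P τe.ea
      linarith
    · have k4 : T.F .CB ℓ 0 (3 / 5) (4 / 5) := k3.nx.to (by
        norm_num [Ty.len, Ty.ea, Ang.tc, Ang.ts, hl])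
      refine k4.nc0 rn ?_ ?_
      · rcases hea : τe.ea
        · norm_num [Ang.tc, Ang.ts]
        · norm_num [Ang.tc, Ang.ts]
        · exact (hob hea (by norm_num [hl])).elim
      · rcases hea : τe.ea
        · norm_num [Ang.tc, Ang.ts, Ty.sa]
        · norm_num [Ang.tc, Ang.ts, Ty.sa]
        · exact (hob hea (by norm_num [hl])).elim
    · exact k2 ((floor_sr floor (t := 13 / 5) (by norm_num) hl).Fr.to (by norm_num))
  · exact h2.not_CD ne hseg hK

/-- A row on a floor starting at the left side consists of squares. -/
lemma IsBig.rows {T : Tiling p q} {L : ℝ} (B : T.IsBig L) (ne : p ≠ 1 + q) (n : ℕ) :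
    ∀ y ℓ : ℝ, 0 ≤ y → (∀ x, 0 < x → x < ℓ → T.S x y) →
    (∃ τ : Ty, T.F τ (ℓ - τ.len p q) y 1 0 ∧
      (τ.ea = .obtuse → ∀ k : ℕ, ℓ ≠ k * (p + q) + 1)) →
    n * (p + q) < ℓ → y + n * (p + q) < L →
    (∀ x, 0 < x → x ≤ n * (p + q) → T.S x (y + (p + q))) ∧
    (∀ t, 0 < t → t < p + q → T.Sk (n * (p + q)) (y + t) ∧
      (y + t ≤ L → T.Q (n * (p + q)) (y + t))) := by
  have P := T.par
  have h2 := P.h2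
  have hq := P.hq
  have hp := P.pp
  have hp1 := P.p_gt
  have hq1 := P.q_lt
  have mm := P.m_pos
  -- The height and the length of the floor vary in the induction: above a break there is a shorter
  -- floor, and the hypothesis for the same number of squares applies to the row on it, supplying a
  -- wall above the break.
  induction n with
  | zero =>
    intro y ℓ hy _ _ _ _
    simp only [CharP.cast_eq_zero, zero_mul]
    exact ⟨fun x h0 h1 => absurd h0 (not_lt.2 h1), fun t h0 h1 => ⟨B.Sk_wall _, fun h =>
      B.wall _ (by linarith) h⟩⟩
  | succ n ih =>
    intro y ℓ hy floor hend hnℓ hnL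
    push_cast at hnℓ hnL
    set c := (n : ℝ) * (p + q) with hc
    have hc0 : 0 ≤ c := by positivity
    have hnℓ : c + (p + q) < ℓ := by linarith
    have hnL : y + c + (p + q) < L := by linarith
    obtain ⟨top, bar⟩ := ih y ℓ hy floor hend (by linarith) (by linarith)
    have hu : (1 : ℝ) ^ 2 + 0 ^ 2 = 1 := by norm_num
    have floor' : ∀ t, 0 < t → t < ℓ - c → (T.mv c y 1 0 hu).S t 0 := by
      intro t h0 h1
      rw [tr_S, add_zero]
      exact floor _ (by linarith) (by linarith)
    have bar' : ∀ t, 0 < t → t < p + q → (T.mv c y 1 0 hu).S 0 t := by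
      intro t h0 h1
      rw [tr_S, add_zero]
      exact ⟨(bar t h0 h1).1, (bar t h0 h1).2 (by linarith)⟩
    have full : (∀ t, 0 ≤ t → t ≤ p + q →
        (T.mv c y 1 0 hu).S (p + q) t ∧ (T.mv c y 1 0 hu).S t (p + q)) →
        (∀ x, 0 < x → x ≤ ((n + 1 : ℕ) : ℝ) * (p + q) → T.S x (y + (p + q))) ∧
        (∀ t, 0 < t → t < p + q → T.Sk (((n + 1 : ℕ) : ℝ) * (p + q)) (y + t) ∧
        (y + t ≤ L → T.Q (((n + 1 : ℕ) : ℝ) * (p + q)) (y + t))) := by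
      intro h
      have e : ((n + 1 : ℕ) : ℝ) * (p + q) = c + (p + q) := by push_cast; ring
      rw [e]
      constructor
      · intro x h0 h1
        rcases le_or_gt x c with h | hx
        · exact top x h0 h
        · have := (h (x - c) (by linarith) (by linarith)).2
          rw [tr_S] at this
          simpa using this
      · intro t h0 h1
        have := (h t h0.le h1.le).1
        rw [tr_S] at this
        exact ⟨this.1, fun _ => this.2⟩
    have floor2 : ∀ ℓ' : ℝ, (∀ t, 0 < t → t < ℓ' → T.S (c + t) (y + (p + q))) →
        ∀ x, 0 < x → x < c + ℓ' → T.S x (y + (p + q)) := by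
      intro ℓ' h x h0 h1
      rcases le_or_gt x c with hx | hx
      · exact top x h0 hx
      · have := h (x - c) (by linarith) (by linarith)
        simpa using this
    have hQ0 : (T.mv c y 1 0 hu).Q 0 0 := by
      rw [tr_Q, add_zero, add_zero]
      have h1 := (floor' ((ℓ - c) / 2) (by linarith) (by linarith)).2
      rcases n.eq_zero_or_pos with hn | hn
      · have : c = 0 := by rw [hc, hn]; simp
        rw [this]; exact B.wall _ hy (by linarith)
      · exact (floor c (by positivity) (by linarith)).2
    obtain ⟨τ, hτ, hs⟩ := corner_start (T := T.mv c y 1 0 hu) (by linarith : 0 < ℓ - c)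
      (by linarith) hQ0 floor' bar'
    rcases Ty.of_sa_right hs with rfl | rfl | rfl | rfl
    · exact (corner_not_DA ne (by linarith) (by linarith) floor' bar' hτ).elim
    · rcases corner_BC ne (gx := (ℓ + c + (p + q)) / 2 - c) (gy := 0)
        (by linarith) (by linarith) floor' bar' (by
          rw [tr_Q, add_zero]
          exact (floor _ (by linarith) (by linarith)).2) (by linarith) hτ with
        ⟨k1, k2⟩ | k | ⟨τ, k1, k2⟩
      · exfalso
        have hs7 := P.s_gt'
        have hp32 := P.p_lt
        have kS : ∀ t, 0 < t → t < p → T.S (c + t) (y + (p + q)) := by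
          intro t h0 h1
          have := k1.edge (t := p - t) (by linarith) (by simp only [Ty.len]; linarith)
          rw [tr_S] at this
          convert this using 1 <;> ring
        have kE : ∃ τ : Ty, T.F τ (c + p - τ.len p q) (y + (p + q)) 1 0 ∧
            (τ.ea = .obtuse → ∀ k : ℕ, c + p ≠ k * (p + q) + 1) := by
          -- For k ≤ n the right side is at most c + 1 < c + p; for larger k it exceeds c + p + q.
          have key : ∀ k : ℕ, c + p ≠ k * (p + q) + 1 := by
            intro k hk
            rcases le_or_gt k n with hkn | hkn
            · have : (k : ℝ) * (p + q) ≤ n * (p + q) :=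
                mul_le_mul_of_nonneg_right (Nat.cast_le.2 hkn) (by linarith)
              linarith
            · have : ((n + 1 : ℕ) : ℝ) * (p + q) ≤ k * (p + q) :=
                mul_le_mul_of_nonneg_right (Nat.cast_le.2 hkn) (by linarith)
              push_cast at this
              linarith
          rcases k2 with k2 | k2
          · rw [tr_F] at k2
            exact ⟨.BC, k2.to (by simp [Ty.len]; ring), fun _ => key⟩
          · rw [tr_F] at k2
            exact ⟨.DC, k2.to (by simp [Ty.len]; ring), fun _ => key⟩
        obtain ⟨-, bar2⟩ := ih (y + (p + q)) (c + p) (by linarith) (floor2 p kS) kE (by linarith)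
          (by linarith)
        have hK : (T.mv c y 1 0 hu).SR 0 (p + q) 0 1 := by
          refine SR.of_seg (X := min (p + q) (L - y - (p + q))) (lt_min (by linarith) (by linarith))
            fun t h0 h1 => ?_
          rw [tr_S]
          have := lt_min_iff.1 h1
          have h := bar2 t h0 this.1
          have := h.2 (by linarith [this.2])
          have : T.S c (y + (p + q) + t) := ⟨h.1, this⟩
          convert this using 1 <;> ring
        have hseg : ∀ t, 0 < t → t < p → (T.mv c y 1 0 hu).S (p + t * -1) ((p + q) + t * 0) :=
          fun t h0 h1 => k1.edge h0.le h1.le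
        -- The upper floor of length p, read towards the left, ends at the wall of the row above.
        -- For the special parameters the ray forbidden at height 1 above it lies on this wall,
        -- whose height p + q exceeds 1.
        rcases k2 with k2 | k2
        · obtain ⟨e1, e2, -, k3, -⟩ := F.BC_special ne (x := p) (y := p + q) (e := -1) (f := 0)
            (X := p - q) (Y := p + q)
            (k2.to (by simp)) (by ring) (by ring) hseg (hK.to (by simp))
          refine k3 (Fr.of_seg (X := p + q - 1) (by linarith) fun t h0 h1 => ?_)
          rw [tr_Sk]
          have := (bar2 (1 + t) (by linarith) (by linarith)).1
          subst e1 e2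
          convert this using 1 <;> ring
        · exact F.not_DC ne (x := p) (y := p + q) (e := -1) (f := 0)
            (X := p - 1) (Y := p + q)
            (k2.to (by simp)) (by ring) (by ring) hseg (hK.to (by simp))
      · exact full k
      · exfalso
        have rf := (floor_sr floor' (t := p + q) (by linarith) (by linarith)).Fr
        have pass : ∀ τ : Ty, (T.mv c y 1 0 hu).F τ (p + q) q 0 (-1) → q < τ.len p q → False :=
          fun τ k hl => k.nc (t := q) hq hl (by ring) (by ring) rf (by norm_num)
        -- All candidates except `BC` are longer than q and would cross the floor; `BC` ends on the
        -- floor with an obtuse angle, which contains the floor ray.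
        cases τ
        case BC =>
          have k3 : (T.mv c y 1 0 hu).F .CD (p + q) 0 ((p + q) / 2) (-((p - q) / 2)) :=
            k1.nx.to (by
              simp only [Ty.len, Ty.ea, Ang.tc, Ang.ts]
              refine ⟨?_, ?_, ?_, ?_⟩ <;> ring)
          refine k3.nc0 rf ?_ ?_
          · linarith
          · simp only [Ty.sa, Ang.tc, Ang.ts]
            refine one_pos.trans_eq ?_
            grind
        case CD => simp [Ty.sa] at k2
        case CB => simp [Ty.sa] at k2
        all_goals exact pass _ k1 (by simp only [Ty.len]; linarith)
    · exact (corner_not_DC ne (by linarith) (by linarith) floor' bar' hτ).elim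
    · rcases corner_BA ne (gx := -c) (gy := L - y) (by linarith) (by linarith) floor' bar' (by
          rw [tr_Q]
          have := B.wall L (by linarith) le_rfl
          convert this using 1 <;> ring) (by linarith) hτ with ⟨k1, k2⟩ | k | ⟨k1, τ, k2, k3⟩
      · exfalso
        obtain ⟨τe, he, hob⟩ := hend
        refine no_break_BA ne (by linarith : p + q < ℓ - c) floor' (τe := τe) ?_ (fun h h' => ?_)
          k1 k2
        · rw [tr_F]; exact he.to ⟨by ring, by ring, rfl, rfl⟩
        · refine hob h (n + 1) ?_
          push_cast
          linarith
      · exact full k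
      · exfalso
        have kS : ∀ t, 0 < t → t < q → T.S (c + t) (y + (p + q)) := by
          intro t h0 h1
          have := k1.edge (t := q - t) (by linarith) (by simp only [Ty.len]; linarith)
          rw [tr_S] at this
          convert this using 1 <;> ring
        have k2' := k2
        rw [tr_F] at k2'
        obtain ⟨-, bar2⟩ := ih (y + (p + q)) (c + q) (by linarith) (floor2 q kS)
          ⟨τ, k2'.to ⟨by ring, rfl, rfl, rfl⟩, fun h => by rcases k3 with h' | h' <;> simp [h] at h'⟩
          (by linarith) (by linarith)
        have rb : (T.mv c y 1 0 hu).Fr 0 (p + q) 0 1 := by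
          refine Fr.of_seg (X := p + q) (by linarith) fun t h0 h1 => ?_
          rw [tr_Sk]
          have := (bar2 t h0 h1).1
          convert this using 1 <;> ring
        have pass : ∀ τ : Ty, (T.mv c y 1 0 hu).F τ (q - τ.len p q) (p + q) 1 0 →
            q < τ.len p q → False :=
          fun τ k hl => k.nc (t := τ.len p q - q) (by linarith) (by linarith) (by ring) (by ring) rb
            (by norm_num)
        -- Here the wall of the upper row cuts every edge longer than q, and `CB` would start at the
        -- wall with an obtuse angle containing it.
        cases τ
        case BC => simp [Ty.ea] at k3
        case CB =>
          have k2 := k2.to (x' := 0) (y' := p + q) (e' := 1) (f' := 0) (by simp [Ty.len])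
          refine k2.nc0 rb (by norm_num) ?_
          simp only [Ty.sa, Ang.tc, Ang.ts]
          linarith
        all_goals exact pass _ k2 (by simp only [Ty.len]; linarith)

/-- No tile lies in the corner `A` in the way homothetic to the whole. -/
lemma IsBig.not_homothetic {T : Tiling p q} {L : ℝ} (B : T.IsBig L) (ne : p ≠ 1 + q)
    (h : T.F .DA (L - 1) 0 1 0) : False := by
  have P := T.par
  have h2 := P.h2
  have hq := P.hq
  have hp := P.pp
  have hp1 := P.p_gt
  have hq1 := P.q_lt
  have mm := P.m_pos
  have hs1 := P.s_gt
  have hL := B.one_lt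
  obtain ⟨n, hn, hn'⟩ : ∃ n : ℕ, n * (p + q) < L ∧ L ≤ (n + 1) * (p + q) := by
    have hs : 0 < p + q := by linarith
    have hpos : 0 < L / (p + q) := by positivity
    obtain ⟨n, hn⟩ := Nat.exists_eq_succ_of_ne_zero (Nat.ceil_pos.2 hpos).ne'
    refine ⟨n, ?_, ?_⟩
    · have : n < ⌈L / (p + q)⌉₊ := by omega
      exact (lt_div_iff₀ hs).1 (Nat.lt_ceil.1 this)
    · have := Nat.le_ceil (L / (p + q))
      rw [hn] at this
      push_cast at this
      exact (div_le_iff₀ hs).1 this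
  obtain ⟨top, bar⟩ := B.rows ne n 0 L le_rfl
    (fun x h0 h1 => ⟨B.Sk_base x, B.base x h0.le h1.le⟩)
    ⟨.DA, h, fun h => by simp [Ty.ea] at h⟩ hn (by linarith)
  set c := (n : ℝ) * (p + q) with hc
  have hc0 : 0 ≤ c := by positivity
  have hn' : L ≤ c + (p + q) := by linarith
  have hu : (1 : ℝ) ^ 2 + 0 ^ 2 = 1 := by norm_num
  have floor' : ∀ t, 0 < t → t < L - c → (T.mv c 0 1 0 hu).S t 0 := by
    intro t h0 h1
    rw [tr_S, add_zero]
    exact ⟨B.Sk_base _, B.base _ (by linarith) (by linarith)⟩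
  have bar' : ∀ t, 0 < t → t < min (p + q) L → (T.mv c 0 1 0 hu).S 0 t := by
    intro t h0 h1
    rw [tr_S, add_zero]
    have := lt_min_iff.1 h1
    exact ⟨(bar t h0 this.1).1, (bar t h0 this.1).2 (by linarith [this.2])⟩
  have hY : 0 < min (p + q) L := lt_min (by linarith) (by linarith)
  have hF : (T.mv c 0 1 0 hu).F .DA (L - 1 - c) 0 1 0 := by
    rw [tr_F]; exact h.to ⟨by ring, by ring, rfl, rfl⟩
  -- The last wall stands at c and the corner tile has its vertex D at L − 1. If the wall is to the
  -- right of D, it enters the tile. If it passes through D, the acute angle above C has a side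
  -- along CB longer than q, which leaves the region. If it is to the left of D, the gap is shorter
  -- than 1 and cannot be filled.
  rcases lt_trichotomy (L - 1) c with hd | hd | hd
  · exact hF.nc (t := c - (L - 1)) (X := 0) (Y := 0) (by linarith) (by simp only [Ty.len]; linarith)
      (by ring) (by ring) (bar_sr bar' le_rfl hY).Fr (by norm_num)
  · have hn0 : 1 ≤ n := by
      rcases n.eq_zero_or_pos with hn | hn
      · have : c = 0 := by rw [hc, hn]; simp
        linarith
      · exact hn
    have hcs : p + q ≤ c := by
      have : (1 : ℝ) ≤ n := by exact_mod_cast hn0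
      rw [hc]; nlinarith
    have k0 := hF.to (x' := 0) (y' := 0) (e' := 1) (f' := 0) ⟨by linarith, rfl, rfl, rfl⟩
    obtain ⟨τ0, hτ, d0⟩ := k0.prev
    cases τ0 <;> simp [Ty.nx] at hτ
    have d1 : (T.mv c 0 1 0 hu).F .CD 0 1 0 (-1) :=
      d0.to (by simp [Ty.len, Ty.sa, Ang.tc, Ang.ts])
    obtain ⟨τ, g0, gs⟩ := d1.rs_neg ne ((bar_sr bar' zero_le_one
      (lt_min (by linarith) (by linarith))).to (by simp))
    have fin : ∀ τ : Ty, 1 ≤ τ.len p q →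
        ¬ (T.mv c 0 1 0 hu).F τ 0 1 ((p + q) / 2) ((p - q) / 2) := by
      intro τ hl k
      have := (k.edge (by linarith) (le_refl (τ.len p q))).2
      rw [tr_Q] at this
      have := B.side _ _ this
      rw [show c = L - 1 by linarith] at this
      have : 2 * τ.len p q - 2 * q ≤ 0 := by
        refine le_of_eq_of_le ?_ this
        grind
      linarith
    rcases Ty.of_ea_acute gs with rfl | rfl
    · exact fin .AB (by simp only [Ty.len]; linarith) (g0.nx.to (by
        simp only [Ty.len, Ty.ea, Ang.tc, Ang.ts]
        refine ⟨?_, ?_, ?_, ?_⟩ <;> ring))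
    · exact fin .AD (by simp only [Ty.len]; linarith) (g0.nx.to (by
        simp only [Ty.len, Ty.ea, Ang.tc, Ang.ts]
        refine ⟨?_, ?_, ?_, ?_⟩ <;> ring))
  · set d := L - 1 - c with hdd
    have hQ0 : (T.mv c 0 1 0 hu).Q 0 0 := by
      rw [tr_Q, add_zero, add_zero]
      exact B.base _ hc0 hn.le
    obtain ⟨τ, hτ, hs⟩ := corner_start (T := T.mv c 0 1 0 hu) (by linarith : 0 < L - c)
      hY hQ0 floor' bar'
    have rd : (T.mv c 0 1 0 hu).Fr d 0 0 1 := hF.sr_prev.Fr.to (by simp [Ty.sa, Ang.tc, Ang.ts])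
    have pass : ∀ (τ : Ty) (x : ℝ), (T.mv c 0 1 0 hu).F τ x 0 1 0 → x < d → d < x + τ.len p q →
        False := fun τ x k h0 h1 =>
      k.nc (t := d - x) (by linarith) (by linarith) (by ring) (by ring) rd (by norm_num)
    rcases Ty.of_sa_right hs with rfl | rfl | rfl | rfl
    · exact pass _ _ hτ (by linarith) (by simp only [Ty.len]; linarith [P.s_lt])
    · rcases lt_trichotomy d q with hl | hl | hl
      · exact pass _ _ hτ (by linarith) (by simp only [Ty.len]; linarith)
      · have k3 : (T.mv c 0 1 0 hu).F .CD d 0 ((p - q) / 2) ((p + q) / 2) :=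
          hτ.nx.to (by simp [Ty.len, Ty.ea, Ang.tc, Ang.ts, hl])
        refine k3.nc0 rd ?_ ?_
        · linarith
        · simp only [Ty.sa, Ang.tc, Ang.ts]
          refine one_pos.trans_eq ?_
          grind
      · obtain ⟨τ, k, ks⟩ := hτ.rs ne (X := q) (Y := 0) (by simp [Ty.len]) (by simp)
          (floor_sr floor' hq.le (by linarith))
        refine pass _ _ k hl ?_
        rcases Ty.of_sa_acute ks with rfl | rfl <;> simp only [Ty.len] <;> linarith [P.p_lt]
    · exact pass _ _ hτ (by linarith) (by simp only [Ty.len]; linarith [P.s_lt])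
    · exact pass _ _ hτ (by linarith) (by simp only [Ty.len]; linarith [P.s_lt])

end Tiling
end Reptile
-- The corner A, sums of sides, and the case of an angle of 60°
namespace Reptile

open Filter Topology

namespace Tiling
variable {p q : ℝ}

/-- The tile in the corner `A` has there its acute angle. -/
lemma IsBig.corner_A {T : Tiling p q} {L : ℝ} (B : T.IsBig L) :
    T.F .DA (L - 1) 0 1 0 ∨ T.F .BA (L - p) 0 1 0 := by
  have P := T.par
  have hL := B.one_lt
  have mm := P.m_pos
  have hs := P.s_gt
  have hr : T.SR L 0 (-1) 0 := SR.of_seg (X := L) (by linarith) fun t h0 h1 => by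
    have : T.S (L - t) 0 := ⟨B.Sk_base _, B.base _ (by linarith) (by linarith)⟩
    convert this using 1 <;> ring
  obtain ⟨τ, t, ht0, ht1, hF⟩ := T.rt (by norm_num) (B.base L (by linarith) le_rfl) hr
    (B.wall L (by linarith) le_rfl) (by linarith)
  have hl := Ty.len_pos P τ
  have h1 := B.side _ _ (hF.edge hl.le le_rfl).2
  have : τ.len p q - t ≤ 0 := by
    by_contra hn
    have := mul_pos (show 0 < p + q by linarith) (not_le.1 hn)
    linarith
  obtain rfl : t = τ.len p q := by linarith
  have hF := hF.to (x' := L - τ.len p q) (y' := 0) (e' := 1) (f' := 0)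
    (by refine ⟨?_, ?_, ?_, ?_⟩ <;> ring)
  have hn : T.F τ.nx L 0 (τ.ea.tc p q) (τ.ea.ts p q) := hF.nx.to (by simp)
  have hl' := Ty.len_pos P τ.nx
  have h2 := B.side _ _ (hn.edge hl'.le le_rfl).2
  have key : 0 < (p + q) * τ.ea.tc p q + (p - q) * τ.ea.ts p q → False := by
    intro h
    have := mul_pos hl' h
    linarith
  have hea : τ.ea = .acute := by
    rcases h : τ.ea
    · rfl
    · refine (key ?_).elim
      rw [h]; simp only [Ang.tc, Ang.ts]; linarith
    · refine (key ?_).elim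
      have := mul_pos mm (show 0 < p + q by linarith)
      rw [h]; simp only [Ang.tc, Ang.ts]; linarith
  rcases Ty.of_ea_acute hea with rfl | rfl
  · exact .inl hF
  · exact .inr hF

/-- Edges follow each other along the floor up to its end. Each has length at least q, so N bounds
the number of steps. -/
lemma F.run {T : Tiling p q} {X : ℝ} (floor : ∀ t, 0 < t → t < X → T.S t 0)
    (hmax : ∀ t, T.Q t 0 → t ≤ X) (N : ℕ) : ∀ (τ : Ty) (x : ℝ), 0 ≤ x → T.F τ x 0 1 0 →
    X - x ≤ N * q → ∃ n m l : ℕ, X = x + τ.len p q + (n + m * p + l * q) := by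
  have P := T.par
  have hq := P.hq
  have hpq := P.hpq
  have hq1 := P.q_lt
  induction N with
  | zero =>
    intro τ x h0 h hx
    have hl := Ty.len_pos P τ
    have := hmax (x + τ.len p q) (by
      have := (h.edge hl.le le_rfl).2
      simpa using this)
    simp at hx
    linarith
  | succ N ih =>
    intro τ x h0 h hx
    have hl := Ty.len_pos P τ
    have hlq : q ≤ τ.len p q := by cases τ <;> simp only [Ty.len] <;> linarith
    have := hmax (x + τ.len p q) (by
      have := (h.edge hl.le le_rfl).2
      simpa using this)
    rcases this.eq_or_lt with h1 | h1
    · exact ⟨0, 0, 0, by simp [h1]⟩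
    · obtain ⟨τ', h', -⟩ := h.follow (X := x + τ.len p q) (Y := 0) (by ring) (by ring)
        (floor_sr floor (by linarith) h1)
      push_cast at hx
      obtain ⟨n, m, l, e⟩ := ih τ' _ (by linarith) h' (by linarith)
      have : τ'.len p q = 1 ∨ τ'.len p q = p ∨ τ'.len p q = q := by
        cases τ' <;> simp [Ty.len]
      rcases this with h | h | h <;> rw [h] at e
      · exact ⟨n + 1, m, l, by push_cast; linarith⟩
      · exact ⟨n, m + 1, l, by push_cast; linarith⟩
      · exact ⟨n, m, l + 1, by push_cast; linarith⟩

lemma IsBig.base_sum {T : Tiling p q} {L : ℝ} (B : T.IsBig L) :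
    ∃ n m l : ℕ, L = n + m * p + l * q := by
  have P := T.par
  have hL := B.one_lt
  have hs := P.s_gt
  have floor : ∀ t, 0 < t → t < L → T.S t 0 := fun t h0 h1 =>
    ⟨B.Sk_base t, B.base t h0.le h1.le⟩
  obtain ⟨τ, t, ht0, ht1, hF⟩ := T.lt (by norm_num) (B.base 0 le_rfl (by linarith))
    (floor_sr floor le_rfl (by linarith)) (B.wall L (by linarith) le_rfl) (by linarith)
  have := B.left _ _ hF.inQ
  obtain rfl : t = 0 := by linarith
  obtain ⟨N, hN⟩ := exists_nat_ge (L / q)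
  obtain ⟨n, m, l, e⟩ := F.run floor (fun t ht => by
    have := B.side _ _ ht
    by_contra hn
    have := mul_pos (show 0 < p + q by linarith) (sub_pos.2 (not_le.1 hn))
    linarith) N τ 0 le_rfl (hF.to (by simp)) (by
    rw [div_le_iff₀ P.hq] at hN; linarith)
  have : τ.len p q = 1 ∨ τ.len p q = p ∨ τ.len p q = q := by
    cases τ <;> simp [Ty.len]
  rcases this with h | h | h <;> rw [h] at e
  · exact ⟨n + 1, m, l, by push_cast; linarith⟩
  · exact ⟨n, m + 1, l, by push_cast; linarith⟩
  · exact ⟨n, m, l + 1, by push_cast; linarith⟩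

/-- A side of length 1 or p occurs because the only right angle starting an edge of length q is that
of `BC`, which ends in an obtuse angle; the next angle is acute and starts an `AB` or `AD`. An
obtuse angle does not fit into the corner B. `F.follow` is used here since `F.rs` is not available
for p = 1 + q. -/
lemma IsBig.side_BC_sum {T : Tiling p q} {L : ℝ} (B : T.IsBig L) :
    ∃ n m l : ℕ, L * q = n + m * p + l * q ∧ 1 ≤ n + m := by
  have P := T.par
  have h2 := P.h2
  have hL := B.one_lt
  have hs := P.s_gt
  have hq := P.hq
  have hpq := P.hpq
  have hq1 := P.q_lt
  have mm := P.m_pos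
  have hu : (-((p + q) / 2)) ^ 2 + (-((p - q) / 2)) ^ 2 = 1 := by linarith
  -- Coordinates with the large vertex B at the origin and C on the first axis.
  set T' := T.mv (L * (q * (p + q) / 2)) (L + L * (q * (p - q) / 2))
    (-((p + q) / 2)) (-((p - q) / 2)) hu
  have Qiff : ∀ x y, T'.Q x y ↔ T.Q (L * (q * (p + q) / 2) + -((p + q) / 2) * x - -((p - q) / 2) * y)
    (L + L * (q * (p - q) / 2) + -((p - q) / 2) * x + -((p + q) / 2) * y) := fun _ _ => Iff.rfl
  have hmin : ∀ x y, T'.Q x y → 0 ≤ x := by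
    intro x y h
    have := B.side _ _ ((Qiff _ _).1 h)
    have : -2 * x ≤ 0 := by
      refine le_of_eq_of_le ?_ this
      grind
    linarith
  have hmax : ∀ t, T'.Q t 0 → t ≤ L * q := by
    intro t h
    have := B.left _ _ ((Qiff _ _).1 h)
    by_contra hn
    have := mul_pos (show 0 < p + q by linarith) (sub_pos.2 (not_le.1 hn))
    linarith
  have hlow : ∀ x y, T'.Q x y → 0 ≤ y := by
    intro x y h
    have := B.top _ _ ((Qiff _ _).1 h)
    have : 0 ≤ 2 * y := by
      refine this.trans_eq ?_
      grind
    linarith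
  have hq0 : T'.Q 0 0 := by
    rw [Qiff]
    have := B.vertex
    convert this using 1 <;> ring
  have hq1' : T'.Q (L * q) 0 := by
    rw [Qiff]
    have := B.wall L (by linarith) le_rfl
    convert this using 1 <;> ring
  have hLq : 0 < L * q := by positivity
  have floor : ∀ t, 0 < t → t < L * q → T'.S t 0 := by
    intro t h0 h1
    refine ⟨T'.Sk_of_boundary (u := 0) (v := -1) fun r hr h => ?_, ?_⟩
    · have := hlow _ _ h
      linarith
    · have := T'.conv _ _ _ _ (t / (L * q)) hq0 hq1' (by positivity) ((div_le_one hLq).2 h1.le)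
      convert this using 1
      · field_simp; ring
      · ring
  have hD : T'.Q (L * q + L * ((p - q) / 2)) (L * ((p + q) / 2)) := by
    rw [Qiff]
    have := B.wall 0 le_rfl (by linarith)
    convert this using 1 <;> grind
  obtain ⟨τ, t, ht0, ht1, hF⟩ := T'.lt (by norm_num) hq0
    (floor_sr floor le_rfl hLq) hD (by
      have : 0 < L * ((p + q) / 2) := by positivity
      linarith)
  have := hmin _ _ hF.inQ
  obtain rfl : t = 0 := by linarith
  have hF := hF.to (x' := 0) (y' := 0) (e' := 1) (f' := 0) (by simp)
  have hmaxlen : ∀ (τ : Ty) x, T'.F τ x 0 1 0 → x + τ.len p q ≤ L * q := fun τ x h => hmax _ (by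
      have := (h.edge (Ty.len_pos P _).le le_rfl).2
      simpa using this)
  obtain ⟨N, hN⟩ := exists_nat_ge (L * q / q)
  rw [div_le_iff₀ P.hq] at hN
  have start : ∀ (τ : Ty) x, 0 ≤ x → T'.F τ x 0 1 0 →
      ∃ n m l : ℕ, L * q = x + τ.len p q + (n + m * p + l * q) := fun τ x h0 h =>
    F.run floor hmax N τ x h0 h (by linarith)
  rcases hsa : τ.sa
  · obtain ⟨n, m, l, e⟩ := start τ 0 le_rfl hF
    rcases Ty.of_sa_acute hsa with rfl | rfl <;> simp only [Ty.len] at e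
    · exact ⟨n, m + 1, l, by push_cast; linarith, by omega⟩
    · exact ⟨n + 1, m, l, by push_cast; linarith, by omega⟩
  · obtain ⟨n, m, l, e⟩ := start τ 0 le_rfl hF
    rcases Ty.of_sa_right hsa with rfl | rfl | rfl | rfl <;> simp only [Ty.len] at e
    · exact ⟨n + 1, m, l, by push_cast; linarith, by omega⟩
    · obtain ⟨τ', h', hs'⟩ := hF.follow (X := q) (Y := 0) (by simp [Ty.len]) (by simp)
        (floor_sr floor hq.le (by nlinarith))
      obtain ⟨n, m, l, e⟩ := start τ' q hq.le h'
      rcases Ty.of_sa_acute (hs' rfl) with rfl | rfl <;> simp only [Ty.len] at e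
      · exact ⟨n, m + 1, l + 1, by push_cast; linarith, by omega⟩
      · exact ⟨n + 1, m, l + 1, by push_cast; linarith, by omega⟩
    · exact ⟨n + 1, m, l, by push_cast; linarith, by omega⟩
    · exact ⟨n, m + 1, l, by push_cast; linarith, by omega⟩
  · exfalso
    obtain ⟨τ', -, h'⟩ := hF.prev
    have := hmin _ _ h'.inQ
    have hl := Ty.len_pos P τ'
    rw [hsa] at this
    simp only [Ang.tc, Ang.ts] at this
    have := mul_pos hl mm
    linarith

lemma int_sqrt_three {s : ℝ} (h : s ^ 2 = 3) (a b : ℤ) (hab : a + b * s = 0) : b = 0 := by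
  by_contra hb
  have hb' : (b : ℝ) ≠ 0 := by exact_mod_cast hb
  have h1 : (a : ℝ) ^ 2 = 3 * b ^ 2 := by
    have : (a : ℝ) = -(b * s) := by linarith
    rw [this]; linear_combination (b : ℝ) ^ 2 * h
  have hirr : Irrational (Real.sqrt 3) := by
    have := Nat.Prime.irrational_sqrt (p := 3) (by norm_num)
    exact_mod_cast this
  refine hirr ⟨|(a : ℚ) / b|, ?_⟩
  rw [eq_comm, Real.sqrt_eq_iff_mul_self_eq (by norm_num) (by positivity)]
  push_cast
  rw [abs_mul_abs_self, div_mul_div_comm, eq_div_iff (by positivity)]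
  linarith

/-- With s = √3 the base gives 2L = a + b s, where a = 2n + m − l and b = m + l; as L² is an
integer, ab = 0. The side BC gives a − b = 2(m' + l') and 3b − a = 2(2n' + m' − l'), with sum b =
2(n' + m'). If a = 0, the first relation forces b = 0 and L = 0. If b = 0, then n' + m' = 0, against
`IsBig.side_BC_sum`. -/
lemma IsBig.not_sixty {T : Tiling p q} {L : ℝ} (B : T.IsBig L) (e : p = 1 + q) (k : ℕ)
    (hk : L ^ 2 = k) : False := by
  have P := T.par
  have h2 := P.h2
  have hL := B.one_lt
  obtain ⟨n, m, l, h1⟩ := B.base_sum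
  obtain ⟨n', m', l', h3, h4⟩ := B.side_BC_sum
  obtain ⟨s, hs⟩ : ∃ s : ℝ, s = p + q := ⟨_, rfl⟩
  have hp : p = (s + 1) / 2 := by linarith
  have hq : q = (s - 1) / 2 := by linarith
  subst hp hq
  have hs3 : s ^ 2 = 3 := by linarith
  have e1 : 2 * L = (2 * n + m - l) + (m + l) * s := by linarith
  have e2 := int_sqrt_three hs3
    ((2 * n + m - l) ^ 2 + 3 * (m + l) ^ 2 - 4 * k) (2 * ((2 * n + m - l) * (m + l))) (by
      push_cast
      have : (2 * L) ^ 2 = 4 * k := by rw [← hk]; ring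
      rw [e1] at this
      linear_combination this - (m + l : ℝ) ^ 2 * hs3)
  have e3 := int_sqrt_three hs3 (3 * (m + l) - (2 * n + m - l) - (4 * n' + 2 * m' - 2 * l'))
    ((2 * n + m - l) - (m + l) - 2 * (m' + l')) (by
      push_cast
      have : 2 * (2 * L) * (s - 1) = 2 * ((2 * n' + m' - l') + (m' + l') * s) * 2 := by
        linear_combination 8 * h3
      rw [e1] at this
      linear_combination (1/2) * this - (m + l : ℝ) * hs3)
  have e4 : (3 * (m + l) - (2 * n + m - l) - (4 * n' + 2 * m' - 2 * l') : ℤ) = 0 := by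
    have : ((3 * (m + l) - (2 * n + m - l) - (4 * n' + 2 * m' - 2 * l') : ℤ) : ℝ) = 0 := by
      have h5 : (((2 * n + m - l) - (m + l) - 2 * (m' + l') : ℤ) : ℝ) = 0 := by
        rw [e3]; simp
      push_cast at h5 ⊢
      have : 2 * (2 * L) * (s - 1) = 2 * ((2 * n' + m' - l') + (m' + l') * s) * 2 := by
        linear_combination 8 * h3
      rw [e1] at this
      linear_combination (1/2) * this - (m + l : ℝ) * hs3 - s * h5
    exact_mod_cast this
  have hz : (2 * n + m - l : ℤ) = 0 ∨ (m + l : ℤ) = 0 := by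
    rcases mul_eq_zero.1 e2 with h | h
    · norm_num at h
    · exact mul_eq_zero.1 h
  rcases hz with hz | hz
  · have : (m : ℝ) + l = 0 := by
      have : m + l = 0 := by omega
      exact_mod_cast this
    have hz' : (2 * n + m - l : ℝ) = 0 := by exact_mod_cast hz
    rw [this, hz'] at e1
    linarith
  · omega

end Tiling
end Reptile
-- From similarities of the plane to tilings
namespace Reptile

open Filter Topology

/-- Cartesian coordinates of the plane with unit length `κ`. -/
structure Frame (ψ : ℝ → ℝ → Plane) (κ : ℝ) : Prop where
  pos : 0 < κ
  sur : ∀ z, ∃ x y, ψ x y = z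
  dist_sq : ∀ x y x' y', dist (ψ x y) (ψ x' y') ^ 2 = κ ^ 2 * ((x - x') ^ 2 + (y - y') ^ 2)

lemma Frame.inj {ψ : ℝ → ℝ → Plane} {κ : ℝ} (h : Frame ψ κ) {x y x' y' : ℝ}
    (e : ψ x y = ψ x' y') : x = x' ∧ y = y' := by
  have := h.dist_sq x y x' y'
  rw [e, dist_self, zero_pow two_ne_zero, zero_eq_mul] at this
  rcases this with h' | h'
  · exact absurd h' (pow_ne_zero _ h.pos.ne')
  · constructor <;> nlinarith [sq_nonneg (x - x'), sq_nonneg (y - y')]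

/-- `f` maps a figure, shrunk by the factor `r`, to the tile with edge `g`. -/
def Pose (ψ : ℝ → ℝ → Plane) (r : ℝ) (f : Plane → Plane) (g : Flag) : Prop :=
  (g.τ = .DA ∧ ∀ x y, f (ψ x y) =
    ψ (r * (g.x + x * g.e - y * g.f)) (r * (g.y + x * g.f + y * g.e))) ∨
  (g.τ = .DC ∧ ∀ x y, f (ψ x y) =
    ψ (r * (g.x + y * g.e - x * g.f)) (r * (g.y + y * g.f + x * g.e)))

/-- The images of the origin and of the two unit points determine the map, since every other image
is known by its distances to these three. The sign of the determinant decides between the types `DA`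
and `DC`. -/
lemma exists_pose {ψ : ℝ → ℝ → Plane} {κ : ℝ} (h : Frame ψ κ) {r : ℝ} (hr : 0 < r)
    {f : Plane → Plane} (hf : ∀ a b, dist (f a) (f b) = r * dist a b) :
    ∃ g : Flag, g.unit ∧ Pose ψ r f g := by
  have sur : ∀ z, ∃ x y, z = ψ (r * x) (r * y) := by
    intro z
    obtain ⟨x, y, rfl⟩ := h.sur z
    exact ⟨x / r, y / r, by rw [mul_div_cancel₀ _ hr.ne', mul_div_cancel₀ _ hr.ne']⟩
  have key : ∀ {x y x' y' z1 z2 w1 w2 : ℝ}, f (ψ x y) = ψ (r * z1) (r * z2) →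
      f (ψ x' y') = ψ (r * w1) (r * w2) →
      (z1 - w1) ^ 2 + (z2 - w2) ^ 2 = (x - x') ^ 2 + (y - y') ^ 2 := by
    intro x y x' y' z1 z2 w1 w2 e1 e2
    have h1 := h.dist_sq (r * z1) (r * z2) (r * w1) (r * w2)
    rw [← e1, ← e2, hf, mul_pow, h.dist_sq] at h1
    have hk := h.pos
    have : r ^ 2 * κ ^ 2 ≠ 0 := by positivity
    apply mul_left_cancel₀ this
    linear_combination -h1
  obtain ⟨c1, c2, hc⟩ := sur (f (ψ 0 0))
  obtain ⟨a1, a2, ha⟩ := sur (f (ψ 1 0))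
  obtain ⟨b1, b2, hb⟩ := sur (f (ψ 0 1))
  have k1 := key ha hc
  have k2 := key hb hc
  have k3 := key ha hb
  have hd : ∃ d1 d2 e1 e2, d1 = a1 - c1 ∧ d2 = a2 - c2 ∧ e1 = b1 - c1 ∧ e2 = b2 - c2 :=
    ⟨_, _, _, _, rfl, rfl, rfl, rfl⟩
  obtain ⟨d1, d2, e1, e2, hd1, hd2, he1, he2⟩ := hd
  have u1 : d1 ^ 2 + d2 ^ 2 = 1 := by rw [hd1, hd2]; linarith
  have u2 : e1 ^ 2 + e2 ^ 2 = 1 := by rw [he1, he2]; linarith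
  have u3 : d1 * e1 + d2 * e2 = 0 := by rw [hd1, hd2, he1, he2]; nlinarith
  have pt : ∀ x y z1 z2, f (ψ x y) = ψ (r * z1) (r * z2) →
      (z1 - c1) * d1 + (z2 - c2) * d2 = x ∧ (z1 - c1) * e1 + (z2 - c2) * e2 = y := by
    intro x y z1 z2 hz
    have l1 := key hz hc
    have l2 := key hz ha
    have l3 := key hz hb
    have ea1 : a1 = c1 + d1 := by linarith
    have ea2 : a2 = c2 + d2 := by linarith
    have eb1 : b1 = c1 + e1 := by linarith
    have eb2 : b2 = c2 + e2 := by linarith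
    rw [ea1, ea2] at l2
    rw [eb1, eb2] at l3
    constructor
    · linear_combination (1/2) * l1 - (1/2) * l2 + (1/2) * u1
    · linear_combination (1/2) * l1 - (1/2) * l3 + (1/2) * u2
  have hδ : (d1 * e2 - d2 * e1) ^ 2 = 1 := by
    linear_combination (e1 ^ 2 + e2 ^ 2) * u1 + u2 - (d1 * e1 + d2 * e2) * u3
  rcases sq_eq_one_iff.1 hδ with hδ | hδ
  · have f1 : e1 = -d2 := by linear_combination d1 * u3 - d2 * hδ - e1 * u1
    have f2 : e2 = d1 := by linear_combination d2 * u3 + d1 * hδ - e2 * u1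
    refine ⟨⟨.DA, c1, c2, d1, d2⟩, u1, .inl ⟨rfl, fun x y => ?_⟩⟩
    obtain ⟨z1, z2, hz⟩ := sur (f (ψ x y))
    obtain ⟨p1, p2⟩ := pt x y z1 z2 hz
    rw [f1, f2] at p2
    rw [hz]
    congr 2
    · linear_combination d1 * p1 - d2 * p2 - (z1 - c1) * u1
    · linear_combination d2 * p1 + d1 * p2 - (z2 - c2) * u1
  · have f1 : d1 = -e2 := by linear_combination e1 * u3 + e2 * hδ - d1 * u2
    have f2 : d2 = e1 := by linear_combination e2 * u3 - e1 * hδ - d2 * u2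
    refine ⟨⟨.DC, c1, c2, e1, e2⟩, u2, .inr ⟨rfl, fun x y => ?_⟩⟩
    obtain ⟨z1, z2, hz⟩ := sur (f (ψ x y))
    obtain ⟨p1, p2⟩ := pt x y z1 z2 hz
    rw [f1, f2] at p1
    rw [hz]
    congr 2
    · linear_combination e1 * p2 - e2 * p1 - (z1 - c1) * u2
    · linear_combination e2 * p2 + e1 * p1 - (z2 - c2) * u2

/-- The edge `DA` of the quadrilateral itself. -/
def baseFlag : Flag := ⟨.DA, 0, 0, 1, 0⟩

variable {p q : ℝ}

lemma imv_poly {u1 u2 : ℝ} (c1 c2 : ℝ) (hu : u1 ^ 2 + u2 ^ 2 = 1) (g : Flag) (X Y : ℝ) :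
    ((g.imv c1 c2 u1 u2).poly p q X Y ↔
      g.poly p q (c1 + u1 * X - u2 * Y) (c2 + u2 * X + u1 * Y)) ∧
    ((g.imv c1 c2 u1 u2).opoly p q X Y ↔
      g.opoly p q (c1 + u1 * X - u2 * Y) (c2 + u2 * X + u1 * Y)) := by
  simp only [Flag.poly, Flag.opoly, ← Flag.imv_st, Flag.imv_hh c1 c2 hu, and_self]

lemma Pose.exists_pre {ψ : ℝ → ℝ → Plane} (P : Par p q) {r : ℝ} {f : Plane → Plane} {g : Flag}
    (hg : g.unit) (h : Pose ψ r f g) (x y : ℝ) : ∃ x' y', f (ψ x' y') = ψ (r * x) (r * y) ∧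
      (baseFlag.poly p q x' y' ↔ g.poly p q x y) ∧
      (baseFlag.opoly p q x' y' ↔ g.opoly p q x y) := by
  obtain ⟨τ, c1, c2, d1, d2⟩ := g
  have hg : d1 ^ 2 + d2 ^ 2 = 1 := hg
  have i1 : c1 + d1 * (d1 * (x - c1) + d2 * (y - c2)) - d2 * (-d2 * (x - c1) + d1 * (y - c2)) = x := by
    linear_combination (x - c1) * hg
  have i2 : c2 + d2 * (d1 * (x - c1) + d2 * (y - c2)) + d1 * (-d2 * (x - c1) + d1 * (y - c2)) = y := by
    linear_combination (y - c2) * hg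
  rcases h with ⟨h1, h2⟩ | ⟨h1, h2⟩
  · simp only at h1 h2
    subst h1
    refine ⟨d1 * (x - c1) + d2 * (y - c2), -d2 * (x - c1) + d1 * (y - c2), ?_, ?_⟩
    · rw [h2]
      congr 2
      · linear_combination i1
      · linear_combination i2
    · have e : baseFlag = Flag.imv c1 c2 d1 d2 ⟨.DA, c1, c2, d1, d2⟩ := by
        ext1 <;> simp only [baseFlag, Flag.imv] <;> linarith
      have := imv_poly (p := p) (q := q) c1 c2 hg ⟨.DA, c1, c2, d1, d2⟩
        (d1 * (x - c1) + d2 * (y - c2)) (-d2 * (x - c1) + d1 * (y - c2))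
      rwa [i1, i2, ← e] at this
  · simp only at h1 h2
    subst h1
    refine ⟨-d2 * (x - c1) + d1 * (y - c2), d1 * (x - c1) + d2 * (y - c2), ?_, ?_⟩
    · rw [h2]
      congr 2
      · linear_combination i1
      · linear_combination i2
    · have e : Flag.swap p q ⟨.CD, 0, 1, 0, -1⟩ = Flag.imv c1 c2 d1 d2 ⟨.DC, c1, c2, d1, d2⟩ := by
        ext1 <;> simp only [Flag.swap, Flag.imv, Ty.bar, Ty.len] <;> linarith
      have e' : (Flag.mk .CD 0 1 0 (-1)).st p q = baseFlag := by
        simp [Flag.st, baseFlag, Ty.nx, Ty.len, Ty.ea, Ang.tc, Ang.ts]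
      have := imv_poly (p := p) (q := q) c1 c2 hg ⟨.DC, c1, c2, d1, d2⟩
        (d1 * (x - c1) + d2 * (y - c2)) (-d2 * (x - c1) + d1 * (y - c2))
      rwa [i1, i2, ← e, Flag.swap_poly P, Flag.swap_opoly P, ← Flag.poly_st P, ← Flag.opoly_st P,
        e'] at this

lemma base_poly_opoly (P : Par p q) (x y : ℝ) : (baseFlag.poly p q x y ↔ 0 ≤ y ∧
    (p + q) * (x - 1) + (p - q) * y ≤ 0 ∧ 0 ≤ (p - q) * x - (p + q) * (y - 1) ∧ 0 ≤ x) ∧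
    (baseFlag.opoly p q x y ↔ 0 < y ∧
    (p + q) * (x - 1) + (p - q) * y < 0 ∧ 0 < (p - q) * x - (p + q) * (y - 1) ∧ 0 < x) := by
  have e1 : baseFlag.st p q = ⟨.AB, 1, 0, -(p - q) / 2, (p + q) / 2⟩ := by
    simp [Flag.st, baseFlag, Ty.nx, Ty.len, Ty.ea, Ang.tc, Ang.ts]
  have e3 : (Flag.mk .CD 0 1 0 (-1)).st p q = baseFlag := by
    simp [Flag.st, baseFlag, Ty.nx, Ty.len, Ty.ea, Ang.tc, Ang.ts]
  have e4 : ((baseFlag.st p q).st p q).st p q = ⟨.CD, 0, 1, 0, -1⟩ := by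
    rw [← e3, Flag.st4 P]
  have e2 : (baseFlag.st p q).st p q = ⟨.BC, 1 + p * (-(p - q) / 2), p * ((p + q) / 2),
      -((p + q) / 2), -((p - q) / 2)⟩ := by
    rw [e1]
    simp only [Flag.st, Ty.nx, Ty.len, Ty.ea, Ang.tc, Ang.ts, Flag.mk.injEq, true_and]
    refine ⟨?_, ?_, ?_⟩ <;> ring
  have h2 := P.h2
  rw [Flag.poly, Flag.opoly, e4, e2, e1]
  simp only [Flag.hh, baseFlag]
  have i3 : 2 * ((y - p * ((p + q) / 2)) * -((p + q) / 2) -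
      (x - (1 + p * (-(p - q) / 2))) * -((p - q) / 2)) = (p - q) * x - (p + q) * (y - 1) := by
    grind
  constructor <;> constructor <;> rintro ⟨h1, h2, h3, h4⟩ <;>
    refine ⟨by linarith, by linarith, by linarith, by linarith⟩

lemma base_poly (P : Par p q) (x y : ℝ) : baseFlag.poly p q x y ↔ 0 ≤ y ∧
    (p + q) * (x - 1) + (p - q) * y ≤ 0 ∧ 0 ≤ (p - q) * x - (p + q) * (y - 1) ∧ 0 ≤ x :=
  (base_poly_opoly P x y).1

lemma base_opoly (P : Par p q) (x y : ℝ) : baseFlag.opoly p q x y ↔ 0 < y ∧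
    (p + q) * (x - 1) + (p - q) * y < 0 ∧ 0 < (p - q) * x - (p + q) * (y - 1) ∧ 0 < x :=
  (base_poly_opoly P x y).2

/-- A dissection of `P` into the images of `P` under similarities of ratio `r`. -/
structure Rep (P : Set Plane) {ι : Type} (f : ι → Plane ≃ᵈ Plane) (r : ℝ) : Prop where
  pos : 0 < r
  lt_one : r < 1
  dist_eq : ∀ i a b, dist (f i a) (f i b) = r * dist a b
  cover : (⋃ i, f i '' P) = P
  disj : ∀ i j, i ≠ j → Disjoint (interior (f i '' P)) (interior (f j '' P))

lemma image_interior (f : Plane ≃ᵈ Plane) (S : Set Plane) :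
    f '' interior S = interior (f '' S) :=
  f.toHomeomorph.image_interior S

/-- Every piece is dissected again in the way the whole is. -/
lemma Rep.comp {P : Set Plane} {ι : Type} {f : ι → Plane ≃ᵈ Plane} {r : ℝ} (h : Rep P f r) :
    Rep P (fun ij : ι × ι => (f ij.2).trans (f ij.1)) (r ^ 2) where
  pos := pow_pos h.pos 2
  lt_one := pow_lt_one₀ h.pos.le h.lt_one two_ne_zero
  dist_eq ij a b := by
    change dist (f ij.1 (f ij.2 a)) (f ij.1 (f ij.2 b)) = _
    rw [h.dist_eq, h.dist_eq]; ring
  cover := by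
    have e : ∀ ij : ι × ι, ((f ij.2).trans (f ij.1)) '' P = f ij.1 '' (f ij.2 '' P) := fun ij => by
      rw [Set.image_image]; rfl
    simp only [e, Set.iUnion_prod', ← Set.image_iUnion, h.cover]
  disj := by
    rintro ⟨i, j⟩ ⟨i', j'⟩ hne
    have e : ∀ i j, ((f j).trans (f i)) '' P = f i '' (f j '' P) := fun i j => by
      rw [Set.image_image]; rfl
    simp only [e]
    by_cases hi : i = i'
    · subst hi
      have : j ≠ j' := fun h => hne (by rw [h])
      rw [← image_interior (f i), ← image_interior (f i)]
      exact (h.disj j j' this).image (f i).injective.injOn (Set.subset_univ _) (Set.subset_univ _)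
    · have sub : ∀ i j, f i '' (f j '' P) ⊆ f i '' P := fun i j =>
        Set.image_mono ((Set.subset_iUnion (fun j => f j '' P) j).trans h.cover.le)
      exact (h.disj i i' hi).mono (interior_mono (sub i j)) (interior_mono (sub i' j'))

lemma mem_interior_of_opoly {ψ : ℝ → ℝ → Plane} {κ : ℝ} (h : Frame ψ κ) {P : Set Plane}
    (hP : ∀ x y, ψ x y ∈ P ↔ baseFlag.poly p q x y) {x y : ℝ} (ho : baseFlag.opoly p q x y) :
    ψ x y ∈ interior P := by
  have hopen : IsOpen {z : ℝ × ℝ | baseFlag.opoly p q z.1 z.2} := by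
    have : ∀ g : Flag, IsOpen {z : ℝ × ℝ | 0 < g.hh z.1 z.2} := fun g =>
      isOpen_lt continuous_const (by simp only [Flag.hh]; fun_prop)
    exact (this _).inter ((this _).inter ((this _).inter (this _)))
  obtain ⟨ε, hε, hb⟩ := Metric.isOpen_iff.1 hopen (x, y) ho
  have hκ := h.pos
  refine mem_interior.2 ⟨Metric.ball (ψ x y) (κ * ε), ?_, Metric.isOpen_ball,
    Metric.mem_ball_self (by positivity)⟩
  intro z hz
  obtain ⟨x', y', rfl⟩ := h.sur z
  rw [hP]
  refine Flag.opoly.poly (hb (a := (x', y')) ?_)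
  have hd := h.dist_sq x' y' x y
  rw [Metric.mem_ball] at hz
  have : dist (ψ x' y') (ψ x y) ^ 2 < (κ * ε) ^ 2 := by
    have := dist_nonneg (x := ψ x' y') (y := ψ x y)
    gcongr
  rw [hd, mul_pow] at this
  have := lt_of_mul_lt_mul_left this (by positivity)
  rw [Metric.mem_ball, Prod.dist_eq, max_lt_iff]
  simp only [Real.dist_eq]
  constructor <;> apply abs_lt_of_sq_lt_sq _ hε.le <;>
    nlinarith [sq_nonneg (x' - x), sq_nonneg (y' - y)]

/-- Coordinates are divided by r: the pieces become unit tiles and the whole has sides CD = DA =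
1/r. -/
lemma Rep.exists_tiling {ψ : ℝ → ℝ → Plane} {κ : ℝ} (h : Frame ψ κ) (Pa : Par p q) {P : Set Plane}
    (hP : ∀ x y, ψ x y ∈ P ↔ baseFlag.poly p q x y) {ι : Type} [Finite ι]
    {f : ι → Plane ≃ᵈ Plane} {r : ℝ} (hR : Rep P f r) (g : ι → Flag) (hg : ∀ i, (g i).unit)
    (hp : ∀ i, Pose ψ r (f i) (g i)) : ∃ T : Tiling p q, T.IsBig (1 / r) ∧
      (∀ i, T.HasFlag (g i)) ∧ ∀ k, T.HasFlag k → ∃ i n, (Flag.st p q)^[n] (g i) = k := by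
  have hr := hR.pos
  let T : Tiling p q :=
    { par := Pa
      Q := fun x y => baseFlag.poly p q (r * x) (r * y)
      conv := by
        intro x y x' y' t h h' h0 h1
        have key : ∀ k : Flag, 0 ≤ k.hh (r * x) (r * y) → 0 ≤ k.hh (r * x') (r * y') →
            0 ≤ k.hh (r * (x + t * (x' - x))) (r * (y + t * (y' - y))) := by
          intro k hk hk'
          have e : k.hh (r * (x + t * (x' - x))) (r * (y + t * (y' - y))) =
              (1 - t) * k.hh (r * x) (r * y) + t * k.hh (r * x') (r * y') := by
            simp only [Flag.hh]; ring
          rw [e]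
          have := mul_nonneg (sub_nonneg.2 h1) hk
          have := mul_nonneg h0 hk'
          linarith
        exact ⟨key _ h.1 h'.1, key _ h.2.1 h'.2.1, key _ h.2.2.1 h'.2.2.1, key _ h.2.2.2 h'.2.2.2⟩
      ι := ι
      fin := inferInstance
      tile := g
      unit := hg
      disj := by
        intro i j hij x y hi hj
        obtain ⟨x1, y1, e1, -, o1⟩ := (hp i).exists_pre Pa (hg i) x y
        obtain ⟨x2, y2, e2, -, o2⟩ := (hp j).exists_pre Pa (hg j) x y
        have m1 := mem_interior_of_opoly h hP (o1.2 hi)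
        have m2 := mem_interior_of_opoly h hP (o2.2 hj)
        have n1 := Set.mem_image_of_mem (f i) m1
        have n2 := Set.mem_image_of_mem (f j) m2
        rw [e1, image_interior] at n1
        rw [e2, image_interior] at n2
        exact Set.disjoint_left.1 (hR.disj i j hij) n1 n2
      cover := by
        intro x y
        rw [← hP, ← hR.cover, Set.mem_iUnion]
        refine exists_congr fun i => ?_
        obtain ⟨x1, y1, e1, o1, -⟩ := (hp i).exists_pre Pa (hg i) x y
        rw [← e1, (f i).injective.mem_set_image, hP, o1] }
  refine ⟨T, ?_, fun i => ⟨i, 0, rfl⟩, fun k hk => hk⟩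
  have Qi : ∀ x y, T.Q x y ↔ 0 ≤ r * y ∧
      (p + q) * (r * x - 1) + (p - q) * (r * y) ≤ 0 ∧
      0 ≤ (p - q) * (r * x) - (p + q) * (r * y - 1) ∧ 0 ≤ r * x := fun x y => base_poly Pa _ _
  have mm := Pa.m_pos
  have hs := Pa.s_gt
  have hq := Pa.hq
  have hpq := Pa.hpq
  have h2 := Pa.h2
  have rr : r * (1 / r) = 1 := by field_simp
  constructor
  · rw [lt_div_iff₀ hr]; linarith [hR.lt_one]
  · intro x y hxy
    exact nonneg_of_mul_nonneg_right ((Qi x y).1 hxy).2.2.2 hr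
  · intro x y hxy
    exact nonneg_of_mul_nonneg_right ((Qi x y).1 hxy).1 hr
  · intro t h0 h1
    have h3 : r * t ≤ 1 := by
      rw [← rr]; exact mul_le_mul_of_nonneg_left h1 hr.le
    have h4 : 0 ≤ r * t := by positivity
    rw [Qi]
    refine ⟨h4, ?_, ?_, by simp⟩
    · nlinarith
    · nlinarith
  · intro t h0 h1
    have h3 : r * t ≤ 1 := by
      rw [← rr]; exact mul_le_mul_of_nonneg_left h1 hr.le
    have h4 : 0 ≤ r * t := by positivity
    rw [Qi]
    refine ⟨by simp, ?_, ?_, h4⟩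
    · nlinarith
    · nlinarith
  · intro x y hxy
    have h3 := ((Qi x y).1 hxy).2.1
    have : r * ((p + q) * (x - 1 / r) + (p - q) * y) ≤ 0 := by
      refine le_of_eq_of_le ?_ h3
      linear_combination -(p + q) * rr
    by_contra hn
    have := mul_pos hr (not_le.1 hn)
    linarith
  · intro x y hxy
    have h3 := ((Qi x y).1 hxy).2.2.1
    refine nonneg_of_mul_nonneg_right (a := r) ?_ hr
    refine h3.trans_eq ?_
    linear_combination -(p + q) * rr
  · rw [Qi]
    have e1 : r * (1 / r * (q * (p + q) / 2)) = q * (p + q) / 2 := by rw [← mul_assoc, rr, one_mul]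
    have e2 : r * (1 / r + 1 / r * (q * (p - q) / 2)) = 1 + q * (p - q) / 2 := by
      rw [mul_add, ← mul_assoc, rr, one_mul]
    rw [e1, e2]
    have e3 : (p + q) * (q * (p + q) / 2 - 1) + (p - q) * (1 + q * (p - q) / 2) = 0 := by grind
    have e4 : (p - q) * (q * (p + q) / 2) - (p + q) * (1 + q * (p - q) / 2 - 1) = 0 := by ring
    rw [e3, e4]
    refine ⟨by positivity, le_rfl, le_rfl, by positivity⟩

end Reptile
-- The two contradictions and the equality of the ratios
namespace Reptile

open Filter Topology

variable {p q : ℝ}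

lemma iterate_st_cases (Pa : Par p q) (g : Flag) (n : ℕ) : (Flag.st p q)^[n] g = g ∨
    (Flag.st p q)^[n] g = g.st p q ∨ (Flag.st p q)^[n] g = (g.st p q).st p q ∨
    (Flag.st p q)^[n] g = ((g.st p q).st p q).st p q := by
  induction n with
  | zero => exact .inl rfl
  | succ n ih =>
    rw [Function.iterate_succ_apply']
    rcases ih with h | h | h | h <;> rw [h]
    · exact .inr (.inl rfl)
    · exact .inr (.inr (.inl rfl))
    · exact .inr (.inr (.inr rfl))
    · exact .inl (Flag.st4 Pa g)

/-- The tile in the corner A is a reflected copy, given by some `f i`. In the dissection repeated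
twice the piece of `f i ∘ f i` is homothetic to the whole and sits in the same corner. -/
lemma Rep.false_of_ne {ψ : ℝ → ℝ → Plane} {κ : ℝ} (h : Frame ψ κ) (Pa : Par p q) {P : Set Plane}
    (hP : ∀ x y, ψ x y ∈ P ↔ baseFlag.poly p q x y) {ι : Type} [Finite ι]
    {f : ι → Plane ≃ᵈ Plane} {r : ℝ} (hR : Rep P f r) (ne : p ≠ 1 + q) : False := by
  have hr := hR.pos
  choose g hg hp using fun i => exists_pose h hr (hR.dist_eq i)
  obtain ⟨T, B, -, hT⟩ := hR.exists_tiling h Pa hP g hg hp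
  rcases B.corner_A with hA | hA
  · exact B.not_homothetic ne hA
  obtain ⟨i, n, hn⟩ := hT _ hA
  have hτ := hp i
  have h2 := Pa.h2
  -- A pose has type `DA` or `DC`, and among these only `DC` leads to `BA`, in two steps.
  have hgi : g i = ⟨.DC, 1 / r - (p - q) / 2, (p + q) / 2, -(p + q) / 2, -(p - q) / 2⟩ := by
    have hc := iterate_st_cases Pa (g i) n
    rw [hn] at hc
    have hst : (g i).τ = .DA ∨ (g i).τ = .DC := hτ.imp And.left And.left
    have hs : ((g i).st p q).st p q = ⟨.BA, 1 / r - p, 0, 1, 0⟩ := by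
      rcases hc with hc | hc | hc | hc
      · rw [← hc] at hst; simp at hst
      · have := congrArg Flag.τ hc
        rcases hst with e | e <;> simp [Flag.st, e, Ty.nx] at this
      · exact hc.symm
      · have := congrArg Flag.τ hc
        rcases hst with e | e <;> simp [Flag.st, e, Ty.nx] at this
    rw [← Flag.st4 Pa (g i), hs]
    simp only [Flag.st, Ty.nx, Ty.len, Ty.ea, Ang.tc, Ang.ts, Flag.mk.injEq, true_and]
    refine ⟨?_, ?_, ?_, ?_⟩ <;> ring
  have hf : ∀ x y, f i (ψ x y) =
      ψ (r * (1 / r - (p - q) / 2 + y * (-(p + q) / 2) - x * (-(p - q) / 2)))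
        (r * ((p + q) / 2 + y * (-(p - q) / 2) + x * (-(p + q) / 2))) := by
    rw [hgi] at hτ
    rcases hτ with ⟨h1, -⟩ | ⟨-, h2⟩
    · cases h1
    · exact h2
  have hR2 := hR.comp
  -- For the pair (i, i) the pose is prescribed, so that the new tiling visibly contains the
  -- forbidden edge.
  have hex : ∀ ij : ι × ι, ∃ g : Flag, g.unit ∧ Pose ψ (r ^ 2) ((f ij.2).trans (f ij.1)) g ∧
      (ij = (i, i) → g = ⟨.DA, 1 / r ^ 2 - 1, 0, 1, 0⟩) := by
    intro ij
    by_cases hij : ij = (i, i)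
    · subst hij
      refine ⟨_, ?_, .inl ⟨?_, ?_⟩, fun _ => rfl⟩
      · simp [Flag.unit]
      · rfl
      · intro x y
        change f i (f i (ψ x y)) = _
        have rr : r * (1 / r) = 1 := by field_simp
        have rr2 : r ^ 2 * (1 / r ^ 2) = 1 := by field_simp
        rw [hf, hf]
        congr 1
        · linear_combination (1 - r * (q - p) / 2) * rr - rr2 + r ^ 2 * (x - 1) * h2 / 2
        · linear_combination (-r * (p + q) / 2) * rr + r ^ 2 * y * h2 / 2
    · obtain ⟨g, h1, h2⟩ := exists_pose h hR2.pos (hR2.dist_eq ij)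
      exact ⟨g, h1, h2, fun h => absurd h hij⟩
  choose g2 hg2 hp2 he using hex
  obtain ⟨T2, B2, hT2, -⟩ := hR2.exists_tiling h Pa hP g2 hg2 hp2
  refine B2.not_homothetic ne ?_
  have := hT2 (i, i)
  rwa [he _ rfl] at this

lemma Rep.false_of_natCast {ψ : ℝ → ℝ → Plane} {κ : ℝ} (h : Frame ψ κ) (Pa : Par p q)
    {P : Set Plane} (hP : ∀ x y, ψ x y ∈ P ↔ baseFlag.poly p q x y) {ι : Type} [Finite ι]
    {f : ι → Plane ≃ᵈ Plane} {r : ℝ} (hR : Rep P f r) {k : ℕ} (hk : k * r ^ 2 = 1) : False := by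
  by_cases e : p = 1 + q
  · have hr := hR.pos
    choose g hg hp using fun i => exists_pose h hr (hR.dist_eq i)
    obtain ⟨T, B, -⟩ := hR.exists_tiling h Pa hP g hg hp
    refine B.not_sixty e k ?_
    field_simp
    linarith
  · exact hR.false_of_ne h Pa hP e

open MeasureTheory Module in
lemma hausdorffMeasure_image_dilationEquiv {X : Type*} [MetricSpace X] [MeasurableSpace X]
    [BorelSpace X] (f : X ≃ᵈ X) {r : NNReal} (hr : 0 < r)
    (hf : ∀ a b, dist (f a) (f b) = r * dist a b) {d : ℝ} (hd : 0 ≤ d) (S : Set X) :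
    μH[d] (f '' S) = (r : ENNReal) ^ d * μH[d] S := by
  apply le_antisymm
  · exact (LipschitzWith.of_dist_le_mul fun a b => (hf a b).le).hausdorffMeasure_image_le hd S
  · have : AntilipschitzWith r⁻¹ f := AntilipschitzWith.of_le_mul_dist fun a b => by
      rw [hf, NNReal.coe_inv, inv_mul_cancel_left₀ (NNReal.coe_ne_zero.2 hr.ne')]
    have := this.le_hausdorffMeasure_image hd S
    rw [ENNReal.coe_inv hr.ne', ENNReal.inv_rpow] at this
    have h0 : (r : ENNReal) ^ d ≠ 0 := by simp [ENNReal.rpow_eq_zero_iff, hr.ne']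
    have h1 : (r : ENNReal) ^ d ≠ ⊤ := ENNReal.rpow_ne_top_of_nonneg hd ENNReal.coe_ne_top
    rwa [← ENNReal.div_eq_inv_mul, ENNReal.le_div_iff_mul_le (.inl h0) (.inl h1),
      mul_comm] at this

open MeasureTheory Module in
-- Congruent pieces have equal area, hence equal ratios. The frontier of a convex set is null, so
-- the areas of the pieces add up to that of the whole and k r² = 1. Hausdorff measure is used
-- because its behaviour under isometries and dilations needs no linear structure.
lemma exists_rep {P : Set Plane} (hconv : Convex ℝ P) (hcomp : IsCompact P)
    (hint : (interior P).Nonempty) (h : IsReptile P) :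
    ∃ (k : ℕ) (f : Fin k → Plane ≃ᵈ Plane) (r : ℝ), Rep P f r ∧ k * r ^ 2 = 1 := by
  obtain ⟨k, hk, T, hcov, hdis, hcong, hsim⟩ := h
  choose f hf using hsim
  have hd : ((finrank ℝ Plane : ℕ) : ℝ) = 2 := by simp
  have : (μH[2] : Measure Plane).IsAddHaarMeasure := by
    rw [← hd]; infer_instance
  set μ : Measure Plane := μH[2] with hμ
  have hrat : ∀ i, ∃ r : NNReal, 0 < r ∧ ∀ a b, dist (f i a) (f i b) = r * dist a b := fun i =>
    ⟨Dilation.ratio (f i), Dilation.ratio_pos _, Dilation.dist_eq (f i)⟩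
  choose r hr hdist using hrat
  have hvol : ∀ i S, μ (f i '' S) = ((r i ^ 2 : NNReal) : ENNReal) * μ S := by
    intro i S
    rw [hμ, hausdorffMeasure_image_dilationEquiv (f i) (hr i) (hdist i) zero_le_two]
    norm_cast
  have h0 : μ P ≠ 0 := fun h => (hint.mono subset_rfl).elim fun x hx =>
    (isOpen_interior.measure_pos μ ⟨x, hx⟩).ne' (measure_mono_null interior_subset h)
  have h1 : μ P ≠ ⊤ := hcomp.measure_lt_top.ne
  have hPi : μ (interior P) = μ P :=
    measure_interior_of_null_frontier (hconv.addHaar_frontier μ)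
  have i0 : (0 : ℕ) < k := by omega
  let o : Fin k := ⟨0, i0⟩
  have hre : ∀ i, r i = r o := by
    intro i
    obtain ⟨e, he⟩ := hcong o i
    have : μ (T i) = μ (T o) := by
      rw [← he, hμ]; exact e.hausdorffMeasure_image 2 _
    rw [← hf, ← hf, hvol, hvol, ENNReal.mul_left_inj h0 h1, ENNReal.coe_inj] at this
    exact (pow_left_inj₀ zero_le zero_le two_ne_zero).1 this
  have hsum : (k : ENNReal) * ((r o ^ 2 : NNReal) : ENNReal) * μ P = μ P := by
    have e : ∑ i : Fin k, μ (f i '' P) = (k : ENNReal) * ((r o ^ 2 : NNReal) : ENNReal) * μ P := by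
      simp only [hvol, hre]
      simp [mul_assoc]
    rw [← e]
    apply le_antisymm
    · have e' : ∀ i, μ (f i '' P) = μ (f i '' interior P) := fun i => by rw [hvol, hvol, hPi]
      simp only [e', image_interior]
      rw [← tsum_fintype (L := .unconditional _), ← measure_iUnion]
      · refine measure_mono (Set.iUnion_subset fun i => interior_subset.trans ?_)
        rw [hf]
        exact (Set.subset_iUnion T i).trans hcov.le
      · intro i j hij
        simp only [Function.onFun, hf]
        exact hdis i j hij
      · exact fun i => isOpen_interior.measurableSet
    · conv_lhs => rw [← hcov]
      simp only [hf]
      exact measure_iUnion_fintype_le μ T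
  have hkr : (k : ℝ) * (r o : ℝ) ^ 2 = 1 := by
    have : (k : ENNReal) * ((r o ^ 2 : NNReal) : ENNReal) = 1 := by
      rw [← ENNReal.mul_left_inj h0 h1, hsum, one_mul]
    exact_mod_cast this
  refine ⟨k, f, r o, ⟨hr o, ?_, ?_, ?_, ?_⟩, hkr⟩
  · have hk' : (2 : ℝ) ≤ k := by exact_mod_cast hk
    have : (0 : ℝ) < r o := hr o
    nlinarith
  · intro i a b
    rw [hdist, hre]
  · simp only [hf, hcov]
  · simp only [hf]
    exact hdis

end Reptile
-- Coordinates for the given quadrilateral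
namespace Reptile

open Filter Topology

variable {p q : ℝ}

lemma frame_of_orthogonal {u v : Plane} {κ : ℝ} (hκ : 0 < κ) (hu : ‖u‖ = κ) (hv : ‖v‖ = κ)
    (huv : inner ℝ u v = 0) (D : Plane) : Frame (fun x y => D + x • u + y • v) κ where
  pos := hκ
  sur z := by
    have h1 : u 0 ^ 2 + u 1 ^ 2 = κ ^ 2 := by
      rw [← hu, EuclideanSpace.real_norm_sq_eq, Fin.sum_univ_two]
    have h2 : v 0 ^ 2 + v 1 ^ 2 = κ ^ 2 := by
      rw [← hv, EuclideanSpace.real_norm_sq_eq, Fin.sum_univ_two]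
    have h3 : u 0 * v 0 + u 1 * v 1 = 0 := by
      rw [← huv, PiLp.inner_apply, Fin.sum_univ_two]; simp [mul_comm]
    have k0 : κ ^ 2 ≠ 0 := by positivity
    have h4 : u 0 ^ 2 + v 0 ^ 2 = κ ^ 2 := by
      apply mul_left_cancel₀ k0
      linear_combination (u 0 * v 0 - u 1 * v 1) * h3 + u 1 ^ 2 * h2 + (κ ^ 2 - v 0 ^ 2) * h1
    have h5 : u 1 ^ 2 + v 1 ^ 2 = κ ^ 2 := by linarith
    have h6 : u 0 * u 1 + v 0 * v 1 = 0 := by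
      apply mul_left_cancel₀ k0
      linear_combination (u 1 * v 0 + u 0 * v 1) * h3 - u 0 * u 1 * h2 - v 0 * v 1 * h1
    refine ⟨((z 0 - D 0) * u 0 + (z 1 - D 1) * u 1) / κ ^ 2,
      ((z 0 - D 0) * v 0 + (z 1 - D 1) * v 1) / κ ^ 2, ?_⟩
    ext i
    fin_cases i
    · simp only [Fin.zero_eta, PiLp.add_apply, PiLp.smul_apply, smul_eq_mul]
      field_simp
      linear_combination (z 0 - D 0) * h4 + (z 1 - D 1) * h6
    · simp only [Fin.mk_one, PiLp.add_apply, PiLp.smul_apply, smul_eq_mul]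
      field_simp
      linear_combination (z 0 - D 0) * h6 + (z 1 - D 1) * h5
  dist_sq x y x' y' := by
    have e : D + x • u + y • v - (D + x' • u + y' • v) = (x - x') • u + (y - y') • v := by module
    rw [dist_eq_norm, e, norm_add_sq_real, norm_smul, norm_smul, inner_smul_left,
      inner_smul_right, huv, hu, hv, mul_pow, mul_pow, Real.norm_eq_abs, Real.norm_eq_abs, sq_abs,
      sq_abs]
    ring

lemma three_mem {E : Type*} [AddCommGroup E] [Module ℝ E] {S : Set E} (hS : Convex ℝ S)
    {a b c : E} (ha : a ∈ S) (hb : b ∈ S) (hc : c ∈ S) {α β γ : ℝ} (h1 : 0 ≤ α) (h2 : 0 ≤ β)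
    (h3 : 0 ≤ γ) (h : α + β + γ = 1) : α • a + β • b + γ • c ∈ S := by
  have := hS.sum_mem (t := Finset.univ) (w := ![α, β, γ]) (z := ![a, b, c])
    (by intro i _; fin_cases i <;> simpa) (by simp [Fin.sum_univ_three, h])
    (by intro i _; fin_cases i <;> simpa)
  simpa [Fin.sum_univ_three] using this

lemma mem_region (Pa : Par p q) {u v D : Plane} {κ : ℝ}
    (hF : Frame (fun x y => D + x • u + y • v) κ) (x y : ℝ) :
    D + x • u + y • v ∈ convexHull ℝ {D + u, D + (q * (p + q) / 2) • u +
      (1 + q * (p - q) / 2) • v, D + v, D} ↔ baseFlag.poly p q x y := by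
  have hq := Pa.hq
  have hpq := Pa.hpq
  have h2 := Pa.h2
  have hp := Pa.pp
  have hs := Pa.s_gt
  constructor
  · intro h
    have hconv : Convex ℝ {z | ∃ x y, D + x • u + y • v = z ∧ baseFlag.poly p q x y} := by
      rintro _ ⟨x, y, rfl, h⟩ _ ⟨x', y', rfl, h'⟩ a b ha hb hab
      refine ⟨a * x + b * x', a * y + b * y', ?_, ?_⟩
      · obtain rfl : b = 1 - a := by linarith
        module
      · rw [base_poly Pa] at h h' ⊢
        obtain ⟨l1, l2, l3, l4⟩ := h
        obtain ⟨r1, r2, r3, r4⟩ := h'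
        refine ⟨by positivity, ?_, ?_, by positivity⟩
        · refine le_of_eq_of_le ?_ (add_nonpos (mul_nonpos_of_nonneg_of_nonpos ha l2)
            (mul_nonpos_of_nonneg_of_nonpos hb r2))
          linear_combination (p + q) * hab
        · refine (add_nonneg (mul_nonneg ha l3) (mul_nonneg hb r3)).trans_eq ?_
          linear_combination (p + q) * hab
    have hsub : convexHull ℝ {D + u, D + (q * (p + q) / 2) • u +
        (1 + q * (p - q) / 2) • v, D + v, D} ⊆
        {z | ∃ x y, D + x • u + y • v = z ∧ baseFlag.poly p q x y} := by
      refine convexHull_min ?_ hconv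
      rintro z (rfl | rfl | rfl | rfl)
      · refine ⟨1, 0, by simp, (base_poly Pa _ _).2 ?_⟩
        refine ⟨le_rfl, ?_, ?_, zero_le_one⟩ <;> linarith
      · refine ⟨_, _, rfl, (base_poly Pa _ _).2 ⟨?_, ?_, ?_, by positivity⟩⟩
        · nlinarith
        · refine le_of_eq ?_
          grind
        · refine le_of_eq ?_
          ring
      · refine ⟨0, 1, by simp, (base_poly Pa _ _).2 ?_⟩
        refine ⟨zero_le_one, ?_, ?_, le_rfl⟩ <;> linarith
      · refine ⟨0, 0, by simp, (base_poly Pa _ _).2 ?_⟩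
        refine ⟨le_rfl, ?_, ?_, le_rfl⟩ <;> linarith
    obtain ⟨x', y', e, h'⟩ := hsub h
    obtain ⟨rfl, rfl⟩ := hF.inj e
    exact h'
  · rw [base_poly Pa]
    rintro ⟨h1, h3, h4, h5⟩
    have mem := subset_convexHull ℝ ({D + u, D + (q * (p + q) / 2) • u +
      (1 + q * (p - q) / 2) • v, D + v, D} : Set Plane)
    have cv := convex_convexHull ℝ ({D + u, D + (q * (p + q) / 2) • u +
      (1 + q * (p - q) / 2) • v, D + v, D} : Set Plane)
    have mA := mem (.inl rfl)
    have mB := mem (.inr (.inl rfl))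
    have mC := mem (.inr (.inr (.inl rfl)))
    have mD := mem (.inr (.inr (.inr rfl)))
    -- The diagonal AC splits the region into the triangles ACD and ABC. In the second one the
    -- weight of B is (x + y − 1)/(pq), as the coordinates of B have sum 1 + pq.
    by_cases hxy : x + y ≤ 1
    · have := three_mem cv mA mC mD h5 h1 (sub_nonneg.2 hxy) (by ring)
      convert this using 1
      module
    · have hb : 0 ≤ (x + y - 1) / (p * q) := div_nonneg (by linarith) (by positivity)
      have ha : 0 ≤ x - (x + y - 1) / (p * q) * (q * (p + q) / 2) := by
        have : x - (x + y - 1) / (p * q) * (q * (p + q) / 2) =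
            ((p - q) * x - (p + q) * (y - 1)) / (2 * p) := by field_simp; ring
        rw [this]; positivity
      have hc : 0 ≤ y - (x + y - 1) / (p * q) * (1 + q * (p - q) / 2) := by
        have : y - (x + y - 1) / (p * q) * (1 + q * (p - q) / 2) =
            -((p + q) * (x - 1) + (p - q) * y) / (2 * q) := by
          have : 1 + q * (p - q) / 2 = p * (p + q) / 2 := by linear_combination -h2 / 2
          rw [this]; field_simp; ring
        rw [this]
        exact div_nonneg (neg_nonneg.2 h3) (by positivity)
      have hsum : x - (x + y - 1) / (p * q) * (q * (p + q) / 2) + (x + y - 1) / (p * q) +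
          (y - (x + y - 1) / (p * q) * (1 + q * (p - q) / 2)) = 1 := by
        field_simp
        ring
      convert three_mem cv mA mB mC ha hb hc hsum using 1
      generalize (x + y - 1) / (p * q) = β at hsum ⊢
      nth_rewrite 1 [← one_smul ℝ D, ← hsum]
      module

/-- If B has coordinates (b, c), then its distances from A and C have squares 1 + (c − b) and 1 − (c
− b), which gives p and q. -/
lemma not_isReptile {u v : Plane} {κ : ℝ} (hκ : 0 < κ) (hu : ‖u‖ = κ) (hv : ‖v‖ = κ)
    (huv : inner ℝ u v = 0) (D : Plane) {b c : ℝ} (h : b ^ 2 + c ^ 2 = b + c) (hb : 0 < b)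
    (hbc : b < c) (h1 : 1 < b + c) :
    ¬ IsReptile (convexHull ℝ {D + u, D + b • u + c • v, D + v, D}) := by
  have hF := frame_of_orthogonal hκ hu hv huv D
  have hlt : c - b < 1 := by nlinarith
  have sp : √(1 + (c - b)) ^ 2 = 1 + (c - b) := Real.sq_sqrt (by linarith)
  have sq : √(1 - (c - b)) ^ 2 = 1 - (c - b) := Real.sq_sqrt (by linarith)
  have spq : √(1 + (c - b)) * √(1 - (c - b)) = b + c - 1 := by
    rw [← Real.sqrt_mul (by linarith), ← Real.sqrt_sq (sub_nonneg.2 h1.le)]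
    congr 1
    linear_combination -2 * h
  have Pa : Par (√(1 + (c - b))) (√(1 - (c - b))) :=
    ⟨Real.sqrt_pos.2 (by linarith), Real.sqrt_lt_sqrt (by linarith) (by linarith), by linarith⟩
  have hP := mem_region Pa hF
  rw [show √(1 - (c - b)) * (√(1 + (c - b)) + √(1 - (c - b))) / 2 = b by
    linear_combination spq / 2 + sq / 2, show 1 + √(1 - (c - b)) * (√(1 + (c - b)) -
      √(1 - (c - b))) / 2 = c by linear_combination spq / 2 - sq / 2] at hP
  intro hrep
  have hcomp : IsCompact (convexHull ℝ {D + u, D + b • u + c • v, D + v, D}) :=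
    Set.Finite.isCompact_convexHull ℝ (Set.toFinite _)
  have hint : (interior (convexHull ℝ {D + u, D + b • u + c • v, D + v, D})).Nonempty := by
    refine ⟨D + (1 / 2 : ℝ) • u + (1 / 2 : ℝ) • v,
      mem_interior_of_opoly (x := 1 / 2) (y := 1 / 2) hF hP ?_⟩
    rw [base_opoly Pa]
    have := Pa.hq
    have := Pa.pp
    refine ⟨by norm_num, ?_, ?_, by norm_num⟩ <;> linarith
  obtain ⟨k, f, r, hR, hk⟩ := exists_rep (convex_convexHull ℝ _) hcomp hint hrep
  exact hR.false_of_natCast hF Pa hP hk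

end Reptile

theorem lemma6 (A B C D : Plane) (hQ : IsCyclicQuadrilateral A B C D)
    (hcd : dist C D = dist D A)
    (hβ : ∠ A B C = Real.pi / 2) (hδ : ∠ C D A = Real.pi / 2)
    (hsq : ¬ IsSquareQuadrilateral A B C D) :
    ¬ IsReptile (quadRegion A B C D) := by
  have hκ : 0 < dist D A := dist_pos.2 fun h => by
    have := @hQ.injective 3 0 (by simpa using h)
    simp at this
  have hu : ‖A - D‖ = dist D A := by rw [dist_comm, dist_eq_norm]
  have hv : ‖C - D‖ = dist D A := by rw [← hcd, dist_eq_norm]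
  have huv : inner ℝ (A - D) (C - D) = 0 := by
    rw [real_inner_comm]
    exact InnerProductGeometry.inner_eq_zero_iff_angle_eq_pi_div_two _ _ |>.2 hδ
  have hF := Reptile.frame_of_orthogonal hκ hu hv huv D
  obtain ⟨b, c, hB⟩ := hF.sur B
  have eA : D + (1 : ℝ) • (A - D) + (0 : ℝ) • (C - D) = A := by module
  have eC : D + (0 : ℝ) • (A - D) + (1 : ℝ) • (C - D) = C := by module
  have eD : D + (0 : ℝ) • (A - D) + (0 : ℝ) • (C - D) = D := by module
  have dAB := hF.dist_sq 1 0 b c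
  have dBC := hF.dist_sq b c 0 1
  have dAC := hF.dist_sq 1 0 0 1
  have k0 : dist D A ^ 2 ≠ 0 := by positivity
  beta_reduce at hB dAB dBC dAC
  rw [eA, hB] at dAB
  rw [eC, hB] at dBC
  rw [eA, eC] at dAC
  have h : b ^ 2 + c ^ 2 = b + c := by
    have := (EuclideanGeometry.dist_sq_eq_dist_sq_add_dist_sq_iff_angle_eq_pi_div_two A B C).2 hβ
    rw [dist_comm C B, ← sq, ← sq, ← sq, dAC, dAB, dBC] at this
    apply mul_left_cancel₀ k0
    linear_combination -this / 2
  obtain ⟨z, ⟨t, t', ht, ht', htt, rfl⟩, s, s', hs, hs', hss, hz⟩ := hQ.diagonals_cross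
  have hcr : s * b = t ∧ s * c = t' := by
    apply hF.inj
    beta_reduce
    have e1 : t • A + t' • C = D + t • (A - D) + t' • (C - D) := by
      obtain rfl : t' = 1 - t := by linarith
      module
    rw [← e1, ← hz, ← hB]
    obtain rfl : s' = 1 - s := by linarith
    module
  have hb : 0 < b := (mul_pos_iff_of_pos_left hs).1 (hcr.1 ▸ ht)
  have hc : 0 < c := (mul_pos_iff_of_pos_left hs).1 (hcr.2 ▸ ht')
  -- The crossing point of the diagonals is s·(b, c) with coordinate sum 1 and s < 1.
  have h1 : 1 < b + c := by nlinarith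
  rw [quadRegion]
  rcases lt_trichotomy b c with hbc | hbc | hbc
  · have := Reptile.not_isReptile hκ hu hv huv D h hb hbc h1
    rwa [hB, add_sub_cancel, add_sub_cancel] at this
  · exfalso
    subst hbc
    obtain rfl : b = 1 := by nlinarith
    have pyth := fun X Y Z : Plane =>
      EuclideanGeometry.dist_sq_eq_dist_sq_add_dist_sq_iff_angle_eq_pi_div_two X Y Z
    have eq_of_sq : ∀ x y : ℝ, 0 ≤ x → 0 ≤ y → x ^ 2 = y ^ 2 → x = y := fun x y hx hy =>
      (pow_left_inj₀ hx hy two_ne_zero).1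
    have dDB := hF.dist_sq 0 0 1 1
    beta_reduce at dDB
    rw [eD, hB] at dDB
    have hAB : dist A B = dist D A := by
      refine eq_of_sq _ _ dist_nonneg dist_nonneg ?_
      rw [dAB]; ring
    have hBC : dist B C = dist D A := by
      refine eq_of_sq _ _ dist_nonneg dist_nonneg ?_
      rw [dBC]; ring
    refine hsq ⟨by rw [hAB, hBC], by rw [hAB, hcd], by rw [hAB], ?_, hβ, ?_, hδ⟩
    · rw [← pyth, dist_comm B A, hAB, ← sq, dDB]; ring
    · rw [← pyth, dist_comm D C, hcd, hBC, dist_comm B D, ← sq, dDB]; ring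
  -- For c < b the roles of A and C are exchanged.
  · have := Reptile.not_isReptile hκ hv hu (by rwa [real_inner_comm]) D (b := c) (c := b)
      (by linarith) hc hbc (by linarith)
    have e : D + c • (C - D) + b • (A - D) = B := by rw [← hB]; abel
    rw [e, add_sub_cancel, add_sub_cancel] at this
    have e' : ({A, B, C, D} : Set Plane) = {C, B, A, D} := by
      ext z
      simp only [Set.mem_insert_iff, Set.mem_singleton_iff]
      tauto
    rwa [e']
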